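/- For $\varepsilon\in(0,1)$ let $\mathrm{MAXLIN}_\varepsilon$ be the following promise problem. An instance is a system $Ax=b$ of $m\ge 1$ linear equations in $n\ge 1$ variables over $\mathbb F_2$. It is a YES instance if some $x\in\mathbb F_2^n$ satisfies at least $\frac58 m$ of the equations, and a NO instance if every $x\in\mathbb F_2^n$ satisfies at most $(\frac58-\varepsilon)m$ of them. For real $p\ge 1$ and $\gamma\ge 1$ let $\mathrm{SVP}_{p,\gamma}$ be the following promise problem. An instance is a matrix $B\in\mathbb Q^{d\times k}$, $k\ge 1$, with linearly independent columns, generating a lattice $\mathcal L\subset\mathbb R^d$ of rank $k$, together with a length $r>0$, which is specified by the rational number $r^p$. It is a YES instance if $\lambda_1^{(p)}(\mathcal L)\le r$ and a NO instance if $\lambda_1^{(p)}(\mathcal L)>\gamma r$, where $\lambda_1^{(p)}(\mathcal L)$ is the least $\ell_p$ norm of a nonzero vector of $\mathcal L$. **Theorem.** For every real $p>2$ and every $\varepsilon\in(0,1)$ there is a constant $\gamma>1$ such that for every constant $C$ there is a constant $C'$ for which the following holds. There is a polynomial-time randomized algorithm which, on every system of $m\le Cn$ equations in $n$ variables over $\mathbb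 F_2$ ($n,m\ge1$), always outputs an instance of $\mathrm{SVP}_{p,\gamma}$ given by a lattice of rank at most $C'n$, and which is a randomized Karp reduction: every YES instance of $\mathrm{MAXLIN}_\varepsilon$ is mapped to a YES instance of $\mathrm{SVP}_{p,\gamma}$ with probability at least $2/3$, and every NO instance of $\mathrm{MAXLIN}_\varepsilon$ is mapped to a NO instance of $\mathrm{SVP}_{p,\gamma}$ with probability at least $2/3$. -/

import Mathlib

/-! ### Random access machines

A program works on finitely many integer registers and finitely many integer arrays, which are
addressed indirectly through registers.  Every elementary instruction (constant, addition,
subtraction, load, store, output) and every test costs one step.  Without multiplication the bit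
length of the numbers grows by at most one bit per step, up to an additive constant, so polynomial
time on this machine is polynomial time on Turing machines. -/

/-- Structured programs of the random access machine. -/
inductive Prog : Type
  /-- do nothing -/
  | skip : Prog
  /-- `reg i := c` -/
  | const (i : ℕ) (c : ℤ) : Prog
  /-- `reg i := reg j + reg k` -/
  | add (i j k : ℕ) : Prog
  /-- `reg i := reg j - reg k` -/
  | sub (i j k : ℕ) : Prog
  /-- `reg i := array a at address reg j` -/
  | load (i a j : ℕ) : Prog
  /-- `array a at address reg i := reg j` -/
  | store (a i j : ℕ) : Prog
  /-- append `reg i` to the output -/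
  | emit (i : ℕ) : Prog
  /-- sequential composition -/
  | seq (P Q : Prog) : Prog
  /-- if `0 < reg i` then `P` else `Q` -/
  | ite (i : ℕ) (P Q : Prog) : Prog
  /-- while `0 < reg i` do `P` -/
  | loop (i : ℕ) (P : Prog) : Prog

/-- Configurations of the random access machine: registers, arrays, and the output so far. -/
structure RAMState where
  reg : ℕ → ℤ
  mem : ℕ → ℤ → ℤ
  out : List ℤ

namespace RAMState

/-- Assign a value to a register. -/
def setReg (s : RAMState) (i : ℕ) (v : ℤ) : RAMState :=
  { s with reg := Function.update s.reg i v }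

/-- Assign a value to a cell of an array. -/
def setMem (s : RAMState) (a : ℕ) (k v : ℤ) : RAMState :=
  { s with mem := Function.update s.mem a (Function.update (s.mem a) k v) }

/-- Append a value to the output. -/
def write (s : RAMState) (v : ℤ) : RAMState :=
  { s with out := s.out ++ [v] }

/-- The initial configuration: the input is in array `0` and its number of entries in register `0`;
the random bits are in array `1` and their number in register `1`; all else is zero. -/
def init (x : List ℤ) {k : ℕ} (ρ : Fin k → Bool) : RAMState where
  reg i := if i = 0 then x.length else if i = 1 then k else 0
  mem a j :=
    if a = 0 ∧ 0 ≤ j then x.getD j.toNat 0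
    else if a = 1 ∧ 0 ≤ j then
      (if h : j.toNat < k then (if ρ ⟨j.toNat, h⟩ then 1 else 0) else 0)
    else 0
  out := []

end RAMState

/-- `Runs P s t s'`: started in `s`, the program `P` halts after exactly `t` steps in `s'`. -/
inductive Runs : Prog → RAMState → ℕ → RAMState → Prop
  | skip (s : RAMState) : Runs .skip s 1 s
  | const (s : RAMState) (i : ℕ) (c : ℤ) : Runs (.const i c) s 1 (s.setReg i c)
  | add (s : RAMState) (i j k : ℕ) : Runs (.add i j k) s 1 (s.setReg i (s.reg j + s.reg k))
  | sub (s : RAMState) (i j k : ℕ) : Runs (.sub i j k) s 1 (s.setReg i (s.reg j - s.reg k))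
  | load (s : RAMState) (i a j : ℕ) : Runs (.load i a j) s 1 (s.setReg i (s.mem a (s.reg j)))
  | store (s : RAMState) (a i j : ℕ) :
      Runs (.store a i j) s 1 (s.setMem a (s.reg i) (s.reg j))
  | emit (s : RAMState) (i : ℕ) : Runs (.emit i) s 1 (s.write (s.reg i))
  | seq {P Q : Prog} {s s' s'' : RAMState} {t t' : ℕ} (h : Runs P s t s') (h' : Runs Q s' t' s'') :
      Runs (.seq P Q) s (t + t') s''
  | ite_pos {i : ℕ} {P Q : Prog} {s s' : RAMState} {t : ℕ} (hi : 0 < s.reg i)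
      (h : Runs P s t s') : Runs (.ite i P Q) s (t + 1) s'
  | ite_neg {i : ℕ} {P Q : Prog} {s s' : RAMState} {t : ℕ} (hi : ¬ 0 < s.reg i)
      (h : Runs Q s t s') : Runs (.ite i P Q) s (t + 1) s'
  | loop_done {i : ℕ} {P : Prog} {s : RAMState} (hi : ¬ 0 < s.reg i) : Runs (.loop i P) s 1 s
  | loop_step {i : ℕ} {P : Prog} {s s' s'' : RAMState} {t t' : ℕ} (hi : 0 < s.reg i)
      (h : Runs P s t s') (h' : Runs (.loop i P) s' t' s'') : Runs (.loop i P) s (t + t' + 1) s''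

/-- The bit length of a list of integers. -/
def bitSize (x : List ℤ) : ℕ := (x.map fun a => Nat.size a.natAbs + 1).sum

/-! ### Promise problems and randomized Karp reductions -/

/-- A promise problem: a type of instances with an encoding as lists of integers, and the sets of
YES and of NO instances. -/
structure PromiseProblem where
  Inst : Type
  encode : Inst → List ℤ
  yes : Set Inst
  no : Set Inst

/-- The probability of an event over `k` independent fair coin tosses. -/
noncomputable def coinProb {k : ℕ} (E : Set (Fin k → Bool)) : ℝ := (E.ncard : ℝ) / 2 ^ k

/-- A polynomial-time randomized Karp reduction: a program that is given an instance of `X` and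
polynomially many uniform random bits, always outputs an instance of `Y` within polynomially many
steps (both polynomials in the bit length of the encoded input), and sends YES instances to YES
instances and NO instances to NO instances, each with probability at least `2/3`. -/
structure RandomizedKarpReduction (X Y : PromiseProblem) where
  prog : Prog
  coins : Polynomial ℕ
  time : Polynomial ℕ
  map : (x : X.Inst) → (Fin (coins.eval (bitSize (X.encode x))) → Bool) → Y.Inst
  computes : ∀ x ρ, ∃ t s, Runs prog (RAMState.init (X.encode x) ρ) t s ∧
    t ≤ time.eval (bitSize (X.encode x)) ∧ s.out = Y.encode (map x ρ)
  map_yes : ∀ x ∈ X.yes, 2 / 3 ≤ coinProb {ρ | map x ρ ∈ Y.yes}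
  map_no : ∀ x ∈ X.no, 2 / 3 ≤ coinProb {ρ | map x ρ ∈ Y.no}

/-! ### The gap version of MAXLIN over the field with two elements -/

/-- A system `A x = b` of `m ≥ 1` linear equations in `n ≥ 1` variables over `𝔽₂`. -/
structure LinSystem where
  n : ℕ
  m : ℕ
  A : Matrix (Fin m) (Fin n) (ZMod 2)
  b : Fin m → ZMod 2
  n_pos : 0 < n
  m_pos : 0 < m

namespace LinSystem

/-- The number of equations that the assignment `x` satisfies. -/
def numSat (S : LinSystem) (x : Fin S.n → ZMod 2) : ℕ :=
  (Finset.univ.filter fun i => (S.A.mulVec x) i = S.b i).card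

/-- The list `n, m`, the entries of `A` row by row, the entries of `b`. -/
def encode (S : LinSystem) : List ℤ :=
  [(S.n : ℤ), (S.m : ℤ)]
    ++ (List.ofFn fun i => List.ofFn fun j => ((S.A i j).val : ℤ)).flatten
    ++ List.ofFn fun i => ((S.b i).val : ℤ)

end LinSystem

/-- `gap_{c,s} MAXLIN` over `𝔽₂`, on systems with at most `C * n` equations in `n` variables. -/
def gapMaxLin (c s : ℝ) (C : ℕ) : PromiseProblem where
  Inst := {S : LinSystem // S.m ≤ C * S.n}
  encode S := S.1.encode
  yes := {S | ∃ x, c * S.1.m ≤ S.1.numSat x}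
  no := {S | ∀ x, (S.1.numSat x : ℝ) ≤ s * S.1.m}

/-- `MAXLIN_ε`: completeness `5/8`, soundness `5/8 - ε`. -/
noncomputable def maxLin (ε : ℝ) (C : ℕ) : PromiseProblem := gapMaxLin (5 / 8) (5 / 8 - ε) C

/-! ### The approximate shortest vector problem -/

/-- The lattice in `ℝ^d` that the columns of a rational matrix generate. -/
def latticeOf {d n : ℕ} (B : Matrix (Fin d) (Fin n) ℚ) : Submodule ℤ (Fin d → ℝ) :=
  Submodule.span ℤ (Set.range fun j : Fin n => fun i : Fin d => (B i j : ℝ))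

/-- `λ₁^{(p)}(L)`: the least `ℓ_p` norm of a nonzero vector of `L`. -/
noncomputable def lambdaOne (p : ℝ) {d : ℕ} (L : Submodule ℤ (Fin d → ℝ)) : ℝ :=
  sInf {a : ℝ | ∃ v ∈ L, v ≠ 0 ∧ a = ‖WithLp.toLp (ENNReal.ofReal p) v‖}

/-- An input of the shortest vector problem in the `ℓ_p` norm: a basis of a lattice of rank
`rank ≥ 1`, and a length `r > 0`.  The length is given by the rational number `rPow = r ^ p`. -/
structure SVPInput where
  dim : ℕ
  rank : ℕ
  B : Matrix (Fin dim) (Fin rank) ℚ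
  rPow : ℚ
  rank_pos : 0 < rank
  indep : LinearIndependent ℚ B.col
  rPow_pos : 0 < rPow

namespace SVPInput

/-- The length `r` of an input. -/
noncomputable def radius (I : SVPInput) (p : ℝ) : ℝ := (I.rPow : ℝ) ^ (1 / p)

/-- The list `dim, rank`, the entries of `B` row by row, and `rPow`; a rational number is written
as its numerator followed by its denominator. -/
def encode (I : SVPInput) : List ℤ :=
  [(I.dim : ℤ), (I.rank : ℤ)]
    ++ (List.ofFn fun i =>
        (List.ofFn fun j => [(I.B i j).num, ((I.B i j).den : ℤ)]).flatten).flatten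
    ++ [I.rPow.num, (I.rPow.den : ℤ)]

end SVPInput

/-- `SVP_{p,γ}`. -/
noncomputable def svp (p γ : ℝ) : PromiseProblem where
  Inst := SVPInput
  encode := SVPInput.encode
  yes := {I | lambdaOne p (latticeOf I.B) ≤ I.radius p}
  no := {I | γ * I.radius p < lambdaOne p (latticeOf I.B)}

/-! ### One-dimensional theta series -/

/-! For p > 2 the theta series Θ(t) = ∑ exp(-τ|z + t|^p) over the integers can be larger at some
shift t than at 0. Averaged over τ against exp(-κτ), it becomes ∑ 1/(κ + |z + t|^p). Moving t away
from 0 costs O(t^p) = o(t²) at z = 0, whereas convexity gains order t² at z = ±1. In dimension N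
this is an exponential surplus: far more points of ℤ^N lie near the shifted centre than Θ(0)^N
accounts for (`exists_theta_gt`, `exists_dyadic_shift`, `exists_gadget`).

To a system Ax = b of M equations belongs the lattice of the vectors (Dx, Dβ(Ax + sb + 2w), Dz + Js,
Ds), with one N-dimensional block of z per equation. If s = 1 and x satisfies 5/8 of the equations,
every choice of z from Z^M gives a vector whose p-th power norm is at most ρM. In the NO case, the
number of vectors of p-th power norm at most GM is at most exp(τGM) ∑ exp(-τ·cost), and this sum
factors over coordinates (`sum_exp_costPow_le`). For odd s the blocks contribute at most Θ(t)^(NM),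
but at least (3/8 + ε)M violated equations are paid for, more than the YES radius provides for. For
even s nothing needs to be violated, but the blocks contribute only Θ(0)^(NM). In both cases the NO
count is well below |Z|^M.

A random linear form modulo q, with q between the two counts, then separates the cases: only vectors
on which it vanishes stay short, because its value becomes an extra coordinate scaled by q. A union
bound removes all short vectors in the NO case (`three_mul_ncard_le`); a second moment argument
preserves one in the YES case (`two_thirds_le_ncard`). Taking q = 2^(aM) makes fair coins yield
exactly uniform residues. The price is zero divisors: the union bound needs a small nonzero
coefficient in each short vector, and the second moment needs few pairs in Z congruent modulo 2,
which holds because one parity class carries strictly less than the full theta weight.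

The gadget depends only on p and ε, so the rank is O(M) = O(n + m). What remains is an explicit
program that writes the basis, with its running time. -/

/-- A function whose second derivative is at least `c` has second differences at least `c t²`. -/
theorem second_difference_ge {f f' f'' : ℝ → ℝ} {c x t : ℝ} (ht : 0 ≤ t)
    (hf : ∀ u ∈ Set.Icc (x - t) (x + t), HasDerivAt f (f' u) u)
    (hf' : ∀ u ∈ Set.Icc (x - t) (x + t), HasDerivAt f' (f'' u) u)
    (hc : ∀ u ∈ Set.Icc (x - t) (x + t), c ≤ f'' u) :
    c * t ^ 2 ≤ f (x + t) + f (x - t) - 2 * f x := by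
  -- Midpoint convexity at x is the claim, since the subtracted parabola has second difference
  -- exactly c t².
  have hconv : ConvexOn ℝ (Set.Icc (x - t) (x + t)) fun u => f u - c / 2 * u ^ 2 := by
    refine convexOn_of_hasDerivWithinAt2_nonneg (f' := fun u => f' u - c * u)
      (f'' := fun u => f'' u - c) (convex_Icc _ _) ?_ ?_ ?_ ?_
    · refine ContinuousOn.sub (fun u hu => (hf u hu).continuousAt.continuousWithinAt) ?_
      fun_prop
    · intro u hu
      have h := (hf u (interior_subset hu)).sub (((hasDerivAt_id u).pow 2).const_mul (c / 2))
      refine HasDerivAt.hasDerivWithinAt (h.congr_deriv ?_)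
      simp
      ring
    · intro u hu
      have h := (hf' u (interior_subset hu)).sub ((hasDerivAt_id u).const_mul c)
      refine HasDerivAt.hasDerivWithinAt (h.congr_deriv ?_)
      simp
    · intro u hu
      have := hc u (interior_subset hu)
      linarith
  have hl : x - t ∈ Set.Icc (x - t) (x + t) := ⟨le_rfl, by linarith⟩
  have hr : x + t ∈ Set.Icc (x - t) (x + t) := ⟨by linarith, le_rfl⟩
  have h := hconv.2 hl hr (show (0 : ℝ) ≤ 1 / 2 by norm_num) (show (0 : ℝ) ≤ 1 / 2 by norm_num)
    (by norm_num)
  simp only [smul_eq_mul] at h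
  have hx : 1 / 2 * (x - t) + 1 / 2 * (x + t) = x := by ring
  rw [hx] at h
  nlinarith

theorem hasDerivAt_inv_add_rpow {p κ u : ℝ} (hκ : 0 < κ) (hu : 0 < u) :
    HasDerivAt (fun u : ℝ => (κ + u ^ p)⁻¹) (-(p * u ^ (p - 1)) / (κ + u ^ p) ^ 2) u := by
  have h := ((Real.hasDerivAt_rpow_const (p := p) (Or.inl hu.ne')).const_add κ).inv
    (by positivity)
  exact h

/-- The sign is that of (p + 1)u^p - (p - 1)κ, so the function is convex away from 0. -/
theorem hasDerivAt_deriv_inv_add_rpow {p κ u : ℝ} (hκ : 0 < κ) (hu : 0 < u) :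
    HasDerivAt (fun u : ℝ => -(p * u ^ (p - 1)) / (κ + u ^ p) ^ 2)
      (p * u ^ (p - 2) * ((p + 1) * u ^ p - (p - 1) * κ) / (κ + u ^ p) ^ 3) u := by
  have h1 : HasDerivAt (fun u : ℝ => -(p * u ^ (p - 1))) (-(p * ((p - 1) * u ^ (p - 1 - 1)))) u :=
    ((Real.hasDerivAt_rpow_const (p := p - 1) (Or.inl hu.ne')).const_mul p).neg
  have h2 : HasDerivAt (fun u : ℝ => (κ + u ^ p) ^ 2) (2 * (κ + u ^ p) * (p * u ^ (p - 1))) u := by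
    have := ((Real.hasDerivAt_rpow_const (p := p) (Or.inl hu.ne')).const_add κ).fun_pow 2
    simpa using this
  have hpos : 0 < κ + u ^ p := by positivity
  refine (h1.div h2 (by positivity)).congr_deriv ?_
  have e1 : u ^ (p - 1) = u ^ (p - 2) * u := by
    rw [← Real.rpow_add_one hu.ne']; ring_nf
  have e2 : u ^ p = u ^ (p - 2) * u ^ 2 := by
    rw [← Real.rpow_natCast u 2, ← Real.rpow_add hu]; ring_nf
  have e3 : u ^ (p - 1 - 1) = u ^ (p - 2) := by ring_nf
  rw [e3, e1]
  rw [div_eq_div_iff (by positivity) (by positivity)]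
  have hv : u ^ p = u ^ (p - 2) * u ^ 2 := e2
  generalize u ^ (p - 2) = v at *
  rw [hv]
  ring

theorem summable_inv_add_rpow {p κ : ℝ} (hp : 1 < p) (hκ : 0 < κ) (t : ℝ) :
    Summable fun z : ℤ => (κ + |z + t| ^ p)⁻¹ := by
  refine Summable.of_norm_bounded_eventually ((Real.summable_one_div_int_add_rpow t p).2 hp) ?_
  have hfin : Set.Finite {z : ℤ | (z : ℝ) + t = 0} := by
    refine Set.Subsingleton.finite fun a ha b hb => ?_
    simp only [Set.mem_ofPred_eq] at ha hb
    exact_mod_cast (by linarith : (a : ℝ) = b)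
  filter_upwards [hfin.compl_mem_cofinite] with z hz
  have hz' : 0 < |(z : ℝ) + t| := abs_pos.2 hz
  rw [Real.norm_of_nonneg (by positivity), one_div]
  exact inv_anti₀ (by positivity) (by linarith)

/-- The sum is even in the shift, so twice its increment is the sum over z of second differences. At
z = 0 the loss is of order t^p, at z = 1 the gain is at least c t², and elsewhere nothing is lost; p
> 2 makes the gain win for small t. -/
theorem exists_tsum_inv_add_rpow_gt {p : ℝ} (hp : 2 < p) :
    ∃ κ > 0, ∃ a : ℕ, ∑' z : ℤ, (κ + |(z : ℝ)| ^ p)⁻¹ < ∑' z : ℤ, (κ + |z + 1 / (2 : ℝ) ^ a| ^ p)⁻¹ := by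
  -- With this κ the function is convex on u ≥ 1/2, and t ≤ 1/2 keeps the neighbourhoods of all z ≠
  -- 0 in that range.
  set κ : ℝ := (1 / 2) ^ p with hκdef
  have hκ : 0 < κ := by positivity
  -- A lower bound for the second derivative on [1/2, 2], which contains [1 - t, 1 + t].
  set c : ℝ := p * (1 / 2) ^ (p - 2) * κ / (κ + 2 ^ p) ^ 3 with hc
  have hcpos : 0 < c := by positivity
  -- a small dyadic shift
  have hlim : Filter.Tendsto (fun a : ℕ => (1 / (2 : ℝ) ^ a) ^ (p - 2)) Filter.atTop (nhds 0) := by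
    have h1 : Filter.Tendsto (fun a : ℕ => 1 / (2 : ℝ) ^ a) Filter.atTop (nhds 0) := by
      simpa using tendsto_pow_atTop_nhds_zero_of_lt_one (r := (1 / 2 : ℝ)) (by norm_num) (by norm_num)
    have h2 := h1.rpow_const (p := p - 2) (Or.inr (by linarith))
    rwa [Real.zero_rpow (by linarith)] at h2
  -- This bound on t^(p - 2) makes the loss 2t^p/κ² at z = 0 smaller than the gain c t² at z = 1.
  obtain ⟨a, ha, ha1⟩ := ((hlim.eventually (gt_mem_nhds (show 0 < c * κ ^ 2 / 2 by positivity))).and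
    (Filter.eventually_ge_atTop 1)).exists
  refine ⟨κ, hκ, a, ?_⟩
  set t : ℝ := 1 / 2 ^ a with ht
  have ht0 : 0 < t := by positivity
  have ht1 : t ≤ 1 / 2 := by
    rw [ht]
    exact one_div_le_one_div_of_le (by norm_num) (by simpa using pow_le_pow_right₀ (by norm_num : (1 : ℝ) ≤ 2) ha1)
  have hpos : ∀ u : ℝ, 1 / 2 ≤ u → κ ≤ (p + 1) * u ^ p - (p - 1) * κ := by
    intro u hu
    have : κ ≤ u ^ p := Real.rpow_le_rpow (by norm_num) hu (by linarith)
    nlinarith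
  have hsecond : ∀ z : ℝ, 1 ≤ z → 0 ≤ (κ + (z + t) ^ p)⁻¹ + (κ + (z - t) ^ p)⁻¹ - 2 * (κ + z ^ p)⁻¹ := by
    intro z hz
    have := second_difference_ge (c := 0) (x := z) (t := t) ht0.le
      (fun u hu => hasDerivAt_inv_add_rpow (p := p) hκ (by linarith [hu.1]))
      (fun u hu => hasDerivAt_deriv_inv_add_rpow hκ (by linarith [hu.1])) (fun u hu => by
        have hu0 : 1 / 2 ≤ u := by linarith [hu.1]
        have := hpos u hu0
        have hu' : 0 < u := by linarith
        apply div_nonneg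
        · apply mul_nonneg
          · have := Real.rpow_nonneg hu'.le (p - 2)
            nlinarith
          · linarith
        · positivity)
    simpa using this
  have hone : c * t ^ 2 ≤ (κ + (1 + t) ^ p)⁻¹ + (κ + (1 - t) ^ p)⁻¹ - 2 * (κ + 1 ^ p)⁻¹ := by
    refine second_difference_ge (c := c) (x := 1) (t := t) ht0.le
      (fun u hu => hasDerivAt_inv_add_rpow (p := p) hκ (by linarith [hu.1]))
      (fun u hu => hasDerivAt_deriv_inv_add_rpow hκ (by linarith [hu.1])) (fun u hu => ?_)
    have hu0 : 1 / 2 ≤ u := by linarith [hu.1]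
    have hu' : 0 < u := by linarith
    have hu2 : u ≤ 2 := by linarith [hu.2]
    have h1 := hpos u hu0
    have h2 : (1 / 2 : ℝ) ^ (p - 2) ≤ u ^ (p - 2) := Real.rpow_le_rpow (by norm_num) hu0 (by linarith)
    have h3 : u ^ p ≤ 2 ^ p := Real.rpow_le_rpow hu'.le hu2 (by linarith)
    rw [hc]
    have h4 := Real.rpow_nonneg hu'.le p
    have h5 := Real.rpow_nonneg hu'.le (p - 2)
    have h6 : 0 ≤ p * u ^ (p - 2) * ((p + 1) * u ^ p - (p - 1) * κ) :=
      mul_nonneg (mul_nonneg (by linarith) h5) (by linarith)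
    gcongr
  have hzero : -(2 * t ^ p / κ ^ 2) ≤ (κ + t ^ p)⁻¹ + (κ + t ^ p)⁻¹ - 2 * κ⁻¹ := by
    have htp : 0 < t ^ p := by positivity
    have h : κ⁻¹ - (κ + t ^ p)⁻¹ = t ^ p / (κ * (κ + t ^ p)) := by
      field_simp
      ring
    have h2 : t ^ p / (κ * (κ + t ^ p)) ≤ t ^ p / κ ^ 2 := by
      gcongr
      nlinarith
    have h3 : 2 * t ^ p / κ ^ 2 = 2 * (t ^ p / κ ^ 2) := by ring
    linarith
  have hs1 := summable_inv_add_rpow (p := p) (by linarith) hκ t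
  have hs2 := summable_inv_add_rpow (p := p) (by linarith) hκ (-t)
  have hs0 := summable_inv_add_rpow (p := p) (by linarith) hκ 0
  simp only [add_zero, ← sub_eq_add_neg] at hs0 hs2
  have heven : ∑' z : ℤ, (κ + |(z : ℝ) - t| ^ p)⁻¹ = ∑' z : ℤ, (κ + |(z : ℝ) + t| ^ p)⁻¹ := by
    rw [← (Equiv.neg ℤ).tsum_eq]
    refine tsum_congr fun z => ?_
    rw [Equiv.neg_apply, Int.cast_neg, ← abs_neg]
    ring_nf
  have hsum := ((hs1.add hs2).sub (hs0.mul_left 2))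
  have hle := hsum.sum_le_tsum {0, 1} (fun z hz => by
    simp only [Finset.mem_insert, Finset.mem_singleton, not_or] at hz
    rcases lt_or_gt_of_ne hz.1 with hlt | hgt
    · have hz1 : (1 : ℝ) ≤ -(z : ℝ) := by exact_mod_cast (by omega : (1 : ℤ) ≤ -z)
      have := hsecond (-(z : ℝ)) hz1
      rw [abs_of_neg (by linarith : (z : ℝ) + t < 0), abs_of_neg (by linarith : (z : ℝ) - t < 0),
        abs_of_neg (by linarith : (z : ℝ) < 0)]
      have e1 : -((z : ℝ) + t) = -z - t := by ring
      have e2 : -((z : ℝ) - t) = -z + t := by ring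
      rw [e1, e2]
      linarith
    · have hz1 : (1 : ℝ) ≤ z := by exact_mod_cast (by omega : (1 : ℤ) ≤ z)
      have := hsecond z hz1
      rwa [abs_of_pos (by linarith : 0 < (z : ℝ) + t), abs_of_pos (by linarith : 0 < (z : ℝ) - t),
        abs_of_pos (by linarith : 0 < (z : ℝ))])
  rw [(hs1.add hs2).tsum_sub (hs0.mul_left 2), hs1.tsum_add hs2, tsum_mul_left, heven,
    Finset.sum_pair (by norm_num)] at hle
  simp only [Int.cast_zero, zero_add, zero_sub, abs_neg, abs_of_pos ht0, abs_zero, Int.cast_one,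
    Real.zero_rpow (by linarith : p ≠ 0), add_zero, abs_of_pos (by linarith : 0 < 1 + t),
    abs_of_pos (by linarith : 0 < 1 - t), abs_one] at hle
  have hfin : 2 * t ^ p / κ ^ 2 < c * t ^ 2 := by
    have : t ^ p = t ^ (p - 2) * t ^ 2 := by
      rw [← Real.rpow_natCast t 2, ← Real.rpow_add ht0]; ring_nf
    rw [this, div_lt_iff₀ (by positivity)]
    have ht2 : 0 < t ^ 2 := by positivity
    nlinarith
  linarith

/-- The theta series `∑ exp (-τ |z + t| ^ p)`. -/
noncomputable def theta (p τ t : ℝ) : ℝ := ∑' z : ℤ, Real.exp (-(τ * |z + t| ^ p))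

/-- The inequality 1 + x ≤ exp x bounds exp(-τy) by 1/(1 + τy), a term of the series already
treated. -/
theorem summable_theta {p τ : ℝ} (hp : 1 < p) (hτ : 0 < τ) (t : ℝ) :
    Summable fun z : ℤ => Real.exp (-(τ * |z + t| ^ p)) := by
  refine Summable.of_norm_bounded ((summable_inv_add_rpow hp (inv_pos.2 hτ) t).mul_left τ⁻¹) fun z => ?_
  rw [Real.norm_of_nonneg (Real.exp_nonneg _), Real.exp_neg, ← mul_inv]
  refine inv_anti₀ (by positivity) ?_
  have := Real.add_one_le_exp (τ * |(z : ℝ) + t| ^ p)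
  rw [mul_add, mul_inv_cancel₀ hτ.ne']
  linarith

theorem lintegral_exp_mul_exp {κ y : ℝ} (hκ : 0 < κ) (hy : 0 ≤ y) :
    ∫⁻ τ in Set.Ioi (0 : ℝ), ENNReal.ofReal (Real.exp (-(κ * τ)) * Real.exp (-(τ * y)))
      = ENNReal.ofReal (κ + y)⁻¹ := by
  have hneg : -(κ + y) < 0 := by linarith
  have h : ∀ τ : ℝ, Real.exp (-(κ * τ)) * Real.exp (-(τ * y)) = Real.exp (-(κ + y) * τ) := by
    intro τ
    rw [← Real.exp_add]
    ring_nf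
  simp_rw [h]
  rw [← MeasureTheory.ofReal_integral_eq_lintegral_ofReal (integrableOn_exp_mul_Ioi hneg 0)
    (Filter.Eventually.of_forall fun _ => Real.exp_nonneg _), integral_exp_mul_Ioi hneg]
  congr 1
  rw [mul_zero, Real.exp_zero, neg_div_neg_eq, one_div]

/-- The Laplace transform in τ turns exp(-τy) into 1/(κ + y), term by term because all terms are
nonnegative. -/
theorem lintegral_theta {p κ : ℝ} (hp : 1 < p) (hκ : 0 < κ) (t : ℝ) :
    ∫⁻ τ in Set.Ioi (0 : ℝ), ENNReal.ofReal (Real.exp (-(κ * τ)) * theta p τ t)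
      = ENNReal.ofReal (∑' z : ℤ, (κ + |z + t| ^ p)⁻¹) := by
  rw [ENNReal.ofReal_tsum_of_nonneg (fun z => by positivity) (summable_inv_add_rpow hp hκ t)]
  have h1 : ∀ z : ℤ, ENNReal.ofReal (κ + |z + t| ^ p)⁻¹ = ∫⁻ τ in Set.Ioi (0 : ℝ),
      ENNReal.ofReal (Real.exp (-(κ * τ)) * Real.exp (-(τ * |z + t| ^ p))) :=
    fun z => (lintegral_exp_mul_exp hκ (by positivity)).symm
  simp_rw [h1]
  rw [← MeasureTheory.lintegral_tsum fun z => by fun_prop]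
  refine MeasureTheory.setLIntegral_congr_fun measurableSet_Ioi fun τ hτ => ?_
  rw [theta, ← tsum_mul_left, ENNReal.ofReal_tsum_of_nonneg (fun z => by positivity)
    ((summable_theta hp hτ t).mul_left _)]

/-- Otherwise the opposite inequality for all τ > 0 would survive integration against exp(-κτ). -/
theorem exists_theta_gt {p : ℝ} (hp : 2 < p) :
    ∃ τ > 0, ∃ a : ℕ, theta p τ 0 < theta p τ (1 / 2 ^ a) := by
  obtain ⟨κ, hκ, a, h⟩ := exists_tsum_inv_add_rpow_gt hp
  by_contra! hcon
  have hle := MeasureTheory.setLIntegral_mono' (μ := MeasureTheory.volume) measurableSet_Ioi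
    fun τ (hτ : τ ∈ Set.Ioi (0 : ℝ)) => ENNReal.ofReal_le_ofReal
      (mul_le_mul_of_nonneg_left (hcon τ hτ a) (Real.exp_nonneg (-(κ * τ))))
  rw [lintegral_theta (by linarith) hκ, lintegral_theta (by linarith) hκ,
    ENNReal.ofReal_le_ofReal_iff (tsum_nonneg fun z => by positivity)] at hle
  simp only [add_zero] at hle
  linarith

theorem theta_add_int (p τ t : ℝ) (j : ℤ) : theta p τ (t + j) = theta p τ t := by
  rw [theta, theta, ← (Equiv.addRight j).tsum_eq (fun z : ℤ => Real.exp (-(τ * |z + t| ^ p)))]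
  refine tsum_congr fun z => ?_
  rw [Equiv.coe_addRight, Int.cast_add]
  ring_nf

/-- A dyadic shift `J / D` at which the theta series exceeds its value at `0`, whereas its even
multiples do not exceed the value at `0` and its odd multiples do not exceed the value at `J / D`. -/
theorem exists_dyadic_shift {p : ℝ} (hp : 2 < p) :
    ∃ τ > 0, ∃ D J : ℕ, 0 < D ∧ J < D ∧ theta p τ 0 < theta p τ (J / D) ∧
      (∀ s : ℤ, Even s → theta p τ (s * (J / D)) ≤ theta p τ 0) ∧
      ∀ s : ℤ, theta p τ (s * (J / D)) ≤ theta p τ (J / D) := by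
  classical
  obtain ⟨τ, hτ, a₀, ha₀⟩ := exists_theta_gt hp
  have hex : ∃ a : ℕ, ∃ j : ℤ, theta p τ 0 < theta p τ (j / 2 ^ a) := ⟨a₀, 1, by simpa using ha₀⟩
  -- With the least exponent, even multiples of the shift have denominator 2^(a - 1), where no shift
  -- beats 0.
  set a := Nat.find hex with ha
  obtain ⟨j₀, hj₀⟩ := Nat.find_spec hex
  rw [← ha] at hj₀
  have hmod : ∀ j : ℤ, theta p τ (j / 2 ^ a) = theta p τ (((j % 2 ^ a).toNat : ℕ) / 2 ^ a) := by
    intro j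
    have h0 : 0 ≤ j % 2 ^ a := Int.emod_nonneg _ (by positivity)
    have h1 : ((j % 2 ^ a).toNat : ℝ) = ((j % 2 ^ a : ℤ) : ℝ) := by
      exact_mod_cast congrArg (Int.cast : ℤ → ℝ) (Int.toNat_of_nonneg h0)
    have h2 : (j : ℝ) / 2 ^ a = ((j % 2 ^ a : ℤ) : ℝ) / 2 ^ a + (j / 2 ^ a : ℤ) := by
      have h3 : (j : ℝ) = ((j % 2 ^ a : ℤ) : ℝ) + 2 ^ a * ((j / 2 ^ a : ℤ) : ℝ) := by
        exact_mod_cast (Int.emod_add_mul_ediv j (2 ^ a)).symm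
      rw [div_eq_iff (by positivity), add_mul, div_mul_cancel₀ _ (by positivity), mul_comm _ ((2 : ℝ) ^ a)]
      exact h3
    rw [h2, theta_add_int, h1]
  have hlt : ∀ j : ℤ, (j % 2 ^ a).toNat < 2 ^ a := by
    intro j
    have h1 := Int.emod_lt_of_pos j (show (0 : ℤ) < 2 ^ a by positivity)
    have h0 : 0 ≤ j % 2 ^ a := Int.emod_nonneg _ (by positivity)
    zify
    rwa [Int.toNat_of_nonneg h0]
  -- The best numerator over this denominator dominates every multiple of J / 2^a.
  obtain ⟨J, hJ, hmax⟩ := Finset.exists_max_image (Finset.range (2 ^ a))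
    (fun j : ℕ => theta p τ (j / 2 ^ a)) ⟨0, by simp⟩
  rw [Finset.mem_range] at hJ
  have hmax' : ∀ j : ℤ, theta p τ (j / 2 ^ a) ≤ theta p τ (J / 2 ^ a) := by
    intro j
    rw [hmod]
    exact hmax _ (Finset.mem_range.2 (hlt j))
  refine ⟨τ, hτ, 2 ^ a, J, by positivity, hJ, ?_, ?_, ?_⟩
  · push_cast
    exact hj₀.trans_le (hmax' j₀)
  · rintro s ⟨s', rfl⟩
    -- Integer shifts do not change theta, so denominator 1 cannot occur.
    have ha1 : a ≠ 0 := by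
      intro h
      rw [h, pow_zero, div_one] at hj₀
      have := theta_add_int p τ 0 j₀
      rw [zero_add] at this
      linarith
    have hmin := Nat.find_min hex (m := a - 1) (by omega)
    push Not at hmin
    have h := hmin (s' * J)
    refine le_of_eq_of_le ?_ h
    congr 1
    obtain ⟨a', ha'⟩ := Nat.exists_eq_succ_of_ne_zero ha1
    rw [ha', Nat.succ_sub_one]
    push_cast
    rw [Nat.succ_eq_add_one, pow_succ]
    field_simp
    ring
  · intro s
    have h := hmax' (s * J)
    push_cast at h ⊢
    rwa [mul_div_assoc] at h
/-! ### The gadget lattice -/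

/-- Constants of the reduction: the integer lattice of dimension `N`, scaled by `D` and shifted by
multiples of `J`, has more points `Z` close to the shift `J` than short vectors. -/
structure Gadget (p ε : ℝ) where
  (D β J N a ρ B : ℕ)
  (γ G τ X Θe Θo : ℝ)
  Z : Finset (Fin N → ℤ)
  D_pos : 0 < D
  β_pos : 0 < β
  ρ_pos : 0 < ρ
  one_lt_γ : 1 < γ
  τ_pos : 0 < τ
  one_le_X : 1 ≤ X
  one_le_Θe : 1 ≤ Θe
  Θo_nonneg : 0 ≤ Θo
  one_le_G : 1 ≤ G
  -- Per equation, ρ is the p-th power of the YES radius, and G the level up to which vectors are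
  -- counted in the NO case.
  γ_rpow_mul_le : γ ^ p * ρ ≤ G
  sum_le_X : ∀ T : Finset ℤ, ∑ y ∈ T, Real.exp (-(τ * |(D : ℝ) * y| ^ p)) ≤ X
  sum_le_Θe : ∀ (s : ℤ) (T : Finset ℤ), Even s →
    ∑ z ∈ T, Real.exp (-(τ * |(D : ℝ) * z + J * s| ^ p)) ≤ Θe
  sum_le_Θo : ∀ (s : ℤ) (T : Finset ℤ), ∑ z ∈ T, Real.exp (-(τ * |(D : ℝ) * z + J * s| ^ p)) ≤ Θo
  -- The NO count per equation must stay below 2^a. The factor X³ covers s, x and w; 6G covers the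
  -- losses of the union bound. Odd s pays for a fraction 3/8 + ε of violated equations; even s pays
  -- nothing but is limited to Θe.
  odd_le : 6 * G * Real.exp (τ * G) * X ^ 3 *
    (Θo ^ N * Real.exp (-(τ * (((D : ℝ) * β) ^ p - (D : ℝ) ^ p) * (3 / 8 + ε)))) ≤ 2 ^ a
  even_le : 6 * G * Real.exp (τ * G) * X ^ 3 * Θe ^ N ≤ 2 ^ a
  -- The budget ρ covers D^p each for x and s, the violated 3/8 of the equations, and the gadget
  -- block.
  close : ∀ z ∈ Z, 2 * (D : ℝ) ^ p + 3 / 8 * ((D : ℝ) * β) ^ p + ∑ i, |(D : ℝ) * z i + J| ^ p ≤ ρ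
  le_card : 4 * 2 ^ a ≤ (Z.card : ℝ)
  abs_sub_le : ∀ z ∈ Z, ∀ z' ∈ Z, ∀ i, |z i - z' i| ≤ B
  -- Needed for the second moment: modulo a power of 2, only pairs congruent modulo 2 give dependent
  -- conditions.
  card_congr_le : ∀ z ∈ Z, 4 * (B : ℝ) * ((Z.filter fun z' => ∀ i, Even (z' i - z i)).card : ℝ) ≤ Z.card

/-- By the pigeonhole principle, many points of a box have their distance from `-t` in a common
short interval. -/
theorem exists_shell {p τ t : ℝ} (hp : 0 ≤ p) (hτ : 0 ≤ τ) (ht : 0 ≤ t) (ht1 : t ≤ 1) (N B : ℕ) :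
    ∃ R : ℝ, 0 ≤ R ∧ R ≤ N * (B + 1 : ℝ) ^ p + 1 ∧ ∃ Z : Finset (Fin N → ℤ),
      (∀ z ∈ Z, (∀ i, |z i| ≤ B) ∧ ∑ i, |z i + t| ^ p ≤ R) ∧
      Real.exp (τ * (R - 1)) * (∑ z ∈ Finset.Icc (-(B : ℤ)) B, Real.exp (-(τ * |z + t| ^ p))) ^ N
        ≤ Z.card * (N * (B + 1 : ℝ) ^ p + 1) := by
  classical
  set U : ℝ := N * (B + 1 : ℝ) ^ p with hU
  have hU0 : 0 ≤ U := by positivity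
  set box : Finset (Fin N → ℤ) := Fintype.piFinset fun _ => Finset.Icc (-(B : ℤ)) B with hbox
  set d : (Fin N → ℤ) → ℝ := fun z => ∑ i, |z i + t| ^ p with hd
  have hd0 : ∀ z, 0 ≤ d z := fun z => Finset.sum_nonneg fun i _ => by positivity
  have hbnd : ∀ z ∈ box, (∀ i, |z i| ≤ B) ∧ d z ≤ U := by
    intro z hz
    have hz' : ∀ i, |z i| ≤ B := fun i => abs_le.2 (Finset.mem_Icc.1 (Fintype.mem_piFinset.1 hz i))
    refine ⟨hz', ?_⟩
    have : d z ≤ ∑ _i : Fin N, (B + 1 : ℝ) ^ p := by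
      refine Finset.sum_le_sum fun i _ => Real.rpow_le_rpow (abs_nonneg _) ?_ hp
      have h1 : |(z i : ℝ)| ≤ B := by exact_mod_cast hz' i
      calc |(z i : ℝ) + t| ≤ |(z i : ℝ)| + |t| := abs_add_le _ _
        _ ≤ B + 1 := by rw [abs_of_nonneg ht]; linarith
    simpa using this
  have hprod : (∑ z ∈ Finset.Icc (-(B : ℤ)) B, Real.exp (-(τ * |z + t| ^ p))) ^ N
      = ∑ z ∈ box, Real.exp (-(τ * d z)) := by
    have := Finset.prod_univ_sum (fun _ : Fin N => Finset.Icc (-(B : ℤ)) B)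
      (fun _ z => Real.exp (-(τ * |(z : ℝ) + t| ^ p)))
    rw [Finset.prod_const, Finset.card_univ, Fintype.card_fin] at this
    rw [this]
    refine Finset.sum_congr rfl fun z _ => ?_
    rw [← Real.exp_sum, hd]
    simp only [Finset.mul_sum, Finset.sum_neg_distrib]
  -- All p-th powers of distances in the box are at most U, so n unit intervals cover them.
  set n : ℕ := ⌊U⌋₊ + 1 with hn
  have hn1 : (n : ℝ) ≤ U + 1 := by
    rw [hn]; push_cast; linarith [Nat.floor_le hU0]
  have hmaps : ∀ z ∈ box, ⌊d z⌋₊ ∈ Finset.range n := fun z hz =>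
    Finset.mem_range.2 (Nat.lt_succ_of_le (Nat.floor_le_floor (hbnd z hz).2))
  set W := ∑ z ∈ box, Real.exp (-(τ * d z)) with hW
  have hfib := Finset.sum_fiberwise_of_maps_to hmaps fun z => Real.exp (-(τ * d z))
  -- Some interval carries at least the average weight, and its points weigh at most exp(-τj) each,
  -- which turns weight into cardinality.
  have hex : ∃ j ∈ Finset.range n, W / n ≤
      ∑ z ∈ box.filter fun z => ⌊d z⌋₊ = j, Real.exp (-(τ * d z)) := by
    refine Finset.exists_le_of_sum_le (by simp [hn]) ?_
    rw [hfib, Finset.sum_const, Finset.card_range, nsmul_eq_mul, mul_div_cancel₀]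
    rw [hn]; positivity
  obtain ⟨j, hj, hjle⟩ := hex
  have hjU : (j : ℝ) ≤ U := by
    have : j ≤ ⌊U⌋₊ := Nat.lt_succ_iff.1 (Finset.mem_range.1 hj)
    exact (Nat.cast_le.2 this).trans (Nat.floor_le hU0)
  refine ⟨j + 1, by positivity, by linarith, box.filter fun z => ⌊d z⌋₊ = j, ?_, ?_⟩
  · intro z hz
    rw [Finset.mem_filter] at hz
    refine ⟨(hbnd z hz.1).1, ?_⟩
    have := Nat.lt_floor_add_one (d z)
    rw [hz.2] at this
    exact this.le
  · rw [hprod]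
    have h1 : ∑ z ∈ box.filter (fun z => ⌊d z⌋₊ = j), Real.exp (-(τ * d z))
        ≤ ((box.filter fun z => ⌊d z⌋₊ = j).card : ℝ) * Real.exp (-(τ * j)) := by
      rw [← nsmul_eq_mul, ← Finset.sum_const]
      refine Finset.sum_le_sum fun z hz => ?_
      rw [Finset.mem_filter] at hz
      have := Nat.floor_le (hd0 z)
      rw [hz.2] at this
      gcongr
    have hnpos : (0 : ℝ) < n := by rw [hn]; positivity
    have h2 := hjle.trans h1
    rw [div_le_iff₀ hnpos] at h2
    have h3 : Real.exp (τ * ((j : ℝ) + 1 - 1)) * Real.exp (-(τ * j)) = 1 := by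
      rw [← Real.exp_add]; ring_nf; exact Real.exp_zero
    calc Real.exp (τ * ((j : ℝ) + 1 - 1)) * W
        ≤ Real.exp (τ * ((j : ℝ) + 1 - 1)) *
          (((box.filter fun z => ⌊d z⌋₊ = j).card : ℝ) * Real.exp (-(τ * j)) * n) := by gcongr
      _ = ((box.filter fun z => ⌊d z⌋₊ = j).card : ℝ) * n *
          (Real.exp (τ * ((j : ℝ) + 1 - 1)) * Real.exp (-(τ * j))) := by ring
      _ ≤ ((box.filter fun z => ⌊d z⌋₊ = j).card : ℝ) * (U + 1) := by
          rw [h3, mul_one]; gcongr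

/-- Few points of a ball are congruent modulo `2` to a given one. -/
theorem card_congr_le_of_parity {p τ t R θ' : ℝ} (hτ : 0 ≤ τ) {N B : ℕ} {Z : Finset (Fin N → ℤ)}
    (hZ : ∀ z ∈ Z, (∀ i, |z i| ≤ B) ∧ ∑ i, |z i + t| ^ p ≤ R)
    (hθ' : ∀ (e : ℤ) (T : Finset ℤ),
      ∑ z ∈ T.filter (fun z => Even (z - e)), Real.exp (-(τ * |z + t| ^ p)) ≤ θ')
    (z₀ : Fin N → ℤ) :
    ((Z.filter fun z => ∀ i, Even (z i - z₀ i)).card : ℝ) ≤ Real.exp (τ * R) * θ' ^ N := by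
  classical
  set T : Fin N → Finset ℤ := fun i => (Finset.Icc (-(B : ℤ)) B).filter fun z => Even (z - z₀ i)
  have hsub : (Z.filter fun z => ∀ i, Even (z i - z₀ i)) ⊆ Fintype.piFinset T := by
    intro z hz
    rw [Finset.mem_filter] at hz
    exact Fintype.mem_piFinset.2 fun i => Finset.mem_filter.2
      ⟨Finset.mem_Icc.2 (abs_le.1 ((hZ z hz.1).1 i)), hz.2 i⟩
  -- Each point of the ball weighs at least exp(-τR), and the total weight factors over coordinates,
  -- each confined to one residue class modulo 2.
  calc ((Z.filter fun z => ∀ i, Even (z i - z₀ i)).card : ℝ)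
      = ∑ _z ∈ Z.filter fun z => ∀ i, Even (z i - z₀ i), (1 : ℝ) := by simp
    _ ≤ ∑ z ∈ Z.filter fun z => ∀ i, Even (z i - z₀ i),
          Real.exp (τ * R) * ∏ i, Real.exp (-(τ * |z i + t| ^ p)) := by
        refine Finset.sum_le_sum fun z hz => ?_
        rw [← Real.exp_sum, ← Real.exp_add, Finset.sum_neg_distrib, ← Finset.mul_sum]
        refine Real.one_le_exp ?_
        have := mul_le_mul_of_nonneg_left (hZ z (Finset.mem_filter.1 hz).1).2 hτ
        linarith
    _ ≤ ∑ z ∈ Fintype.piFinset T, Real.exp (τ * R) * ∏ i, Real.exp (-(τ * |z i + t| ^ p)) :=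
        Finset.sum_le_sum_of_subset_of_nonneg hsub fun z _ _ => by positivity
    _ = Real.exp (τ * R) * ∏ i, ∑ z ∈ T i, Real.exp (-(τ * |z + t| ^ p)) := by
        rw [← Finset.mul_sum, Finset.prod_univ_sum]
    _ ≤ Real.exp (τ * R) * θ' ^ N := by
        gcongr
        calc ∏ i, ∑ z ∈ T i, Real.exp (-(τ * |(z : ℝ) + t| ^ p)) ≤ ∏ _i : Fin N, θ' :=
              Finset.prod_le_prod (fun i _ => Finset.sum_nonneg fun z _ => (Real.exp_pos _).le)
                fun i _ => hθ' _ _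
          _ = θ' ^ N := by simp

/-! ### Single-coordinate estimates and the choice of parameters -/

theorem one_le_theta_zero {p τ : ℝ} (hp : 1 < p) (hτ : 0 < τ) : 1 ≤ theta p τ 0 := by
  have := (summable_theta hp hτ 0).le_tsum 0 fun z _ => (Real.exp_pos _).le
  simpa [theta, Real.zero_rpow (by linarith : p ≠ 0)] using this

theorem sum_le_theta {p τ : ℝ} (hp : 1 < p) (hτ : 0 < τ) (t : ℝ) (T : Finset ℤ) :
    ∑ z ∈ T, Real.exp (-(τ * |z + t| ^ p)) ≤ theta p τ t :=
  (summable_theta hp hτ t).sum_le_tsum T fun _ _ => (Real.exp_pos _).le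

/-- A residue class modulo 2 omits 0 or 1, hence misses a fixed part of the total weight. -/
theorem exists_parity_bound {p τ : ℝ} (hp : 1 < p) (hτ : 0 < τ) (t : ℝ) :
    ∃ θ' : ℝ, 0 < θ' ∧ θ' < theta p τ t ∧ ∀ (e : ℤ) (T : Finset ℤ),
      ∑ z ∈ T.filter (fun z => Even (z - e)), Real.exp (-(τ * |z + t| ^ p)) ≤ θ' := by
  classical
  set f : ℤ → ℝ := fun z => Real.exp (-(τ * |z + t| ^ p)) with hf
  have hfpos : ∀ z, 0 < f z := fun z => Real.exp_pos _
  have hθ : 0 < theta p τ t := by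
    have := sum_le_theta hp hτ t {0}
    rw [Finset.sum_singleton] at this
    exact (Real.exp_pos _).trans_le this
  -- The second entry of the maximum only keeps θ' positive, so that its logarithm is meaningful.
  refine ⟨max (theta p τ t - min (f 0) (f 1)) (theta p τ t / 2), ?_, ?_, ?_⟩
  · exact lt_max_of_lt_right (by linarith)
  · refine max_lt ?_ (by linarith)
    have := lt_min (hfpos 0) (hfpos 1)
    linarith
  · intro e T
    refine le_max_of_le_left ?_
    have key : ∀ w : ℤ, ¬ Even (w - e) → ∑ z ∈ T.filter (fun z => Even (z - e)), f z
        ≤ theta p τ t - f w := by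
      intro w hw
      have h := sum_le_theta hp hτ t (insert w (T.filter fun z => Even (z - e)))
      rw [Finset.sum_insert (by simp [hw])] at h
      simp only [hf]
      linarith
    by_cases he : Even (0 - e)
    · have h1 : ¬ Even (1 - e) := by
        rw [Int.even_sub] at he ⊢
        simpa using he
      exact (key 1 h1).trans (by linarith [min_le_right (f 0) (f 1)])
    · exact (key 0 he).trans (by linarith [min_le_left (f 0) (f 1)])

/-- The pigeonhole argument needs a finite box; the loss per coordinate is a factor exp(-η) with η
at will. -/
theorem exists_truncation {p τ : ℝ} (hp : 1 < p) (hτ : 0 < τ) (t : ℝ) {η : ℝ} (hη : 0 < η) :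
    ∃ B : ℕ, 0 < B ∧ theta p τ t * Real.exp (-η) ≤
      ∑ z ∈ Finset.Icc (-(B : ℤ)) B, Real.exp (-(τ * |z + t| ^ p)) := by
  have hθ : 0 < theta p τ t := by
    have := sum_le_theta hp hτ t {0}
    rw [Finset.sum_singleton] at this
    exact (Real.exp_pos _).trans_le this
  have hlt : theta p τ t * Real.exp (-η) < theta p τ t := by
    have : Real.exp (-η) < 1 :=
      (Real.exp_lt_exp.2 (by linarith : -η < 0)).trans_eq Real.exp_zero
    nlinarith
  obtain ⟨T, hT⟩ := ((summable_theta hp hτ t).hasSum.eventually (lt_mem_nhds hlt)).exists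
  refine ⟨T.sup Int.natAbs + 1, by omega, hT.le.trans ?_⟩
  refine Finset.sum_le_sum_of_subset_of_nonneg (fun z hz => ?_) fun _ _ _ => (Real.exp_pos _).le
  have := Finset.le_sup (f := Int.natAbs) hz
  rw [Finset.mem_Icc]
  omega

/-- Two logarithms of quantities linear in β^p, the number of shells and ρ + 1, have to be beaten by
a gain linear in β^p. -/
theorem exists_rpow_dominates_log {p c c' : ℝ} (hp : 1 ≤ p) (hc : 0 < c) (hc' : 0 < c') (C : ℝ) :
    ∃ β : ℕ, 0 < β ∧ C + 2 * Real.log (c' * (β : ℝ) ^ p) ≤ c * (β : ℝ) ^ p := by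
  -- Chosen so that c'Λ = K · (cΛ/4); then log y ≤ y - 1 at y = cΛ/4 suffices.
  set K := 4 * c' / c with hK
  have hKpos : 0 < K := by positivity
  obtain ⟨b, hb⟩ := exists_nat_ge ((C + 2 * Real.log K) * 2 / c)
  refine ⟨b + 1, by omega, ?_⟩
  set Λ : ℝ := ((b + 1 : ℕ) : ℝ) ^ p with hΛ
  have hb1 : (1 : ℝ) ≤ ((b + 1 : ℕ) : ℝ) := by push_cast; linarith [Nat.cast_nonneg (α := ℝ) b]
  have hΛb : ((b + 1 : ℕ) : ℝ) ≤ Λ := by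
    simpa [hΛ] using Real.rpow_le_rpow_of_exponent_le hb1 hp
  have hΛpos : 0 < Λ := by linarith
  have h1 : Real.log (c' * Λ) ≤ c / 4 * Λ + Real.log K := by
    have h2 : c' * Λ = K * (c / 4 * Λ) := by rw [hK]; field_simp
    rw [h2, Real.log_mul hKpos.ne' (by positivity)]
    have := Real.log_le_sub_one_of_pos (show 0 < c / 4 * Λ by positivity)
    linarith
  rw [div_le_iff₀ hc] at hb
  push_cast at hΛb
  nlinarith

set_option maxHeartbeats 800000 in
/-- Choice of the size of the gadget: the logarithmic terms are dominated by `β ^ p`. -/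
theorem exists_parameters {p ε τ t θ l l₀ l' : ℝ} {D : ℕ} (hp : 2 < p) (hε : 0 < ε) (hτ : 0 < τ)
    (hD : 0 < D) (ht0 : 0 ≤ t) (ht1 : t ≤ 1) (hθ : theta p τ t = θ) (hθe : Real.exp l = θ)
    (hl₀0 : 0 ≤ l₀) (hΔ : 0 < l - l₀) (hμ : 0 < l - l') :
    ∃ (β N B ρ : ℕ) (R E : ℝ) (Z : Finset (Fin N → ℤ)), 0 < β ∧ 0 < B ∧ 0 < ρ ∧ 0 ≤ R ∧
      (∀ z ∈ Z, (∀ i, |z i| ≤ B) ∧ ∑ i, |z i + t| ^ p ≤ R) ∧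
      (D : ℝ) ^ p * (2 + 3 / 8 * (β : ℝ) ^ p + R) ≤ ρ ∧
      ρ ≤ (D : ℝ) ^ p * (2 + 3 / 8 * (β : ℝ) ^ p + R) + 1 ∧
      Real.exp (τ * R + N * l - E) ≤ Z.card ∧
      Real.log 48 + Real.log (ρ + 1) + 3 * l₀ + E + 6 * τ ≤ min ε (5 / 8) * τ * (β : ℝ) ^ p ∧
      Real.log (4 * (2 * B : ℕ)) + E ≤ N * (l - l') ∧
      τ * (β : ℝ) ^ p ≤ N * (l - l₀) := by
  have hp1 : 1 < p := by linarith
  have hp0 : 0 ≤ p := by linarith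
  obtain ⟨Δ, hΔdef⟩ : ∃ x, x = l - l₀ := ⟨_, rfl⟩
  rw [← hΔdef] at hΔ
  obtain ⟨μ, hμdef⟩ : ∃ x, x = l - l' := ⟨_, rfl⟩
  rw [← hμdef] at hμ
  obtain ⟨ε', hε'⟩ : ∃ x, x = min ε (5 / 8) := ⟨_, rfl⟩
  have hε'pos : 0 < ε' := by rw [hε']; exact lt_min hε (by norm_num)
  -- Since N is about τΛ/Δ, the truncation loss ηN uses, up to an additive η, at most half of the
  -- gain ε'τΛ, and at most half of μN.
  obtain ⟨η, hη⟩ : ∃ x, x = min (ε' * Δ / 2) (μ / 2) := ⟨_, rfl⟩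
  have hηpos : 0 < η := by rw [hη]; exact lt_min (by positivity) (by positivity)
  obtain ⟨B, hB, hBtr⟩ := exists_truncation hp1 hτ t hηpos
  rw [hθ] at hBtr
  obtain ⟨V, hV⟩ : ∃ x, x = (B + 1 : ℝ) ^ p := ⟨_, rfl⟩
  have hVpos : 0 < V := hV ▸ by positivity
  -- These constants bound N, U and ρ + 1 by multiples of Λ = β^p before β is chosen, which avoids
  -- circularity.
  obtain ⟨c₁, hc₁⟩ : ∃ x, x = τ / Δ + 1 := ⟨_, rfl⟩
  have hc₁pos : 0 < c₁ := hc₁ ▸ by positivity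
  obtain ⟨c₂, hc₂⟩ : ∃ x, x = c₁ * V + 1 := ⟨_, rfl⟩
  have hc₂pos : 0 < c₂ := hc₂ ▸ by positivity
  obtain ⟨c₃, hc₃⟩ : ∃ x, x = (D : ℝ) ^ p * (3 + c₂) + 2 + c₂ := ⟨_, rfl⟩
  have hDp : 1 ≤ (D : ℝ) ^ p := Real.one_le_rpow (by exact_mod_cast hD) hp0
  have hc₃pos : 0 < c₃ := hc₃ ▸ by positivity
  have h4B : (0 : ℝ) < 4 * (2 * B : ℕ) := by positivity
  obtain ⟨C, hC⟩ : ∃ x, x = Real.log 48 + 3 * l₀ + 8 * τ + η + |Real.log (4 * (2 * B : ℕ))| := ⟨_, rfl⟩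
  obtain ⟨c, hc⟩ : ∃ x, x = min (ε' * τ / 2) (μ * τ / Δ / 2) := ⟨_, rfl⟩
  have hcpos : 0 < c := by rw [hc]; exact lt_min (by positivity) (by positivity)
  obtain ⟨β, hβ, hlog⟩ := exists_rpow_dominates_log (p := p) hp1.le hcpos hc₃pos C
  obtain ⟨Λ, hΛ⟩ : ∃ x, x = (β : ℝ) ^ p := ⟨_, rfl⟩
  have hΛ1 : 1 ≤ Λ := hΛ ▸ Real.one_le_rpow (by exact_mod_cast hβ) hp0
  -- The least dimension in which the surplus Δ per coordinate outweighs the full price τΛ of a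
  -- violated equation.
  obtain ⟨N, hN⟩ : ∃ x, x = ⌈τ * Λ / Δ⌉₊ := ⟨_, rfl⟩
  have hNle : τ * Λ / Δ ≤ N := hN ▸ Nat.le_ceil _
  have hNge : (N : ℝ) ≤ τ * Λ / Δ + 1 := hN ▸ (Nat.ceil_lt_add_one (by positivity)).le
  have hNΛ : (N : ℝ) ≤ c₁ * Λ := by
    rw [hc₁, add_mul, one_mul, div_mul_eq_mul_div]; linarith
  obtain ⟨R, hR0, hRU, Z, hZ, hcard⟩ := exists_shell hp0 hτ.le ht0 ht1 N B
  obtain ⟨U, hU⟩ : ∃ x, x = N * V + 1 := ⟨_, rfl⟩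
  rw [← hV, ← hU] at hRU hcard
  have hU1 : 1 ≤ U := by rw [hU]; have : 0 ≤ (N : ℝ) * V := by positivity
                         linarith
  have hUΛ : U ≤ c₂ * Λ := by
    rw [hU, hc₂, add_mul, one_mul]
    have : (N : ℝ) * V ≤ c₁ * Λ * V := by gcongr
    linarith
  obtain ⟨ρ, hρ⟩ : ∃ x, x = ⌈(D : ℝ) ^ p * (2 + 3 / 8 * Λ + R)⌉₊ := ⟨_, rfl⟩
  have hρle : (D : ℝ) ^ p * (2 + 3 / 8 * Λ + R) ≤ ρ := hρ ▸ Nat.le_ceil _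
  have hρge : (ρ : ℝ) ≤ (D : ℝ) ^ p * (2 + 3 / 8 * Λ + R) + 1 :=
    hρ ▸ (Nat.ceil_lt_add_one (by positivity)).le
  have hρ1 : (1 : ℝ) ≤ ρ :=
    (one_le_mul_of_one_le_of_one_le hDp (by linarith)).trans hρle
  have hρpos : 0 < ρ := by exact_mod_cast (by linarith : (0 : ℝ) < ρ)
  have hρΛ : (ρ : ℝ) + 1 ≤ c₃ * Λ := by
    have h1 : 2 + 3 / 8 * Λ + R ≤ (3 + c₂) * Λ := by linarith
    have h2 : (D : ℝ) ^ p * (2 + 3 / 8 * Λ + R) ≤ (D : ℝ) ^ p * ((3 + c₂) * Λ) := by gcongr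
    rw [hc₃]
    have h3 : 0 ≤ c₂ * Λ := by positivity
    linarith
  have hUΛ' : U ≤ c₃ * Λ := hUΛ.trans (by
    rw [hc₃]
    have : 0 ≤ (D : ℝ) ^ p * (3 + c₂) * Λ := by positivity
    linarith)
  obtain ⟨L, hL⟩ : ∃ x, x = Real.log (c₃ * Λ) := ⟨_, rfl⟩
  rw [← hΛ, ← hL, hC] at hlog
  have hlogU : Real.log U ≤ L := hL ▸ Real.log_le_log (by linarith) hUΛ'
  have hlogU0 : 0 ≤ Real.log U := Real.log_nonneg hU1
  have hlogρ : Real.log (ρ + 1) ≤ L := hL ▸ Real.log_le_log (by linarith) hρΛ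
  -- The losses in counting Z: truncation of the box, unit width of the shell, and pigeonhole.
  obtain ⟨E, hE⟩ : ∃ x, x = η * N + τ + Real.log U := ⟨_, rfl⟩
  have hZcard : Real.exp (τ * R + N * l - E) ≤ Z.card := by
    have h1 : Real.exp (τ * (R - 1)) * (θ * Real.exp (-η)) ^ N ≤ Z.card * U :=
      le_trans (by
        have : 0 ≤ θ * Real.exp (-η) := by rw [← hθe]; positivity
        gcongr) hcard
    have h2 : Real.exp (τ * (R - 1)) * (θ * Real.exp (-η)) ^ N
        = Real.exp (τ * R + N * l - E) * U := by
      rw [← hθe, ← Real.exp_add, ← Real.exp_nat_mul, ← Real.exp_add, hE]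
      have hU' : Real.exp (Real.log U) = U := Real.exp_log (by linarith)
      nth_rewrite 2 [← hU']
      rw [← Real.exp_add]
      ring_nf
    rw [h2] at h1
    exact le_of_mul_le_mul_right h1 (by linarith)
  have hc1 : c ≤ ε' * τ / 2 := hc ▸ min_le_left _ _
  have hc2 : c ≤ μ * τ / Δ / 2 := hc ▸ min_le_right _ _
  have hη1 : η ≤ ε' * Δ / 2 := hη ▸ min_le_left _ _
  have hη2 : η ≤ μ / 2 := hη ▸ min_le_right _ _
  have hηN : η * N ≤ ε' * τ * Λ / 2 + η := by
    calc η * N ≤ η * (τ * Λ / Δ + 1) := by gcongr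
      _ = η * (τ * Λ / Δ) + η := by ring
      _ ≤ ε' * Δ / 2 * (τ * Λ / Δ) + η := by gcongr
      _ = ε' * τ * Λ / 2 + η := by field_simp
  have hcΛ1 : c * Λ ≤ ε' * τ / 2 * Λ := by gcongr
  have hcΛ2 : c * Λ ≤ μ / 2 * N := by
    calc c * Λ ≤ μ * τ / Δ / 2 * Λ := by gcongr
      _ = μ / 2 * (τ * Λ / Δ) := by ring
      _ ≤ μ / 2 * N := by gcongr
  have habs0 : 0 ≤ |Real.log (4 * (2 * B : ℕ))| := abs_nonneg _
  have habs1 : Real.log (4 * (2 * B : ℕ)) ≤ |Real.log (4 * (2 * B : ℕ))| := le_abs_self _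
  have hmain : Real.log 48 + Real.log (ρ + 1) + 3 * l₀ + E + 6 * τ ≤ ε' * τ * Λ := by
    rw [hE]; linarith
  have hlog48 : 0 ≤ Real.log 48 := Real.log_nonneg (by norm_num)
  have hLnn : 0 ≤ L := hlogU0.trans hlogU
  have hmain' : Real.log (4 * (2 * B : ℕ)) + E ≤ N * μ := by
    have : η * N ≤ μ / 2 * N := by gcongr
    rw [hE]; linarith
  refine ⟨β, N, B, ρ, R, E, Z, hβ, hB, hρpos, hR0, hZ, ?_⟩
  rw [← hΛ, ← hε', ← hμdef, ← hΔdef]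
  refine ⟨hρle, hρge, hZcard, hmain, hmain', ?_⟩
  rwa [div_le_iff₀ hΔ] at hNle

-- Both upper bounds are compared with log |Z| ≥ τR + Nl - E. For odd s, the penalty (3/8 + ε)τΛ
-- exceeds the budget 3τΛ/8 of the YES case by ετΛ. For even s, the surplus NΔ ≥ τΛ exceeds it by
-- 5τΛ/8. The smaller of the two pays for all lower-order terms.
set_option maxHeartbeats 800000 in
theorem exists_gadget {p ε : ℝ} (hp : 2 < p) (hε : 0 < ε) (hε1 : ε < 1) : Nonempty (Gadget p ε) := by
  have hp1 : 1 < p := by linarith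
  have hp0 : 0 ≤ p := by linarith
  obtain ⟨τ, hτ, D, J, hD, hJD, hgt, heven, hodd⟩ := exists_dyadic_shift hp
  have hDR : (0 : ℝ) < D := by exact_mod_cast hD
  set t : ℝ := J / D with ht
  have ht0 : 0 ≤ t := by positivity
  have ht1 : t ≤ 1 := by
    rw [ht, div_le_one hDR]; exact_mod_cast hJD.le
  set θ₀ := theta p τ 0 with hθ₀
  set θ := theta p τ t with hθ
  have hθ₀1 : 1 ≤ θ₀ := one_le_theta_zero hp1 hτ
  have hθ₀pos : 0 < θ₀ := by linarith
  have hθpos : 0 < θ := by linarith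
  obtain ⟨θ', hθ'pos, hθ'lt, hθ'⟩ := exists_parity_bound hp1 hτ t
  clear_value θ θ₀ t
  obtain ⟨l, hl⟩ : ∃ x, x = Real.log θ := ⟨_, rfl⟩
  obtain ⟨l₀, hl₀⟩ : ∃ x, x = Real.log θ₀ := ⟨_, rfl⟩
  obtain ⟨l', hl'⟩ : ∃ x, x = Real.log θ' := ⟨_, rfl⟩
  have hl₀0 : 0 ≤ l₀ := hl₀ ▸ Real.log_nonneg hθ₀1
  have hΔ : 0 < l - l₀ := by
    have := Real.log_lt_log hθ₀pos hgt
    linarith [hl, hl₀]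
  have hμ : 0 < l - l' := by
    have := Real.log_lt_log hθ'pos hθ'lt
    rw [← hθ] at this
    linarith
  have hθe : Real.exp l = θ := hl ▸ Real.exp_log hθpos
  have hθ₀e : Real.exp l₀ = θ₀ := hl₀ ▸ Real.exp_log hθ₀pos
  have hθ'e : Real.exp l' = θ' := hl' ▸ Real.exp_log hθ'pos
  obtain ⟨β, N, B, ρ, R, E, Z, hβ, hB, hρpos, hR0, hZ, hρle, hρge, hZcard, hmain, hmain', hNΔ⟩ :=
    exists_parameters hp hε hτ hD ht0 ht1 hθ.symm hθe hl₀0 hΔ hμ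
  have hDp : 1 ≤ (D : ℝ) ^ p := Real.one_le_rpow (by exact_mod_cast hD) hp0
  have h4B : (0 : ℝ) < 4 * (2 * B : ℕ) := by positivity
  have hρ1 : (1 : ℝ) ≤ ρ := by exact_mod_cast hρpos
  obtain ⟨Λ, hΛ⟩ : ∃ x, x = (β : ℝ) ^ p := ⟨_, rfl⟩
  rw [← hΛ] at hρle hρge hmain hNΔ
  have hΛ1 : 1 ≤ Λ := hΛ ▸ Real.one_le_rpow (by exact_mod_cast hβ) hp0
  obtain ⟨ε', hε'⟩ : ∃ x, x = min ε (5 / 8) := ⟨_, rfl⟩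
  obtain ⟨Δ, hΔdef⟩ : ∃ x, x = l - l₀ := ⟨_, rfl⟩
  obtain ⟨μ, hμdef⟩ : ∃ x, x = l - l' := ⟨_, rfl⟩
  rw [← hε'] at hmain
  rw [← hΔdef] at hNΔ
  rw [← hμdef] at hmain'
  have hε'1 : ε' * τ * Λ ≤ ε * τ * Λ := by gcongr; exact hε' ▸ min_le_left _ _
  have hε'2 : ε' * τ * Λ ≤ 5 / 8 * τ * Λ := by gcongr; exact hε' ▸ min_le_right _ _
  -- The coordinates of the gadget are scaled by D, so the exponent is rescaled by D^p.
  obtain ⟨τ', hτ'⟩ : ∃ x, x = τ / (D : ℝ) ^ p := ⟨_, rfl⟩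
  have hτ'pos : 0 < τ' := by rw [hτ']; positivity
  have hτ'D : τ' * (D : ℝ) ^ p = τ := by rw [hτ']; field_simp
  have hτ'ρ : τ' * (ρ + 1) ≤ τ * (4 + 3 / 8 * Λ + R) := by
    calc τ' * (ρ + 1) ≤ τ' * ((D : ℝ) ^ p * (2 + 3 / 8 * Λ + R) + 2) := by gcongr ?_ * ?_; linarith
      _ = τ * (2 + 3 / 8 * Λ + R) + 2 * τ' := by rw [mul_add, ← mul_assoc, hτ'D]; ring
      _ ≤ τ * (2 + 3 / 8 * Λ + R) + 2 * τ := by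
          gcongr
          exact hτ' ▸ div_le_self hτ.le hDp
      _ = τ * (4 + 3 / 8 * Λ + R) := by ring
  obtain ⟨A, hA⟩ : ∃ x, x = 6 * (ρ + 1) * Real.exp (τ' * (ρ + 1)) * θ₀ ^ 3 := ⟨_, rfl⟩
  -- Here 8 = 4 · 2: the factor 4 of `le_card` and a factor 2 lost in rounding to a power of 2. With
  -- the 6 in A this gives log 48.
  have hAe : 8 * A = Real.exp (Real.log 48 + Real.log (ρ + 1) + τ' * (ρ + 1) + 3 * l₀) := by
    rw [Real.exp_add, Real.exp_add, Real.exp_add, Real.exp_log (by norm_num),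
      Real.exp_log (by linarith), hA, ← hθ₀e, ← Real.exp_nat_mul]
    push_cast
    ring
  have hA1 : 1 ≤ A := by
    have h1 : 1 ≤ Real.exp (τ' * (ρ + 1)) := Real.one_le_exp (by positivity)
    have h2 : 1 ≤ θ₀ ^ 3 := one_le_pow₀ hθ₀1
    have h3 : (1 : ℝ) ≤ 6 * (ρ + 1) := by linarith
    rw [hA]
    exact one_le_mul_of_one_le_of_one_le (one_le_mul_of_one_le_of_one_le h3 h1) h2
  have hDβ : ((D : ℝ) * β) ^ p = (D : ℝ) ^ p * Λ :=
    hΛ ▸ Real.mul_rpow hDR.le (by positivity)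
  obtain ⟨κ, hκ⟩ : ∃ x, x = Real.exp (-(τ' * (((D : ℝ) * β) ^ p - (D : ℝ) ^ p) * (3 / 8 + ε))) := ⟨_, rfl⟩
  have hκe : κ = Real.exp (-(τ * (Λ - 1) * (3 / 8 + ε))) := by
    rw [hκ, hDβ]
    congr 3
    rw [← hτ'D]
    ring
  have hO : 8 * (A * (θ ^ N * κ)) ≤ Z.card := by
    refine le_trans ?_ hZcard
    rw [← mul_assoc, hAe, hκe, ← hθe, ← Real.exp_nat_mul, ← Real.exp_add, ← Real.exp_add,
      Real.exp_le_exp]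
    have h1 : τ * ε ≤ τ := mul_le_of_le_one_right hτ.le hε1.le
    linarith
  have hEv : 8 * (A * θ₀ ^ N) ≤ Z.card := by
    refine le_trans ?_ hZcard
    rw [← mul_assoc, hAe, ← hθ₀e, ← Real.exp_nat_mul, ← Real.exp_add, Real.exp_le_exp]
    have : (N : ℝ) * l = N * Δ + N * l₀ := by rw [hΔdef]; ring
    linarith
  obtain ⟨M, hM⟩ : ∃ x, x = max (A * (θ ^ N * κ)) (A * θ₀ ^ N) := ⟨_, rfl⟩
  have hM1 : 1 ≤ M := hM ▸ le_max_of_le_right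
    (one_le_mul_of_one_le_of_one_le hA1 (one_le_pow₀ hθ₀1))
  -- From 2^a ≤ M < 2^(a + 1), the exponent a + 1 puts the modulus above both NO bounds and below
  -- |Z|/4.
  obtain ⟨a, ha, ha'⟩ := exists_nat_pow_near hM1 (by norm_num : (1 : ℝ) < 2)
  -- With γ^p = 1 + 1/ρ and G = ρ + 1, the relation between the two radii is an equality.
  have hγ1 : (1 : ℝ) < 1 + 1 / ρ := by
    have : (0 : ℝ) < 1 / ρ := by positivity
    linarith
  have hscale : ∀ u : ℝ, τ' * |(D : ℝ) * u| ^ p = τ * |u| ^ p := fun u => by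
    rw [abs_mul, abs_of_pos hDR, Real.mul_rpow hDR.le (abs_nonneg _), ← mul_assoc, hτ'D]
  have hshift : ∀ z s : ℤ, (D : ℝ) * z + J * s = D * (z + s * t) := fun z s => by
    rw [ht]; field_simp
  refine ⟨{ D := D, β := β, J := J, N := N, a := a + 1, ρ := ρ, B := 2 * B
            γ := (1 + 1 / ρ) ^ (1 / p), G := ρ + 1, τ := τ', X := θ₀, Θe := θ₀, Θo := θ, Z := Z
            D_pos := hD, β_pos := hβ, ρ_pos := hρpos
            one_lt_γ := Real.one_lt_rpow hγ1 (by positivity)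
            τ_pos := hτ'pos
            one_le_X := hθ₀1, one_le_Θe := hθ₀1, Θo_nonneg := hθpos.le
            one_le_G := by linarith
            γ_rpow_mul_le := ?_, sum_le_X := ?_, sum_le_Θe := ?_, sum_le_Θo := ?_
            odd_le := ?_, even_le := ?_, close := ?_, le_card := ?_, abs_sub_le := ?_
            card_congr_le := ?_ }⟩
  · rw [← Real.rpow_mul (by positivity), one_div_mul_cancel (by linarith), Real.rpow_one]
    field_simp
    exact le_rfl
  · intro T
    have := sum_le_theta hp1 hτ 0 T
    simp only [add_zero] at this
    simp only [hscale, hθ₀]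
    exact this
  · intro s T hs
    simp only [hshift, hscale]
    exact (sum_le_theta hp1 hτ _ T).trans (heven s hs)
  · intro s T
    simp only [hshift, hscale]
    exact (sum_le_theta hp1 hτ _ T).trans (hodd s)
  · rw [← hκ, ← hA]
    exact ((le_max_left _ _).trans_eq hM.symm).trans ha'.le
  · rw [← hA]
    exact ((le_max_right _ _).trans_eq hM.symm).trans ha'.le
  · intro z hz
    have h1 : ∀ i, |(D : ℝ) * z i + J| ^ p = (D : ℝ) ^ p * |z i + t| ^ p := fun i => by
      have := hshift (z i) 1
      rw [Int.cast_one, mul_one, one_mul] at this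
      rw [this, abs_mul, abs_of_pos hDR, Real.mul_rpow hDR.le (abs_nonneg _)]
    simp only [h1, hDβ]
    rw [← Finset.mul_sum]
    have := (hZ z hz).2
    calc _ = (D : ℝ) ^ p * (2 + 3 / 8 * Λ + ∑ i, |z i + t| ^ p) := by ring
      _ ≤ (D : ℝ) ^ p * (2 + 3 / 8 * Λ + R) := by gcongr
      _ ≤ ρ := hρle
  · have h8 : 8 * M ≤ Z.card := by
      rw [hM, mul_max_of_nonneg _ _ (by norm_num : (0 : ℝ) ≤ 8)]
      exact max_le hO hEv
    rw [pow_succ]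
    linarith
  · intro z hz z' hz' i
    have h1 := abs_le.1 ((hZ z hz).1 i)
    have h2 := abs_le.1 ((hZ z' hz').1 i)
    rw [abs_le]
    push_cast
    constructor <;> linarith
  · intro z hz
    refine le_trans ?_ hZcard
    have h1 := card_congr_le_of_parity hτ.le hZ hθ' z
    calc 4 * ((2 * B : ℕ) : ℝ) * ((Z.filter fun z' => ∀ i, Even (z' i - z i)).card : ℝ)
        ≤ 4 * ((2 * B : ℕ) : ℝ) * (Real.exp (τ * R) * θ' ^ N) := by gcongr
      _ = Real.exp (Real.log (4 * (2 * B : ℕ)) + τ * R + N * l') := by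
          rw [Real.exp_add, Real.exp_add, Real.exp_log h4B, ← hθ'e, ← Real.exp_nat_mul]; ring
      _ ≤ Real.exp (τ * R + N * l - E) := by
          rw [Real.exp_le_exp]
          have : (N : ℝ) * μ = N * l - N * l' := by rw [hμdef]; ring
          linarith
/-! ### Random linear forms modulo `q` -/

section LinearForms

variable {I : Type*} [Fintype I]

/-- The linear form `c ↦ ∑ c i * v i` modulo `q`. -/
def modForm (q : ℕ) (v : I → ℤ) : (I → ZMod q) →+ ZMod q where
  toFun c := ∑ i, c i * (v i : ZMod q)
  map_zero' := by simp
  map_add' c c' := by simp [add_mul, Finset.sum_add_distrib]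

theorem modForm_apply (q : ℕ) (v : I → ℤ) (c : I → ZMod q) :
    modForm q v c = ∑ i, c i * (v i : ZMod q) := rfl

theorem modForm_single [DecidableEq I] (q : ℕ) (v : I → ℤ) (i : I) (a : ZMod q) :
    modForm q v (Pi.single i a) = a * (v i : ZMod q) := by
  rw [modForm_apply, Finset.sum_eq_single i]
  · simp
  · intro j _ hj
    simp [hj]
  · simp

/-- The image has |G| / |ker φ| elements and contains the cyclic group generated by φ x. -/
theorem card_ker_mul_addOrderOf_le {G H : Type*} [AddCommGroup G] [AddCommGroup H] [Finite G]
    (φ : G →+ H) (x : G) : Nat.card φ.ker * addOrderOf (φ x) ≤ Nat.card G := by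
  have h := AddSubgroup.card_mul_index φ.ker
  rw [AddSubgroup.index_ker] at h
  rw [← h]
  refine Nat.mul_le_mul_left _ ?_
  rw [← Nat.card_zmultiples]
  have hle : AddSubgroup.zmultiples (φ x) ≤ φ.range :=
    (AddSubgroup.zmultiples_le).2 ⟨x, rfl⟩
  have : Finite φ.range := (Set.finite_range φ).to_subtype
  exact Nat.card_le_card_of_injective _ (AddSubgroup.inclusion_injective hle)

/-- The unit vector at i is sent to v i, whose additive order modulo q is q / gcd(q, v i). -/
theorem card_ker_modForm_mul_le (q : ℕ) [NeZero q] (v : I → ℤ) (i : I) :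
    Nat.card (modForm q v).ker * q ≤ Nat.gcd q (v i).natAbs * q ^ Fintype.card I := by
  classical
  have h := card_ker_mul_addOrderOf_le (modForm q v) (Pi.single i 1)
  rw [modForm_single, one_mul, Nat.card_fun, Nat.card_zmod, Nat.card_eq_fintype_card (α := I)] at h
  have hord : addOrderOf ((v i : ℤ) : ZMod q) = q / Nat.gcd q (v i).natAbs := by
    rcases Int.natAbs_eq (v i) with hv | hv
    · rw [hv, Int.natAbs_natCast, Int.cast_natCast, ZMod.addOrderOf_coe _ (NeZero.ne q)]
    · rw [hv, Int.natAbs_neg, Int.natAbs_natCast, Int.cast_neg, Int.cast_natCast, addOrderOf_neg,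
        ZMod.addOrderOf_coe _ (NeZero.ne q)]
  rw [hord] at h
  have hq : Nat.gcd q (v i).natAbs * (q / Nat.gcd q (v i).natAbs) = q :=
    Nat.mul_div_cancel' (Nat.gcd_dvd_left _ _)
  calc Nat.card (modForm q v).ker * q
      = Nat.gcd q (v i).natAbs * (Nat.card (modForm q v).ker * (q / Nat.gcd q (v i).natAbs)) := by
        rw [Nat.mul_left_comm, hq]
    _ ≤ _ := Nat.mul_le_mul_left _ h

theorem card_ker_modForm_mul_le_abs (q : ℕ) [NeZero q] (v : I → ℤ) {i : I} (hi : v i ≠ 0) :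
    Nat.card (modForm q v).ker * q ≤ (v i).natAbs * q ^ Fintype.card I :=
  (card_ker_modForm_mul_le q v i).trans
    (Nat.mul_le_mul_right _ (Nat.gcd_le_right _ (Int.natAbs_pos.2 hi)))

theorem card_ker_mul_card_of_surjective {G H : Type*} [AddCommGroup G] [AddCommGroup H]
    (φ : G →+ H) (hφ : Function.Surjective φ) : Nat.card φ.ker * Nat.card H = Nat.card G := by
  have h := AddSubgroup.card_mul_index φ.ker
  rw [AddSubgroup.index_ker, AddMonoidHom.range_eq_top.2 hφ] at h
  rwa [AddSubgroup.card_top] at h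

theorem modForm_surjective (q : ℕ) (v : I → ℤ) {i : I} (hi : v i = 1) :
    Function.Surjective (modForm q v) := by
  classical
  intro a
  exact ⟨Pi.single i a, by rw [modForm_single, hi]; simp⟩

theorem card_ker_modForm_mul (q : ℕ) (v : I → ℤ) {i : I} (hi : v i = 1) :
    Nat.card (modForm q v).ker * q = q ^ Fintype.card I := by
  have h := card_ker_mul_card_of_surjective _ (modForm_surjective q v hi)
  rwa [Nat.card_zmod, Nat.card_fun, Nat.card_zmod, Nat.card_eq_fintype_card (α := I)] at h

theorem modForm_sub (q : ℕ) (v v' : I → ℤ) (c : I → ZMod q) :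
    modForm q (v - v') c = modForm q v c - modForm q v' c := by
  simp [modForm_apply, mul_sub]

/-- Since v and v' agree at s, changing the coefficient there preserves the kernel of v - v' while
giving the form of v every value. Independence of two conditions thus reduces to the kernel of the
difference. -/
theorem card_inf_ker_modForm_mul (q : ℕ) (v v' : I → ℤ) {s : I} (hs : v s = 1) (hs' : v' s = 1) :
    Nat.card ↥((modForm q v).ker ⊓ (modForm q v').ker) * q = Nat.card (modForm q (v - v')).ker := by
  classical
  set φ : (modForm q (v - v')).ker →+ ZMod q := (modForm q v).comp (AddSubgroup.subtype _) with hφ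
  have hsurj : Function.Surjective φ := by
    intro a
    refine ⟨⟨Pi.single s a, ?_⟩, ?_⟩
    · rw [AddMonoidHom.mem_ker, modForm_single]
      simp [hs, hs']
    · simp [hφ, modForm_single, hs]
  have h := card_ker_mul_card_of_surjective φ hsurj
  rw [Nat.card_zmod] at h
  rw [← h]
  congr 1
  refine Nat.card_congr
    { toFun := fun c => ⟨⟨c.1, ?_⟩, ?_⟩, invFun := fun c => ⟨c.1.1, ?_⟩
      left_inv := fun c => rfl, right_inv := fun c => rfl }
  · have hc := c.2
    rw [AddSubgroup.mem_inf, AddMonoidHom.mem_ker, AddMonoidHom.mem_ker] at hc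
    rw [AddMonoidHom.mem_ker, modForm_sub, hc.1, hc.2, sub_zero]
  · have hc := c.2
    rw [AddSubgroup.mem_inf, AddMonoidHom.mem_ker] at hc
    rw [AddMonoidHom.mem_ker]
    exact hc.1
  · have h1 := c.1.2
    have h2 := c.2
    rw [AddMonoidHom.mem_ker] at h1 h2
    rw [modForm_sub] at h1
    have h3 : modForm q v c.1.1 = 0 := h2
    rw [h3, zero_sub, neg_eq_zero] at h1
    rw [AddSubgroup.mem_inf, AddMonoidHom.mem_ker, AddMonoidHom.mem_ker]
    exact ⟨h3, h1⟩

/-- First moment bound: few linear forms vanish on some vector of a small set. -/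
theorem card_exists_modForm_eq_zero_mul_le (q : ℕ) [NeZero q] (S : Finset (I → ℤ)) (V : ℕ)
    (hS : ∀ v ∈ S, ∃ i, v i ≠ 0 ∧ (v i).natAbs ≤ V) :
    {c : I → ZMod q | ∃ v ∈ S, modForm q v c = 0}.ncard * q ≤ S.card * V * q ^ Fintype.card I := by
  classical
  have hU : {c : I → ZMod q | ∃ v ∈ S, modForm q v c = 0}
      = ⋃ v ∈ S, ((modForm q v).ker : Set (I → ZMod q)) := by
    ext c
    simp [AddMonoidHom.mem_ker]
  rw [hU]
  calc (⋃ v ∈ S, ((modForm q v).ker : Set (I → ZMod q))).ncard * q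
      ≤ (∑ v ∈ S, ((modForm q v).ker : Set (I → ZMod q)).ncard) * q :=
        Nat.mul_le_mul_right _ (Finset.set_ncard_biUnion_le _ _)
    _ = ∑ v ∈ S, Nat.card (modForm q v).ker * q := by
        rw [Finset.sum_mul]
        rfl
    _ ≤ ∑ _v ∈ S, V * q ^ Fintype.card I := by
        refine Finset.sum_le_sum fun v hv => ?_
        obtain ⟨i, hi, hV⟩ := hS v hv
        exact (card_ker_modForm_mul_le_abs q v hi).trans (Nat.mul_le_mul_right _ hV)
    _ = S.card * V * q ^ Fintype.card I := by simp [mul_assoc]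

/-- An odd coordinate of the difference is a unit modulo 2^l and makes the conditions independent.
If all coordinates are even, a nonzero one has size at most B, which costs at most a factor B. -/
theorem card_inf_ker_le {l : ℕ} {v v' : I → ℤ} {s : I} {B : ℕ} (hs : v s = 1) (hs' : v' s = 1)
    (hne : v ≠ v') (hB : ∀ i, |v i - v' i| ≤ B) :
    Nat.card ↥((modForm (2 ^ l) v).ker ⊓ (modForm (2 ^ l) v').ker) * (2 ^ l) ^ 2 ≤
      (if ∀ i, Even (v' i - v i) then B else 1) * (2 ^ l) ^ Fintype.card I := by
  rw [sq, ← mul_assoc, card_inf_ker_modForm_mul _ _ _ hs hs']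
  split_ifs with h
  · obtain ⟨i, hi⟩ := Function.ne_iff.1 hne
    refine (card_ker_modForm_mul_le_abs (2 ^ l) (v - v') (i := i)
      (by simpa [sub_eq_zero] using hi)).trans (Nat.mul_le_mul_right _ ?_)
    have := hB i
    rw [Int.abs_eq_natAbs] at this
    exact_mod_cast this
  · push Not at h
    obtain ⟨i, hi⟩ := h
    refine (card_ker_modForm_mul_le (2 ^ l) (v - v') i).trans (Nat.mul_le_mul_right _ ?_)
    have hodd : Odd ((v - v') i).natAbs := by
      rw [Int.natAbs_odd, Pi.sub_apply, ← neg_sub, odd_neg]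
      exact Int.not_even_iff_odd.1 hi
    exact (Nat.Coprime.pow_left l (Nat.coprime_two_left.2 hodd)).le

/-- Second moment bound: most linear forms vanish on some vector of a large set. -/
theorem two_thirds_le_card_exists_modForm_eq_zero (l B : ℕ) (S : Finset (I → ℤ)) (s : I)
    (hs : ∀ v ∈ S, v s = 1) (hB : ∀ v ∈ S, ∀ v' ∈ S, ∀ i, |v i - v' i| ≤ B)
    (hq : 4 * 2 ^ l ≤ (S.card : ℝ))
    (hpar : ∀ v ∈ S, 4 * (B : ℝ) * ((S.filter fun v' => ∀ i, Even (v' i - v i)).card : ℝ) ≤ S.card) :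
    2 / 3 * ((2 : ℝ) ^ l) ^ Fintype.card I ≤
      ({c : I → ZMod (2 ^ l) | ∃ v ∈ S, modForm (2 ^ l) v c = 0}.ncard : ℝ) := by
  classical
  set q : ℕ := 2 ^ l with hqdef
  have hq0 : (0 : ℝ) < q := by rw [hqdef]; positivity
  have hqR : ((2 : ℝ) ^ l) = q := by rw [hqdef]; push_cast; rfl
  rw [hqR] at hq ⊢
  set Q : ℝ := (q : ℝ) ^ Fintype.card I with hQ
  have hQ0 : 0 < Q := by positivity
  set n : ℝ := (S.card : ℝ) with hn
  have hn0 : 0 < n := by linarith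
  -- X counts the vectors of S on which the form vanishes; T is its support, and Cauchy–Schwarz
  -- gives |T| ≥ (∑ X)² / ∑ X².
  set X : (I → ZMod q) → ℝ := fun c => ∑ v ∈ S, if modForm q v c = 0 then 1 else 0 with hX
  set T : Finset (I → ZMod q) := Finset.univ.filter fun c => ∃ v ∈ S, modForm q v c = 0 with hT
  have hTcard : ({c : I → ZMod q | ∃ v ∈ S, modForm q v c = 0}.ncard : ℝ) = T.card := by
    rw [← Set.ncard_coe_finset]
    congr 2
    ext c
    simp [hT]
  rw [hTcard]
  have hsupp : ∀ c, c ∉ T → X c = 0 := by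
    intro c hc
    simp only [hT, Finset.mem_filter, Finset.mem_univ, true_and, not_exists, not_and] at hc
    exact Finset.sum_eq_zero fun v hv => if_neg (hc v hv)
  have hcount : ∀ A : AddSubgroup (I → ZMod q),
      ∑ c : I → ZMod q, (if c ∈ A then (1 : ℝ) else 0) = Nat.card A := by
    intro A
    rw [Finset.sum_ite]
    simp only [Finset.sum_const, nsmul_eq_mul, mul_one, mul_zero, add_zero]
    rw [Nat.card_eq_fintype_card, Fintype.card_subtype]
  have hfirst : (∑ c, X c) * q = n * Q := by
    rw [hX, Finset.sum_comm, Finset.sum_mul, hn, ← nsmul_eq_mul, ← Finset.sum_const]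
    refine Finset.sum_congr rfl fun v hv => ?_
    have h1 := hcount (modForm q v).ker
    simp only [AddMonoidHom.mem_ker] at h1
    rw [h1, hQ]
    exact_mod_cast card_ker_modForm_mul q v (hs v hv)
  -- The constant is 1 + 1/4 + 1/4: independent pairs, the diagonal by 4q ≤ |S|, and the pairs
  -- congruent modulo 2 by `hpar`.
  have hsecond : (∑ c, X c ^ 2) * (q : ℝ) ^ 2 ≤ 3 / 2 * n ^ 2 * Q := by
    have h1 : ∑ c, X c ^ 2 = ∑ v ∈ S, ∑ v' ∈ S,
        (Nat.card ↥((modForm q v).ker ⊓ (modForm q v').ker) : ℝ) := by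
      have : ∀ c, X c ^ 2 = ∑ v ∈ S, ∑ v' ∈ S,
          if c ∈ (modForm q v).ker ⊓ (modForm q v').ker then (1 : ℝ) else 0 := by
        intro c
        rw [sq, hX, Finset.sum_mul_sum]
        refine Finset.sum_congr rfl fun v _ => Finset.sum_congr rfl fun v' _ => ?_
        rw [AddSubgroup.mem_inf, AddMonoidHom.mem_ker, AddMonoidHom.mem_ker]
        by_cases h : modForm q v c = 0 <;> by_cases h' : modForm q v' c = 0 <;> simp [h, h']
      simp_rw [this]
      rw [Finset.sum_comm]
      refine Finset.sum_congr rfl fun v _ => ?_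
      rw [Finset.sum_comm]
      exact Finset.sum_congr rfl fun v' _ => hcount _
    rw [h1, Finset.sum_mul]
    have hrow : ∀ v ∈ S, (∑ v' ∈ S,
        (Nat.card ↥((modForm q v).ker ⊓ (modForm q v').ker) : ℝ)) * (q : ℝ) ^ 2 ≤ 3 / 2 * n * Q := by
      intro v hv
      rw [Finset.sum_mul]
      have hterm : ∀ v' ∈ S, (Nat.card ↥((modForm q v).ker ⊓ (modForm q v').ker) : ℝ) * (q : ℝ) ^ 2 ≤
          ((if v' = v then (q : ℝ) else 0) + (1 + if ∀ i, Even (v' i - v i) then (B : ℝ) else 0)) * Q := by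
        intro v' hv'
        by_cases hvv : v' = v
        · subst hvv
          have h2 : (Nat.card (modForm q v').ker : ℝ) * q = Q := by
            rw [hQ]; exact_mod_cast card_ker_modForm_mul q v' (hs v' hv')
          rw [inf_idem, sq, ← mul_assoc, h2, if_pos rfl, mul_comm Q]
          refine mul_le_mul_of_nonneg_right ?_ hQ0.le
          have : (0 : ℝ) ≤ if ∀ i, Even (v' i - v' i) then (B : ℝ) else 0 := by
            split_ifs <;> positivity
          linarith
        · have h2 := card_inf_ker_le (l := l) (hs v hv) (hs v' hv') (Ne.symm hvv) (hB v hv v' hv')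
          rw [← hqdef] at h2
          have h3 : (Nat.card ↥((modForm q v).ker ⊓ (modForm q v').ker) : ℝ) * (q : ℝ) ^ 2 ≤
              (if ∀ i, Even (v' i - v i) then (B : ℝ) else 1) * Q := by
            rw [hQ]
            split_ifs at h2 ⊢ <;> exact_mod_cast h2
          refine h3.trans (mul_le_mul_of_nonneg_right ?_ hQ0.le)
          rw [if_neg hvv]
          split_ifs <;> linarith
      refine (Finset.sum_le_sum hterm).trans ?_
      rw [← Finset.sum_mul]
      refine mul_le_mul_of_nonneg_right ?_ hQ0.le
      rw [Finset.sum_add_distrib, Finset.sum_add_distrib, Finset.sum_ite_eq' S v, if_pos hv,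
        Finset.sum_const, nsmul_eq_mul, mul_one, ← Finset.sum_filter, Finset.sum_const, nsmul_eq_mul]
      have := hpar v hv
      linarith
    refine (Finset.sum_le_sum hrow).trans ?_
    rw [Finset.sum_const, nsmul_eq_mul]
    linarith
  have hcs : (∑ c, X c) ^ 2 ≤ T.card * ∑ c, X c ^ 2 := by
    have h1 : ∑ c ∈ T, X c = ∑ c, X c := Finset.sum_subset (Finset.subset_univ _) fun c _ hc => hsupp c hc
    have h2 := sq_sum_le_card_mul_sum_sq (s := T) (f := X)
    rw [h1] at h2
    refine h2.trans (mul_le_mul_of_nonneg_left ?_ (Nat.cast_nonneg _))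
    exact Finset.sum_le_sum_of_subset_of_nonneg (Finset.subset_univ _) fun c _ _ => sq_nonneg _
  have h1 : (n * Q) ^ 2 ≤ T.card * (3 / 2 * n ^ 2 * Q) := by
    rw [← hfirst, mul_pow]
    calc (∑ c, X c) ^ 2 * (q : ℝ) ^ 2 ≤ T.card * (∑ c, X c ^ 2) * (q : ℝ) ^ 2 := by gcongr
      _ = T.card * ((∑ c, X c ^ 2) * (q : ℝ) ^ 2) := by ring
      _ ≤ _ := mul_le_mul_of_nonneg_left hsecond (Nat.cast_nonneg _)
  have h2 : n ^ 2 * Q * Q ≤ n ^ 2 * Q * (3 / 2 * T.card) := by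
    calc n ^ 2 * Q * Q = (n * Q) ^ 2 := by ring
      _ ≤ _ := h1
      _ = _ := by ring
  have h3 := le_of_mul_le_mul_left h2 (by positivity)
  linarith

end LinearForms

/-! ### Uniform residues from coin tosses -/

/-- The `j`-th coin, as a number; `0` beyond the end. -/
def coinBit {K : ℕ} (ρ : Fin K → Bool) (j : ℕ) : ℕ := if h : j < K then (ρ ⟨j, h⟩).toNat else 0

/-- The number with binary digits `f 0, …, f (l - 1)`, least significant first. -/
def binVal (f : ℕ → ℕ) (l : ℕ) : ℕ := ∑ t ∈ Finset.range l, f t * 2 ^ t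

theorem binVal_lt {f : ℕ → ℕ} (hf : ∀ t, f t ≤ 1) (l : ℕ) : binVal f l < 2 ^ l := by
  induction l with
  | zero => simp [binVal]
  | succ l ih =>
    have h : binVal f (l + 1) = binVal f l + f l * 2 ^ l := Finset.sum_range_succ _ _
    have := Nat.mul_le_mul_right (2 ^ l) (hf l)
    rw [h, pow_succ]
    omega

theorem binVal_injective {f g : ℕ → ℕ} (hf : ∀ t, f t ≤ 1) (hg : ∀ t, g t ≤ 1) {l : ℕ}
    (h : binVal f l = binVal g l) : ∀ t < l, f t = g t := by
  induction l with
  | zero => simp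
  | succ l ih =>
    have e : ∀ f : ℕ → ℕ, binVal f (l + 1) = binVal f l + f l * 2 ^ l :=
      fun f => Finset.sum_range_succ _ _
    rw [e, e] at h
    have h1 := binVal_lt hf l
    have h2 := binVal_lt hg l
    have h3 : f l = g l := by
      have := congrArg (· / 2 ^ l) h
      simpa [Nat.add_mul_div_right, Nat.div_eq_of_lt h1, Nat.div_eq_of_lt h2] using this
    rw [h3] at h
    intro t ht
    rcases Nat.lt_succ_iff_lt_or_eq.1 ht with h' | rfl
    · exact ih (by omega) t h'
    · exact h3

/-- The residues modulo `2 ^ l` that consecutive blocks of `l` coins encode. -/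
def coinResidue {K : ℕ} (l k : ℕ) (ρ : Fin K → Bool) (i : Fin k) : ZMod (2 ^ l) :=
  (binVal (fun t => coinBit ρ (i * l + t)) l : ℕ)

/-- Binary expansions are injective, and both sides have 2^l elements. -/
theorem bool_block_bijective (l : ℕ) : Function.Bijective fun b : Fin l → Bool =>
    ((binVal (coinBit b) l : ℕ) : ZMod (2 ^ l)) := by
  have hle : ∀ (b : Fin l → Bool) t, coinBit b t ≤ 1 := by
    intro b t
    unfold coinBit
    split_ifs
    · exact Bool.toNat_le _
    · exact zero_le_one
  rw [Fintype.bijective_iff_injective_and_card]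
  refine ⟨fun b b' h => ?_, by simp [ZMod.card]⟩
  simp only at h
  rw [ZMod.natCast_eq_natCast_iff', Nat.mod_eq_of_lt (binVal_lt (hle b) l),
    Nat.mod_eq_of_lt (binVal_lt (hle b') l)] at h
  funext t
  have := binVal_injective (hle b) (hle b') h t t.2
  simp only [coinBit, t.2, dif_pos] at this
  revert this
  cases b t <;> cases b' t <;> simp

/-- The coins are regrouped into k blocks of l and an unused remainder; each block corresponds
bijectively to a residue, so uniformity is exact. -/
theorem coinProb_coinResidue {K l k : ℕ} (hK : k * l ≤ K) (E : Set (Fin k → ZMod (2 ^ l))) :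
    coinProb {ρ : Fin K → Bool | coinResidue l k ρ ∈ E} = (E.ncard : ℝ) / ((2 : ℝ) ^ l) ^ k := by
  classical
  obtain ⟨r, rfl⟩ := Nat.exists_eq_add_of_le hK
  set eidx : (Fin k × Fin l) ⊕ Fin r ≃ Fin (k * l + r) :=
    (Equiv.sumCongr finProdFinEquiv (Equiv.refl _)).trans finSumFinEquiv with heidx
  set e1 : (Fin (k * l + r) → Bool) ≃ (Fin k → Fin l → Bool) × (Fin r → Bool) :=
    (eidx.symm.arrowCongr (Equiv.refl Bool)).trans
      ((Equiv.sumArrowEquivProdArrow _ _ _).trans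
        (Equiv.prodCongr (Equiv.curry _ _ _) (Equiv.refl _))) with he1
  set eb := Equiv.ofBijective _ (bool_block_bijective l) with heb
  set e : (Fin (k * l + r) → Bool) ≃ (Fin k → ZMod (2 ^ l)) × (Fin r → Bool) :=
    e1.trans (Equiv.prodCongr (Equiv.piCongrRight fun _ => eb) (Equiv.refl _)) with he
  have hfst : ∀ ρ, (e ρ).1 = coinResidue l k ρ := by
    intro ρ
    funext i
    have h1 : (e ρ).1 i = ((binVal (coinBit ((e1 ρ).1 i)) l : ℕ) : ZMod (2 ^ l)) := rfl
    rw [h1, coinResidue]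
    congr 1
    refine Finset.sum_congr rfl fun t ht => ?_
    rw [Finset.mem_range] at ht
    have h2 : (e1 ρ).1 i ⟨t, ht⟩ = ρ (eidx (Sum.inl (i, ⟨t, ht⟩))) := rfl
    have h3 : (eidx (Sum.inl (i, ⟨t, ht⟩))).val = i * l + t := by
      simp [heidx, mul_comm, add_comm]
    have h4 : (i : ℕ) * l + t < k * l + r := h3 ▸ (eidx (Sum.inl (i, ⟨t, ht⟩))).2
    congr 1
    simp only [coinBit]
    rw [dif_pos ht, dif_pos h4, h2]
    congr 2
    exact Fin.ext h3
  have hset : {ρ : Fin (k * l + r) → Bool | coinResidue l k ρ ∈ E} = e ⁻¹' (E ×ˢ Set.univ) := by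
    ext ρ
    simp [hfst]
  rw [coinProb, hset, Set.ncard_preimage_of_injective_subset_range e.injective (by simp),
    Set.ncard_prod, Set.ncard_univ, Nat.card_eq_fintype_card, Fintype.card_fun, Fintype.card_bool,
    Fintype.card_fin]
  push_cast
  rw [pow_add, ← pow_mul, mul_comm l k, mul_div_mul_right _ _ (by positivity)]
/-! ### Counting lattice vectors -/

section Counting

variable {p ε : ℝ} {X Y : Type}

/-- The coefficients of a vector of the lattice, other than that of the modulus. -/
abbrev CoefIndex (X Y : Type) (N : ℕ) : Type := ((X ⊕ Y) ⊕ (Y × Fin N)) ⊕ Fin 1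

/-- Assemble coefficients. -/
def coef {N : ℕ} (s : ℤ) (x : X → ℤ) (w : Y → ℤ) (z : Y × Fin N → ℤ) : CoefIndex X Y N → ℤ :=
  Sum.elim (Sum.elim (Sum.elim x w) z) fun _ => s

theorem coef_surjective {N : ℕ} (v : CoefIndex X Y N → ℤ) : ∃ s x w z, v = coef s x w z := by
  refine ⟨v (Sum.inr 0), fun i => v (Sum.inl (Sum.inl (Sum.inl i))),
    fun y => v (Sum.inl (Sum.inl (Sum.inr y))), fun yj => v (Sum.inl (Sum.inr yj)), ?_⟩
  funext i
  rcases i with ((i | i) | i) | i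
  · rfl
  · rfl
  · rfl
  · rw [Subsingleton.elim i 0]; rfl

/-- The part of a coordinate of the system of equations that does not depend on the multiples
of `2`. -/
def eqnResidual {X Y : Type} [Fintype X] (A : Y → X → ZMod 2) (b : Y → ZMod 2) (s : ℤ) (x : X → ℤ) (y : Y) : ℤ :=
  ∑ i, ((A y i).val : ℤ) * x i + (b y).val * s

/-- An odd s acts as 1 modulo 2, and signs do not matter there, so the residual reduces to Ax + b =
Ax - b. -/
theorem odd_eqnResidual_iff {X Y : Type} [Fintype X] (A : Y → X → ZMod 2) (b : Y → ZMod 2) {s : ℤ} (hs : Odd s) (x : X → ℤ)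
    (y : Y) : Odd (eqnResidual A b s x y) ↔ ¬ ∑ i, A y i * (x i : ZMod 2) = b y := by
  have hs1 : (s : ZMod 2) = 1 := by
    obtain ⟨t, rfl⟩ := hs
    push_cast
    rw [show (2 : ZMod 2) = 0 from rfl, zero_mul, zero_add]
  have h : ((eqnResidual A b s x y : ℤ) : ZMod 2) = ∑ i, A y i * (x i : ZMod 2) + b y := by
    rw [eqnResidual]
    push_cast
    rw [hs1, mul_one]
    simp
  rw [← Int.not_even_iff_odd, not_iff_not, ← ZMod.intCast_eq_zero_iff_even, h]
  rw [add_eq_zero_iff_eq_neg, ZMod.neg_eq_self_mod_two]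

variable [Fintype X] [Fintype Y]

/-- The `p`-th power of the norm of a lattice vector, except for the coordinate of the linear
form. -/
noncomputable def costPow (g : Gadget p ε) (A : Y → X → ZMod 2) (b : Y → ZMod 2)
    (s : ℤ) (x : X → ℤ) (w : Y → ℤ) (z : Y × Fin g.N → ℤ) : ℝ :=
  ∑ i, |(g.D : ℝ) * x i| ^ p + ∑ y, |(g.D * g.β : ℝ) * ((eqnResidual A b s x y + 2 * w y : ℤ) : ℝ)| ^ p
    + ∑ yj, |(g.D : ℝ) * z yj + g.J * s| ^ p + |(g.D : ℝ) * s| ^ p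

theorem Gadget.D_pos' (g : Gadget p ε) : (0 : ℝ) < g.D := by exact_mod_cast g.D_pos

theorem Gadget.one_le_D (g : Gadget p ε) : (1 : ℝ) ≤ g.D := by exact_mod_cast g.D_pos

theorem Gadget.one_le_β (g : Gadget p ε) : (1 : ℝ) ≤ g.β := by exact_mod_cast g.β_pos

theorem Gadget.D_rpow_le (g : Gadget p ε) (hp : 0 ≤ p) : (g.D : ℝ) ^ p ≤ (g.D * g.β : ℝ) ^ p :=
  Real.rpow_le_rpow g.D_pos'.le (le_mul_of_one_le_right g.D_pos'.le g.one_le_β) hp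

/-- The weight of an unsatisfied equation. -/
noncomputable def Gadget.κ (g : Gadget p ε) : ℝ :=
  Real.exp (-(g.τ * ((g.D * g.β : ℝ) ^ p - (g.D : ℝ) ^ p)))

/-- An odd y has |y| ≥ 1, so (Dβ)^p|y|^p exceeds D^p|y|^p by at least (Dβ)^p - D^p. That excess is
the factor κ paid by a violated equation. -/
theorem sum_row_le (g : Gadget p ε) (hp : 0 ≤ p) (e : ℤ) (T : Finset ℤ) :
    ∑ w ∈ T, Real.exp (-(g.τ * |(g.D * g.β : ℝ) * ((e + 2 * w : ℤ) : ℝ)| ^ p))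
      ≤ g.X * (if Odd e then g.κ else 1) := by
  classical
  have hD := g.D_pos'
  have hτ := g.τ_pos
  have hDβ := g.D_rpow_le hp
  have hterm : ∀ y : ℤ, (Odd e → Odd y) →
      Real.exp (-(g.τ * |(g.D * g.β : ℝ) * (y : ℝ)| ^ p)) ≤
        (if Odd e then g.κ else 1) * Real.exp (-(g.τ * |(g.D : ℝ) * y| ^ p)) := by
    intro y hy
    rw [abs_mul, abs_of_nonneg (by positivity : (0 : ℝ) ≤ g.D * g.β), abs_mul,
      abs_of_pos hD, Real.mul_rpow (by positivity) (abs_nonneg _), Real.mul_rpow hD.le (abs_nonneg _)]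
    have hy0 : 0 ≤ |(y : ℝ)| ^ p := by positivity
    split_ifs with he
    · have hy1 : 1 ≤ |(y : ℝ)| ^ p := by
        refine Real.one_le_rpow ?_ hp
        have : y ≠ 0 := by
          rintro rfl
          exact absurd (hy he) (by decide)
        exact_mod_cast Int.one_le_abs this
      rw [Gadget.κ, ← Real.exp_add, Real.exp_le_exp]
      have : 0 ≤ g.τ * (((g.D * g.β : ℝ) ^ p - (g.D : ℝ) ^ p) * (|(y : ℝ)| ^ p - 1)) :=
        mul_nonneg hτ.le (mul_nonneg (by linarith) (by linarith))
      linarith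
    · rw [one_mul, Real.exp_le_exp, neg_le_neg_iff]
      gcongr
  have hinj : Set.InjOn (fun w : ℤ => e + 2 * w) T := fun a _ b _ h => by
    simp only at h; omega
  calc _ ≤ ∑ w ∈ T, (if Odd e then g.κ else 1) *
        Real.exp (-(g.τ * |(g.D : ℝ) * ((e + 2 * w : ℤ) : ℝ)| ^ p)) :=
        Finset.sum_le_sum fun w _ => hterm _ fun he => he.add_even (even_two_mul w)
    _ = (if Odd e then g.κ else 1) *
        ∑ y ∈ T.image (fun w : ℤ => e + 2 * w), Real.exp (-(g.τ * |(g.D : ℝ) * (y : ℝ)| ^ p)) := by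
        rw [Finset.sum_image hinj, Finset.mul_sum]
    _ ≤ (if Odd e then g.κ else 1) * g.X := by
        refine mul_le_mul_of_nonneg_left (g.sum_le_X _) ?_
        split_ifs
        · exact (Real.exp_pos _).le
        · exact zero_le_one
    _ = _ := mul_comm _ _

/-- The weights of all lattice vectors sum up to little if no assignment satisfies many equations. -/
theorem sum_exp_costPow_le (g : Gadget p ε) (hp : 0 ≤ p) (A : Y → X → ZMod 2) (b : Y → ZMod 2)
    (hXY : Fintype.card X ≤ Fintype.card Y) (hY : 1 ≤ Fintype.card Y)
    (hno : ∀ x : X → ZMod 2, ((Finset.univ.filter fun y => ∑ i, A y i * x i = b y).card : ℝ)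
      ≤ (5 / 8 - ε) * Fintype.card Y)
    (T : Finset (ℤ × (X → ℤ) × (Y → ℤ) × (Y × Fin g.N → ℤ))) :
    (6 * g.G * Real.exp (g.τ * g.G)) ^ Fintype.card Y *
      ∑ v ∈ T, Real.exp (-(g.τ * costPow g A b v.1 v.2.1 v.2.2.1 v.2.2.2)) ≤
      (2 ^ g.a) ^ Fintype.card Y := by
  classical
  have hX := g.one_le_X
  have hX0 : 0 ≤ g.X := by linarith
  have hτ := g.τ_pos
  have hG := g.one_le_G
  have hΘe := g.one_le_Θe
  have hΘo := g.Θo_nonneg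
  set M := Fintype.card Y with hM
  set Ks : ℝ := max (g.Θo ^ g.N *
    Real.exp (-(g.τ * ((g.D * g.β : ℝ) ^ p - (g.D : ℝ) ^ p) * (3 / 8 + ε)))) (g.Θe ^ g.N) with hKs
  have hKs0 : 0 ≤ Ks := le_max_of_le_right (by positivity)
  have hKa : 6 * g.G * Real.exp (g.τ * g.G) * g.X ^ 3 * Ks ≤ 2 ^ g.a := by
    rw [hKs, mul_max_of_nonneg _ _ (by positivity)]
    exact max_le g.odd_le g.even_le
  -- a box around `T`
  obtain ⟨bs, hbs⟩ : ∃ bs : Finset ℤ, ∀ v ∈ T, v.1 ∈ bs :=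
    ⟨T.image fun v => v.1, fun v hv => Finset.mem_image_of_mem _ hv⟩
  obtain ⟨bx, hbx⟩ : ∃ bx : Finset ℤ, ∀ v ∈ T, ∀ i, v.2.1 i ∈ bx :=
    ⟨T.biUnion fun v => Finset.univ.image v.2.1, fun v hv i =>
      Finset.mem_biUnion.2 ⟨v, hv, Finset.mem_image_of_mem _ (Finset.mem_univ i)⟩⟩
  obtain ⟨bw, hbw⟩ : ∃ bw : Finset ℤ, ∀ v ∈ T, ∀ i, v.2.2.1 i ∈ bw :=
    ⟨T.biUnion fun v => Finset.univ.image v.2.2.1, fun v hv i =>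
      Finset.mem_biUnion.2 ⟨v, hv, Finset.mem_image_of_mem _ (Finset.mem_univ i)⟩⟩
  obtain ⟨bz, hbz⟩ : ∃ bz : Finset ℤ, ∀ v ∈ T, ∀ i, v.2.2.2 i ∈ bz :=
    ⟨T.biUnion fun v => Finset.univ.image v.2.2.2, fun v hv i =>
      Finset.mem_biUnion.2 ⟨v, hv, Finset.mem_image_of_mem _ (Finset.mem_univ i)⟩⟩
  set PX : Finset (X → ℤ) := Fintype.piFinset fun _ => bx
  set PW : Finset (Y → ℤ) := Fintype.piFinset fun _ => bw
  set PZ : Finset (Y × Fin g.N → ℤ) := Fintype.piFinset fun _ => bz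
  have hsub : T ⊆ bs ×ˢ PX ×ˢ PW ×ˢ PZ := by
    intro v hv
    simp only [Finset.mem_product]
    exact ⟨hbs v hv, Fintype.mem_piFinset.2 (hbx v hv), Fintype.mem_piFinset.2 (hbw v hv),
      Fintype.mem_piFinset.2 (hbz v hv)⟩
  set fs : ℤ → ℝ := fun s => Real.exp (-(g.τ * |(g.D : ℝ) * s| ^ p))
  set fx : (X → ℤ) → ℝ := fun x => ∏ i, Real.exp (-(g.τ * |(g.D : ℝ) * x i| ^ p))
  set fw : ℤ → (X → ℤ) → (Y → ℤ) → ℝ := fun s x w =>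
    ∏ y, Real.exp (-(g.τ * |(g.D * g.β : ℝ) * ((eqnResidual A b s x y + 2 * w y : ℤ) : ℝ)| ^ p))
  set fz : ℤ → (Y × Fin g.N → ℤ) → ℝ := fun s z =>
    ∏ yj, Real.exp (-(g.τ * |(g.D : ℝ) * z yj + g.J * s| ^ p))
  have hfs0 : ∀ s, 0 ≤ fs s := fun s => (Real.exp_pos _).le
  have hfx0 : ∀ x, 0 ≤ fx x := fun x => Finset.prod_nonneg fun _ _ => (Real.exp_pos _).le
  have hfw0 : ∀ s x w, 0 ≤ fw s x w := fun s x w => Finset.prod_nonneg fun _ _ => (Real.exp_pos _).le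
  have hfz0 : ∀ s z, 0 ≤ fz s z := fun s z => Finset.prod_nonneg fun _ _ => (Real.exp_pos _).le
  have hfact : ∀ s x w z, Real.exp (-(g.τ * costPow g A b s x w z)) =
      fs s * (fx x * (fw s x w * fz s z)) := by
    intro s x w z
    simp only [fs, fx, fw, fz, ← Real.exp_sum, ← Real.exp_add, costPow, Finset.sum_neg_distrib,
      ← Finset.mul_sum]
    congr 1
    ring
  have hsumx : ∑ x ∈ PX, fx x ≤ g.X ^ Fintype.card X := by
    rw [← Finset.prod_univ_sum (fun _ => bx) fun _ x => Real.exp (-(g.τ * |(g.D : ℝ) * (x : ℝ)| ^ p))]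
    calc _ ≤ ∏ _i : X, g.X := Finset.prod_le_prod
          (fun i _ => Finset.sum_nonneg fun _ _ => (Real.exp_pos _).le) fun i _ => g.sum_le_X _
      _ = _ := by simp
  have hsumw : ∀ s x, ∑ w ∈ PW, fw s x w ≤
      g.X ^ M * g.κ ^ (Finset.univ.filter fun y => Odd (eqnResidual A b s x y)).card := by
    intro s x
    rw [← Finset.prod_univ_sum (fun _ => bw) fun y w =>
      Real.exp (-(g.τ * |(g.D * g.β : ℝ) * ((eqnResidual A b s x y + 2 * w : ℤ) : ℝ)| ^ p))]
    calc _ ≤ ∏ y : Y, g.X * (if Odd (eqnResidual A b s x y) then g.κ else 1) := Finset.prod_le_prod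
          (fun i _ => Finset.sum_nonneg fun _ _ => (Real.exp_pos _).le)
          fun y _ => sum_row_le g hp _ _
      _ = _ := by
        rw [Finset.prod_mul_distrib, Finset.prod_const, Finset.card_univ, Finset.prod_ite,
          Finset.prod_const, Finset.prod_const_one, mul_one]
  have hsumz : ∀ (s : ℤ) (Θ : ℝ), (∀ T : Finset ℤ,
      ∑ z ∈ T, Real.exp (-(g.τ * |(g.D : ℝ) * z + g.J * s| ^ p)) ≤ Θ) →
      ∑ z ∈ PZ, fz s z ≤ (Θ ^ g.N) ^ M := by
    intro s Θ hΘ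
    rw [← Finset.prod_univ_sum (fun _ => bz) fun _ z =>
      Real.exp (-(g.τ * |(g.D : ℝ) * z + g.J * s| ^ p))]
    calc _ ≤ ∏ _i : Y × Fin g.N, Θ := Finset.prod_le_prod
          (fun i _ => Finset.sum_nonneg fun _ _ => (Real.exp_pos _).le) fun i _ => hΘ _
      _ = _ := by
        rw [Finset.prod_const, Finset.card_univ, Fintype.card_prod, Fintype.card_fin, mul_comm, pow_mul]
  have hκ0 : 0 < g.κ := Real.exp_pos _
  have hDβ := g.D_rpow_le hp
  have hκ1 : g.κ ≤ 1 := by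
    rw [Gadget.κ, Real.exp_le_one_iff, neg_nonpos]
    exact mul_nonneg hτ.le (by linarith)
  -- For even s only the trivial bound κ ≤ 1 is used, together with Θe. For odd s, the reduction of
  -- x modulo 2 is an assignment, so the NO promise yields at least (3/8 + ε)M factors κ.
  have hinner : ∀ s x, (∑ w ∈ PW, fw s x w) * ∑ z ∈ PZ, fz s z ≤ g.X ^ M * Ks ^ M := by
    intro s x
    rcases Int.even_or_odd s with hs | hs
    · refine mul_le_mul ((hsumw s x).trans ?_) ((hsumz s _ fun T => g.sum_le_Θe s T hs).trans ?_)
        (Finset.sum_nonneg fun _ _ => hfz0 _ _) (by positivity)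
      · exact mul_le_of_le_one_right (by positivity) (pow_le_one₀ hκ0.le hκ1)
      · exact pow_le_pow_left₀ (by positivity) (le_max_right _ _) _
    · have hodd : (3 / 8 + ε) * M ≤
          ((Finset.univ.filter fun y => Odd (eqnResidual A b s x y)).card : ℝ) := by
        have h1 := hno fun i => (x i : ZMod 2)
        have h2 := Finset.card_filter_add_card_filter_not (s := (Finset.univ : Finset Y))
          (fun y => ∑ i, A y i * (x i : ZMod 2) = b y)
        rw [Finset.card_univ, ← hM] at h2
        have h3 : (Finset.univ.filter fun y => Odd (eqnResidual A b s x y)) =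
            Finset.univ.filter fun y => ¬ ∑ i, A y i * (x i : ZMod 2) = b y :=
          Finset.filter_congr fun y _ => odd_eqnResidual_iff A b hs x y
        rw [h3]
        have h4 : (((Finset.univ.filter fun y => ∑ i, A y i * (x i : ZMod 2) = b y).card : ℝ)) +
          ((Finset.univ.filter fun y => ¬ ∑ i, A y i * (x i : ZMod 2) = b y).card : ℝ) = M := by
          exact_mod_cast h2
        linarith
      have hκpow : g.κ ^ (Finset.univ.filter fun y => Odd (eqnResidual A b s x y)).card ≤
          (Real.exp (-(g.τ * ((g.D * g.β : ℝ) ^ p - (g.D : ℝ) ^ p) * (3 / 8 + ε)))) ^ M := by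
        rw [Gadget.κ, ← Real.exp_nat_mul, ← Real.exp_nat_mul, Real.exp_le_exp]
        have : 0 ≤ g.τ * ((g.D * g.β : ℝ) ^ p - (g.D : ℝ) ^ p) := mul_nonneg hτ.le (by linarith)
        have := mul_le_mul_of_nonneg_left hodd this
        linarith
      calc _ ≤ (g.X ^ M * (Real.exp (-(g.τ * ((g.D * g.β : ℝ) ^ p - (g.D : ℝ) ^ p) * (3 / 8 + ε)))) ^ M)
            * (g.Θo ^ g.N) ^ M :=
            mul_le_mul ((hsumw s x).trans (mul_le_mul_of_nonneg_left hκpow (by positivity)))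
              (hsumz s _ fun T => g.sum_le_Θo s T) (Finset.sum_nonneg fun _ _ => hfz0 _ _)
              (by positivity)
        _ = g.X ^ M * (g.Θo ^ g.N *
            Real.exp (-(g.τ * ((g.D * g.β : ℝ) ^ p - (g.D : ℝ) ^ p) * (3 / 8 + ε)))) ^ M := by
            rw [mul_pow (g.Θo ^ g.N)]; ring
        _ ≤ g.X ^ M * Ks ^ M := by
            refine mul_le_mul_of_nonneg_left ?_ (by positivity)
            exact pow_le_pow_left₀ (by positivity) (le_max_left _ _) _
  have hsum : ∑ v ∈ T, Real.exp (-(g.τ * costPow g A b v.1 v.2.1 v.2.2.1 v.2.2.2)) ≤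
      (g.X ^ 3 * Ks) ^ M := by
    calc _ ≤ ∑ v ∈ bs ×ˢ PX ×ˢ PW ×ˢ PZ,
          Real.exp (-(g.τ * costPow g A b v.1 v.2.1 v.2.2.1 v.2.2.2)) :=
          Finset.sum_le_sum_of_subset_of_nonneg hsub fun _ _ _ => (Real.exp_pos _).le
      _ = ∑ s ∈ bs, fs s * ∑ x ∈ PX, fx x * ((∑ w ∈ PW, fw s x w) * ∑ z ∈ PZ, fz s z) := by
          rw [Finset.sum_product]
          refine Finset.sum_congr rfl fun s _ => ?_
          rw [Finset.sum_product, Finset.mul_sum]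
          refine Finset.sum_congr rfl fun x _ => ?_
          rw [Finset.sum_product, Finset.sum_mul_sum, Finset.mul_sum, Finset.mul_sum]
          refine Finset.sum_congr rfl fun w _ => ?_
          rw [Finset.mul_sum, Finset.mul_sum]
          exact Finset.sum_congr rfl fun z _ => hfact _ _ _ _
      _ ≤ ∑ s ∈ bs, fs s * ∑ x ∈ PX, fx x * (g.X ^ M * Ks ^ M) := by
          refine Finset.sum_le_sum fun s _ => mul_le_mul_of_nonneg_left ?_ (hfs0 s)
          exact Finset.sum_le_sum fun x _ => mul_le_mul_of_nonneg_left (hinner s x) (hfx0 x)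
      _ = (∑ s ∈ bs, fs s) * ((∑ x ∈ PX, fx x) * (g.X ^ M * Ks ^ M)) := by
          rw [Finset.sum_mul, Finset.sum_mul]
      _ ≤ g.X * (g.X ^ Fintype.card X * (g.X ^ M * Ks ^ M)) := by
          refine mul_le_mul (g.sum_le_X bs) (mul_le_mul_of_nonneg_right hsumx (by positivity)) ?_ hX0
          exact mul_nonneg (Finset.sum_nonneg fun _ _ => hfx0 _) (by positivity)
      _ ≤ g.X ^ M * (g.X ^ M * (g.X ^ M * Ks ^ M)) := by
          -- The assumptions 1 ≤ |Y| and |X| ≤ |Y| enter here: s and x are each charged X^M.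
          have h1 : g.X ≤ g.X ^ M := le_self_pow₀ hX (by omega)
          have h2 : g.X ^ Fintype.card X ≤ g.X ^ M := pow_le_pow_right₀ hX hXY
          gcongr
      _ = _ := by ring
  calc _ ≤ (6 * g.G * Real.exp (g.τ * g.G)) ^ M * (g.X ^ 3 * Ks) ^ M :=
        mul_le_mul_of_nonneg_left hsum (by positivity)
    _ = (6 * g.G * Real.exp (g.τ * g.G) * g.X ^ 3 * Ks) ^ M := by rw [← mul_pow]; ring
    _ ≤ _ := pow_le_pow_left₀ (by positivity) hKa _

end Counting

/-! ### Soundness and completeness of the random linear form -/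

section Reduction

variable {p ε : ℝ} {X Y : Type} [Fintype X] [Fintype Y]

theorem abs_le_of_rpow_abs_le {p t r : ℝ} (hp : 1 ≤ p) (hr : 1 ≤ r) (h : |t| ^ p ≤ r) : |t| ≤ r := by
  by_contra! hlt
  have h1 : |t| ≤ |t| ^ p := by
    simpa using Real.rpow_le_rpow_of_exponent_le (by linarith : 1 ≤ |t|) hp
  linarith

theorem abs_le_of_rpow_abs_mul_le {p c r : ℝ} {u : ℤ} (hp : 1 ≤ p) (hr : 1 ≤ r) (hc : 1 ≤ c)
    (h : |c * u| ^ p ≤ r) : |(u : ℝ)| ≤ r := by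
  have h1 := abs_le_of_rpow_abs_le hp hr h
  rw [abs_mul, abs_of_pos (by linarith : 0 < c)] at h1
  nlinarith [abs_nonneg (u : ℝ)]

/-- Every coordinate of a short vector is small. -/
theorem abs_le_of_costPow_le (g : Gadget p ε) (hp : 1 ≤ p) {A : Y → X → ZMod 2} {b : Y → ZMod 2}
    {s : ℤ} {x : X → ℤ} {w : Y → ℤ} {z : Y × Fin g.N → ℤ} {r : ℝ} (hr : 1 ≤ r)
    (h : costPow g A b s x w z ≤ r) :
    |(s : ℝ)| ≤ r ∧ (∀ i, |(x i : ℝ)| ≤ r) ∧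
      (∀ y, |((eqnResidual A b s x y + 2 * w y : ℤ) : ℝ)| ≤ r) ∧
      ∀ yj, |((g.D * z yj + g.J * s : ℤ) : ℝ)| ≤ r := by
  have h1 : ∀ i, 0 ≤ |(g.D : ℝ) * x i| ^ p := fun i => by positivity
  have h2 : ∀ y, 0 ≤ |(g.D * g.β : ℝ) * ((eqnResidual A b s x y + 2 * w y : ℤ) : ℝ)| ^ p :=
    fun y => by positivity
  have h3 : ∀ yj, 0 ≤ |(g.D : ℝ) * z yj + g.J * s| ^ p := fun yj => by positivity
  have h4 : 0 ≤ |(g.D : ℝ) * s| ^ p := by positivity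
  have s1 := Finset.sum_nonneg fun i (_ : i ∈ Finset.univ) => h1 i
  have s2 := Finset.sum_nonneg fun i (_ : i ∈ Finset.univ) => h2 i
  have s3 := Finset.sum_nonneg fun i (_ : i ∈ Finset.univ) => h3 i
  unfold costPow at h
  refine ⟨abs_le_of_rpow_abs_mul_le hp hr g.one_le_D (by linarith), fun i => ?_, fun y => ?_,
    fun yj => ?_⟩
  · have := Finset.single_le_sum (fun i _ => h1 i) (Finset.mem_univ i)
    exact abs_le_of_rpow_abs_mul_le hp hr g.one_le_D (by linarith)
  · have := Finset.single_le_sum (fun i _ => h2 i) (Finset.mem_univ y)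
    exact abs_le_of_rpow_abs_mul_le hp hr
      (one_le_mul_of_one_le_of_one_le g.one_le_D g.one_le_β) (this.trans (by linarith))
  · have := Finset.single_le_sum (fun i _ => h3 i) (Finset.mem_univ yj)
    push_cast
    exact abs_le_of_rpow_abs_le hp hr (by linarith)

theorem int_abs_le_natFloor {u : ℤ} {r : ℝ} (h : |(u : ℝ)| ≤ r) : u.natAbs ≤ ⌊r⌋₊ := by
  refine Nat.le_floor ?_
  rwa [Nat.cast_natAbs, Int.cast_abs]

/-- The coordinates of a short vector lie in a finite box and determine s and x, and then w and z.
-/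
theorem finite_costPow_le (g : Gadget p ε) (hp : 1 ≤ p) (A : Y → X → ZMod 2) (b : Y → ZMod 2)
    {r : ℝ} (hr : 1 ≤ r) :
    {v : ℤ × (X → ℤ) × (Y → ℤ) × (Y × Fin g.N → ℤ) |
      costPow g A b v.1 v.2.1 v.2.2.1 v.2.2.2 ≤ r}.Finite := by
  set K : Set ℤ := Set.Icc (-(⌊r⌋₊ : ℤ)) ⌊r⌋₊ with hK
  have hmem : ∀ {u : ℤ}, |(u : ℝ)| ≤ r → u ∈ K := by
    intro u hu
    have := int_abs_le_natFloor hu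
    rw [hK, Set.mem_Icc]
    omega
  have hKf : K.Finite := Set.finite_Icc _ _
  refine Set.Finite.of_injOn
    (f := fun v => (v.1, v.2.1, (fun y => eqnResidual A b v.1 v.2.1 y + 2 * v.2.2.1 y),
      fun yj => (g.D * v.2.2.2 yj + g.J * v.1 : ℤ)))
    (t := K ×ˢ (Set.pi Set.univ fun _ => K) ×ˢ (Set.pi Set.univ fun _ => K) ×ˢ
      (Set.pi Set.univ fun _ => K)) ?_ ?_
    (hKf.prod ((Set.Finite.pi' fun _ => hKf).prod ((Set.Finite.pi' fun _ => hKf).prod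
      (Set.Finite.pi' fun _ => hKf))) |>.subset ?_)
  · intro v hv
    obtain ⟨h1, h2, h3, h4⟩ := abs_le_of_costPow_le g hp hr hv
    exact ⟨hmem h1, fun i _ => hmem (h2 i), fun y _ => hmem (h3 y), fun yj _ => hmem (h4 yj)⟩
  · rintro ⟨s, x, w, z⟩ _ ⟨s', x', w', z'⟩ _ h
    simp only [Prod.mk.injEq] at h
    obtain ⟨rfl, rfl, h3, h4⟩ := h
    have hw : w = w' := funext fun y => by
      have := congrFun h3 y
      omega
    have hz : z = z' := funext fun yj => by
      have h5 := congrFun h4 yj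
      simp only [add_left_inj] at h5
      exact mul_left_cancel₀ (by exact_mod_cast g.D_pos.ne') h5
    rw [hw, hz]
  · intro v hv
    exact ⟨hv.1, fun i => hv.2.1 i trivial, fun i => hv.2.2.1 i trivial, fun i => hv.2.2.2 i trivial⟩

/-- Every nonzero short vector has a nonzero small coefficient. -/
theorem exists_small_coefficient (g : Gadget p ε) (hp : 1 ≤ p) {A : Y → X → ZMod 2} {b : Y → ZMod 2}
    {s : ℤ} {x : X → ℤ} {w : Y → ℤ} {z : Y × Fin g.N → ℤ} {r : ℝ} (hr : 1 ≤ r)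
    (h : costPow g A b s x w z ≤ r) (hne : coef s x w z ≠ 0) :
    ∃ i, coef s x w z i ≠ 0 ∧ (coef s x w z i).natAbs ≤ ⌊r⌋₊ := by
  obtain ⟨h1, h2, h3, h4⟩ := abs_le_of_costPow_le g hp hr h
  -- Coefficients are examined in the order s, x, w, z: once the earlier ones vanish, the small
  -- coordinate is a nonzero multiple of the next coefficient.
  by_cases hs : s = 0
  swap
  · exact ⟨Sum.inr 0, hs, int_abs_le_natFloor h1⟩
  by_cases hx : ∃ i, x i ≠ 0
  · obtain ⟨i, hi⟩ := hx
    exact ⟨Sum.inl (Sum.inl (Sum.inl i)), hi, int_abs_le_natFloor (h2 i)⟩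
  push Not at hx
  have hres : ∀ y, eqnResidual A b s x y = 0 := fun y => by simp [eqnResidual, hs, hx]
  by_cases hw : ∃ y, w y ≠ 0
  · obtain ⟨y, hy⟩ := hw
    refine ⟨Sum.inl (Sum.inl (Sum.inr y)), hy, ?_⟩
    have := int_abs_le_natFloor (h3 y)
    rw [hres] at this
    have e : coef s x w z (Sum.inl (Sum.inl (Sum.inr y))) = w y := rfl
    rw [e]
    omega
  push Not at hw
  by_cases hz : ∃ yj, z yj ≠ 0
  · obtain ⟨yj, hyj⟩ := hz
    refine ⟨Sum.inl (Sum.inr yj), hyj, ?_⟩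
    have := int_abs_le_natFloor (h4 yj)
    rw [hs, mul_zero, add_zero, Int.natAbs_mul, Int.natAbs_natCast] at this
    have e : coef s x w z (Sum.inl (Sum.inr yj)) = z yj := rfl
    rw [e]
    exact (Nat.le_mul_of_pos_left _ g.D_pos).trans this
  push Not at hz
  refine absurd (funext fun i => ?_) hne
  rcases i with ((i | i) | i) | i
  · exact hx i
  · exact hw i
  · exact hz i
  · exact hs

/-- Soundness: if no assignment satisfies many equations, then most linear forms vanish on no short
vector. -/
theorem three_mul_ncard_le (g : Gadget p ε) (hp : 1 ≤ p) (A : Y → X → ZMod 2) (b : Y → ZMod 2)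
    (hXY : Fintype.card X ≤ Fintype.card Y) (hY : 1 ≤ Fintype.card Y)
    (hno : ∀ x : X → ZMod 2, ((Finset.univ.filter fun y => ∑ i, A y i * x i = b y).card : ℝ)
      ≤ (5 / 8 - ε) * Fintype.card Y) (l : ℕ) (hl : l = g.a * Fintype.card Y) :
    3 * ({c : CoefIndex X Y g.N → ZMod (2 ^ l) | ∃ s x w z, coef s x w z ≠ 0 ∧
      costPow g A b s x w z ≤ g.G * Fintype.card Y ∧ modForm (2 ^ l) (coef s x w z) c = 0}.ncard : ℝ)
      ≤ ((2 : ℝ) ^ l) ^ Fintype.card (CoefIndex X Y g.N) := by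
  classical
  set M := Fintype.card Y with hM
  have hG := g.one_le_G
  have hτ := g.τ_pos
  have hM1 : (1 : ℝ) ≤ M := by exact_mod_cast hY
  set r : ℝ := g.G * M with hr
  have hr1 : 1 ≤ r := one_le_mul_of_one_le_of_one_le hG hM1
  obtain ⟨T, hmemT⟩ : ∃ T : Finset (ℤ × (X → ℤ) × (Y → ℤ) × (Y × Fin g.N → ℤ)),
      ∀ v, v ∈ T ↔ costPow g A b v.1 v.2.1 v.2.2.1 v.2.2.2 ≤ r :=
    ⟨(finite_costPow_le g hp A b hr1).toFinset, fun v => Set.Finite.mem_toFinset _⟩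
  set S : Finset (CoefIndex X Y g.N → ℤ) :=
    (T.image fun v => coef v.1 v.2.1 v.2.2.1 v.2.2.2).filter fun v => v ≠ 0 with hS
  have hset : {c : CoefIndex X Y g.N → ZMod (2 ^ l) | ∃ s x w z, coef s x w z ≠ 0 ∧
      costPow g A b s x w z ≤ r ∧ modForm (2 ^ l) (coef s x w z) c = 0} =
      {c | ∃ v ∈ S, modForm (2 ^ l) v c = 0} := by
    ext c
    constructor
    · rintro ⟨s, x, w, z, h0, h1, h2⟩
      exact ⟨_, Finset.mem_filter.2 ⟨Finset.mem_image.2 ⟨(s, x, w, z), (hmemT (s, x, w, z)).2 h1, rfl⟩, h0⟩, h2⟩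
    · rintro ⟨v, hv, h2⟩
      obtain ⟨hv, h0⟩ := Finset.mem_filter.1 hv
      obtain ⟨⟨s, x, w, z⟩, h1, rfl⟩ := Finset.mem_image.1 hv
      exact ⟨s, x, w, z, h0, (hmemT (s, x, w, z)).1 h1, h2⟩
  rw [hset]
  have hfirst := card_exists_modForm_eq_zero_mul_le (2 ^ l) S ⌊r⌋₊ (by
    intro v hv
    obtain ⟨hv, h0⟩ := Finset.mem_filter.1 hv
    obtain ⟨⟨s, x, w, z⟩, h1, rfl⟩ := Finset.mem_image.1 hv
    exact exists_small_coefficient g hp hr1 ((hmemT (s, x, w, z)).1 h1) h0)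
  set n := {c : CoefIndex X Y g.N → ZMod (2 ^ l) | ∃ v ∈ S, modForm (2 ^ l) v c = 0}.ncard
  have hScard : (S.card : ℝ) ≤ T.card := by
    exact_mod_cast (Finset.card_filter_le _ _).trans Finset.card_image_le
  -- Every counted vector has weight at least exp(-τr).
  have hTcard : (T.card : ℝ) ≤ Real.exp (g.τ * r) *
      ∑ v ∈ T, Real.exp (-(g.τ * costPow g A b v.1 v.2.1 v.2.2.1 v.2.2.2)) := by
    rw [Finset.mul_sum, Finset.card_eq_sum_ones, Nat.cast_sum]
    refine Finset.sum_le_sum fun v hv => ?_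
    rw [← Real.exp_add, Nat.cast_one]
    refine Real.one_le_exp ?_
    have := mul_le_mul_of_nonneg_left ((hmemT v).1 hv) hτ.le
    linarith
  have hsum := sum_exp_costPow_le g (by linarith) A b hXY hY hno T
  rw [← hM] at hsum
  set W := ∑ v ∈ T, Real.exp (-(g.τ * costPow g A b v.1 v.2.1 v.2.2.1 v.2.2.2)) with hW
  have hW0 : 0 ≤ W := Finset.sum_nonneg fun _ _ => (Real.exp_pos _).le
  -- The 6 of the gadget is spent here: 3 for the failure probability 1/3, and 2^M against the
  -- factor M in r.
  have h3r : 3 * r ≤ (6 * g.G) ^ M := by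
    have h2M : (M : ℝ) ≤ 2 ^ M := by exact_mod_cast Nat.lt_two_pow_self.le
    have h3 : (3 : ℝ) ≤ 3 ^ M := le_self_pow₀ (by norm_num) (by omega)
    have hGM : g.G ≤ g.G ^ M := le_self_pow₀ hG (by omega)
    calc 3 * r = 3 * M * g.G := by rw [hr]; ring
      _ ≤ 3 ^ M * 2 ^ M * g.G ^ M := by gcongr
      _ = (6 * g.G) ^ M := by rw [← mul_pow, ← mul_pow]; norm_num
  have hexp : Real.exp (g.τ * r) = Real.exp (g.τ * g.G) ^ M := by
    rw [← Real.exp_nat_mul, hr]; ring_nf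
  set Q : ℝ := ((2 : ℝ) ^ l) ^ Fintype.card (CoefIndex X Y g.N) with hQ
  have hQ0 : 0 < Q := by positivity
  have hq : ((2 : ℝ) ^ g.a) ^ M = 2 ^ l := by rw [← pow_mul, hl]
  have hfirstR : (n : ℝ) * 2 ^ l ≤ S.card * ⌊r⌋₊ * Q := by
    rw [hQ]; exact_mod_cast hfirst
  have hfl : (⌊r⌋₊ : ℝ) ≤ r := Nat.floor_le (by linarith)
  have hfin : 3 * (n : ℝ) * 2 ^ l ≤ Q * 2 ^ l := by
    calc 3 * (n : ℝ) * 2 ^ l ≤ 3 * (S.card * ⌊r⌋₊ * Q) := by linarith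
      _ ≤ 3 * ((Real.exp (g.τ * r) * W) * r * Q) := by
          have := hScard.trans hTcard
          gcongr
      _ = (3 * r) * Real.exp (g.τ * r) * W * Q := by ring
      _ ≤ (6 * g.G) ^ M * Real.exp (g.τ * g.G) ^ M * W * Q := by
          rw [hexp]; gcongr
      _ = (6 * g.G * Real.exp (g.τ * g.G)) ^ M * W * Q := by rw [← mul_pow]
      _ ≤ (2 ^ g.a) ^ M * Q := by gcongr
      _ = Q * 2 ^ l := by rw [hq, mul_comm]
  exact le_of_mul_le_mul_right hfin (by positivity)

/-- The norm of a short vector is less than the weight of the linear form. -/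
theorem mul_card_lt_two_pow_rpow (g : Gadget p ε) (hp : 1 ≤ p) {M l : ℕ} (hM : 1 ≤ M)
    (hl : l = g.a * M) : g.G * M < ((2 : ℝ) ^ l) ^ p := by
  have hG := g.one_le_G
  have hX := g.one_le_X
  have hΘ := g.one_le_Θe
  -- The remaining factors on the left of `even_le` are at least 1.
  have h1 : 6 * g.G ≤ 2 ^ g.a := by
    refine le_trans ?_ g.even_le
    have e1 : 1 ≤ Real.exp (g.τ * g.G) := Real.one_le_exp (mul_nonneg g.τ_pos.le (by linarith))
    have e2 : 1 ≤ g.X ^ 3 := one_le_pow₀ hX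
    have e3 : 1 ≤ g.Θe ^ g.N := one_le_pow₀ hΘ
    have e4 : 0 ≤ 6 * g.G := by linarith
    calc 6 * g.G = 6 * g.G * 1 * 1 * 1 := by ring
      _ ≤ _ := by gcongr
  have h2 : g.G * M < (6 * g.G) ^ M := by
    have h2M : (M : ℝ) < 2 ^ M := by exact_mod_cast Nat.lt_two_pow_self
    have hGM : g.G ≤ g.G ^ M := le_self_pow₀ hG (by omega)
    calc g.G * M < g.G * 2 ^ M := by gcongr
      _ ≤ g.G ^ M * 6 ^ M := by gcongr; norm_num
      _ = _ := by rw [← mul_pow, mul_comm]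
  have h3 : (6 * g.G) ^ M ≤ 2 ^ l := by
    rw [hl, pow_mul]
    gcongr
  have h4 : (2 : ℝ) ^ l ≤ ((2 : ℝ) ^ l) ^ p := by
    simpa using Real.rpow_le_rpow_of_exponent_le (one_le_pow₀ (by norm_num) : (1 : ℝ) ≤ 2 ^ l) hp
  linarith

/-- Completeness: if an assignment satisfies many equations, then most linear forms vanish on some
short vector. -/
theorem two_thirds_le_ncard (g : Gadget p ε) (hp : 1 ≤ p) (A : Y → X → ZMod 2) (b : Y → ZMod 2)
    (hXY : Fintype.card X ≤ Fintype.card Y) (hY : 1 ≤ Fintype.card Y) (x₀ : X → ZMod 2)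
    (hyes : 5 / 8 * (Fintype.card Y : ℝ) ≤
      ((Finset.univ.filter fun y => ∑ i, A y i * x₀ i = b y).card : ℝ))
    (l : ℕ) (hl : l = g.a * Fintype.card Y) :
    2 / 3 * ((2 : ℝ) ^ l) ^ Fintype.card (CoefIndex X Y g.N) ≤
      ({c : CoefIndex X Y g.N → ZMod (2 ^ l) | ∃ x w z,
        costPow g A b 1 x w z ≤ g.ρ * Fintype.card Y ∧
          modForm (2 ^ l) (coef 1 x w z) c = 0}.ncard : ℝ) := by
  classical
  set M := Fintype.card Y with hM
  set x : X → ℤ := fun i => ((x₀ i).val : ℤ) with hx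
  -- This choice leaves remainder 0 or 1 in each equation.
  set w : Y → ℤ := fun y => -(eqnResidual A b 1 x y / 2) with hw
  -- Only the gadget points vary, one from Z per equation. The coefficient s = 1 is the common unit
  -- coordinate that the second moment bound requires.
  set P : Finset (Y → Fin g.N → ℤ) := Fintype.piFinset fun _ => g.Z with hP
  set f : (Y → Fin g.N → ℤ) → CoefIndex X Y g.N → ℤ :=
    fun z => coef 1 x w fun yj => z yj.1 yj.2 with hf
  have hfinj : Function.Injective f := by
    intro z z' h
    funext y j
    exact congrFun h (Sum.inl (Sum.inr (y, j)))
  set S : Finset (CoefIndex X Y g.N → ℤ) := P.map ⟨f, hfinj⟩ with hS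
  have hScard : (S.card : ℝ) = (g.Z.card : ℝ) ^ M := by
    rw [hS, Finset.card_map, hP, Fintype.card_piFinset]
    simp [hM]
  have hD := g.D_pos'
  have hcost : ∀ z ∈ P, costPow g A b 1 x w (fun yj => z yj.1 yj.2) ≤ g.ρ * M := by
    intro z hz
    have hz' := Fintype.mem_piFinset.1 hz
    have h1 : ∑ i, |(g.D : ℝ) * x i| ^ p ≤ M * (g.D : ℝ) ^ p := by
      calc _ ≤ ∑ _i : X, (g.D : ℝ) ^ p := by
            refine Finset.sum_le_sum fun i _ => ?_
            have hx1 : ((x i : ℤ) : ℝ) ≤ 1 := by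
              have : (x₀ i).val < 2 := ZMod.val_lt _
              change (((x₀ i).val : ℤ) : ℝ) ≤ 1
              exact_mod_cast Nat.lt_succ_iff.1 this
            have hx0 : 0 ≤ ((x i : ℤ) : ℝ) := by rw [hx]; positivity
            rw [abs_of_nonneg (by positivity)]
            refine Real.rpow_le_rpow (by positivity) ?_ (by linarith)
            exact mul_le_of_le_one_right hD.le hx1
        _ = (Fintype.card X : ℝ) * (g.D : ℝ) ^ p := by simp
        _ ≤ _ := by gcongr
    have h2 : ∑ y, |(g.D * g.β : ℝ) * ((eqnResidual A b 1 x y + 2 * w y : ℤ) : ℝ)| ^ p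
        ≤ 3 / 8 * M * (g.D * g.β : ℝ) ^ p := by
      have hy : ∀ y, |(g.D * g.β : ℝ) * ((eqnResidual A b 1 x y + 2 * w y : ℤ) : ℝ)| ^ p =
          if ¬ ∑ i, A y i * x₀ i = b y then (g.D * g.β : ℝ) ^ p else 0 := by
        intro y
        have hres : eqnResidual A b 1 x y + 2 * w y = eqnResidual A b 1 x y % 2 := by
          rw [hw]; simp only; omega
        have hodd := odd_eqnResidual_iff A b odd_one x y
        have hxc : ∀ i, ((x i : ℤ) : ZMod 2) = x₀ i := fun i => by
          rw [hx]; simp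
        simp only [hxc] at hodd
        rw [hres]
        by_cases h : ∑ i, A y i * x₀ i = b y
        · rw [if_neg (not_not.2 h)]
          have he : Even (eqnResidual A b 1 x y) := by
            rw [← Int.not_odd_iff_even, hodd, not_not]; exact h
          rw [Int.even_iff.1 he]
          simp [Real.zero_rpow (by linarith : p ≠ 0)]
        · rw [if_pos h, Int.odd_iff.1 (hodd.2 h), Int.cast_one, mul_one, abs_of_nonneg (by positivity)]
      simp only [hy]
      rw [← Finset.sum_filter, Finset.sum_const, nsmul_eq_mul]
      refine mul_le_mul_of_nonneg_right ?_ (by positivity)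
      have h3 := Finset.card_filter_add_card_filter_not (s := (Finset.univ : Finset Y))
          (fun y => ∑ i, A y i * x₀ i = b y)
      rw [Finset.card_univ, ← hM] at h3
      have h4 : (((Finset.univ.filter fun y => ∑ i, A y i * x₀ i = b y).card : ℝ)) +
          ((Finset.univ.filter fun y => ¬ ∑ i, A y i * x₀ i = b y).card : ℝ) = M := by
        exact_mod_cast h3
      linarith
    -- The single coordinate of s is charged to all M equations; with `h1` this uses up the 2D^p of
    -- `close`.
    have h3 : |(g.D : ℝ) * ((1 : ℤ) : ℝ)| ^ p ≤ M * (g.D : ℝ) ^ p := by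
      rw [Int.cast_one, mul_one, abs_of_pos hD]
      exact le_mul_of_one_le_left (by positivity) (by exact_mod_cast hY)
    have h4 : ∑ yj : Y × Fin g.N, |(g.D : ℝ) * z yj.1 yj.2 + g.J * ((1 : ℤ) : ℝ)| ^ p ≤
        M * (g.ρ - 2 * (g.D : ℝ) ^ p - 3 / 8 * (g.D * g.β : ℝ) ^ p) := by
      rw [Fintype.sum_prod_type]
      calc _ ≤ ∑ _y : Y, ((g.ρ : ℝ) - 2 * (g.D : ℝ) ^ p - 3 / 8 * (g.D * g.β : ℝ) ^ p) := by
            refine Finset.sum_le_sum fun y _ => ?_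
            have := g.close _ (hz' y)
            simp only [Int.cast_one, mul_one]
            linarith
        _ = _ := by simp [hM]; ring
    refine (add_le_add (add_le_add (add_le_add h1 h2) h4) h3).trans (le_of_eq ?_)
    ring
  have hsub : {c : CoefIndex X Y g.N → ZMod (2 ^ l) | ∃ v ∈ S, modForm (2 ^ l) v c = 0} ⊆
      {c | ∃ x w z, costPow g A b 1 x w z ≤ g.ρ * M ∧ modForm (2 ^ l) (coef 1 x w z) c = 0} := by
    rintro c ⟨v, hv, h⟩
    obtain ⟨z, hz, rfl⟩ := Finset.mem_map.1 hv
    exact ⟨x, w, _, hcost z hz, h⟩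
  have hncard := Set.ncard_le_ncard hsub (Set.toFinite _)
  refine le_trans ?_ (Nat.cast_le.2 hncard)
  have hZ := g.le_card
  refine two_thirds_le_card_exists_modForm_eq_zero l g.B S (Sum.inr 0) ?_ ?_ ?_ ?_
  · intro v hv
    obtain ⟨z, hz, rfl⟩ := Finset.mem_map.1 hv
    rfl
  · intro v hv v' hv' i
    obtain ⟨z, hz, rfl⟩ := Finset.mem_map.1 hv
    obtain ⟨z', hz', rfl⟩ := Finset.mem_map.1 hv'
    rcases i with ((i | i) | i) | i
    · simp [hf, coef]
    · simp [hf, coef]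
    · exact g.abs_sub_le _ (Fintype.mem_piFinset.1 hz i.1) _ (Fintype.mem_piFinset.1 hz' i.1) i.2
    · simp [hf, coef]
  · rw [hScard, hl, pow_mul]
    calc (4 : ℝ) * (2 ^ g.a) ^ M ≤ 4 ^ M * (2 ^ g.a) ^ M := by
          gcongr
          exact le_self_pow₀ (by norm_num) (by omega)
      _ = (4 * 2 ^ g.a) ^ M := by rw [mul_pow]
      _ ≤ _ := by gcongr
  · intro v hv
    obtain ⟨z, hz, rfl⟩ := Finset.mem_map.1 hv
    have hz' := Fintype.mem_piFinset.1 hz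
    have hfil : (S.filter fun v' => ∀ i, Even (v' i - (f z) i)).card ≤
        (Fintype.piFinset fun y => g.Z.filter fun u => ∀ i, Even (u i - z y i)).card := by
      rw [hS, Finset.filter_map, Finset.card_map]
      refine Finset.card_le_card fun u hu => ?_
      rw [Finset.mem_filter] at hu
      exact Fintype.mem_piFinset.2 fun y => Finset.mem_filter.2
        ⟨Fintype.mem_piFinset.1 hu.1 y, fun i => hu.2 (Sum.inl (Sum.inr (y, i)))⟩
    rw [Fintype.card_piFinset] at hfil
    have hfilR : ((S.filter fun v' => ∀ i, Even (v' i - (f z) i)).card : ℝ) ≤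
        ∏ y, ((g.Z.filter fun u => ∀ i, Even (u i - z y i)).card : ℝ) := by
      exact_mod_cast hfil
    rw [hScard]
    rcases Nat.eq_zero_or_pos g.B with hB | hB
    · rw [hB]; simp
    · have hB1 : (1 : ℝ) ≤ 4 * g.B := by
        have : (1 : ℝ) ≤ g.B := by exact_mod_cast hB
        linarith
      calc _ ≤ 4 * (g.B : ℝ) * ∏ y, ((g.Z.filter fun u => ∀ i, Even (u i - z y i)).card : ℝ) :=
            mul_le_mul_of_nonneg_left hfilR (by positivity)
        _ ≤ (4 * (g.B : ℝ)) ^ M * ∏ y, ((g.Z.filter fun u => ∀ i, Even (u i - z y i)).card : ℝ) := by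
            refine mul_le_mul_of_nonneg_right (le_self_pow₀ hB1 (by omega)) ?_
            exact Finset.prod_nonneg fun _ _ => Nat.cast_nonneg _
        _ = ∏ y, 4 * (g.B : ℝ) * ((g.Z.filter fun u => ∀ i, Even (u i - z y i)).card : ℝ) := by
            rw [Finset.prod_mul_distrib (f := fun _ => 4 * (g.B : ℝ)), Finset.prod_const, Finset.card_univ]
        _ ≤ ∏ _y : Y, (g.Z.card : ℝ) :=
            Finset.prod_le_prod (fun _ _ => by positivity) fun y _ => g.card_congr_le _ (hz' y)
        _ = _ := by simp [hM]

end Reduction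
/-! ### The lattice of a system of equations -/

section Basis

variable {p ε : ℝ} {X Y : Type}

/-- The entries of the basis matrix; the last row is that of the linear form. -/
def basisEntry [DecidableEq X] [DecidableEq Y] (g : Gadget p ε) (A : Y → X → ZMod 2)
    (b : Y → ZMod 2) (q : ℤ) (cv : CoefIndex X Y g.N → ℤ) :
    CoefIndex X Y g.N ⊕ Fin 1 → CoefIndex X Y g.N ⊕ Fin 1 → ℤ
  | .inl (.inl (.inl (.inl i))) =>
    Sum.elim (Sum.elim (Sum.elim (Sum.elim (fun j => if i = j then (g.D : ℤ) else 0)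
      fun _ => 0) fun _ => 0) fun _ => 0) fun _ => 0
  | .inl (.inl (.inl (.inr y))) =>
    Sum.elim (Sum.elim (Sum.elim (Sum.elim (fun j => (g.D * g.β : ℤ) * (A y j).val)
      fun y' => if y = y' then 2 * (g.D * g.β : ℤ) else 0) fun _ => 0)
      fun _ => (g.D * g.β : ℤ) * (b y).val) fun _ => 0
  | .inl (.inl (.inr r)) =>
    Sum.elim (Sum.elim (Sum.elim (Sum.elim (fun _ => 0) fun _ => 0)
      fun r' => if r = r' then (g.D : ℤ) else 0) fun _ => (g.J : ℤ)) fun _ => 0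
  | .inl (.inr _) =>
    Sum.elim (Sum.elim (Sum.elim (Sum.elim (fun _ => 0) fun _ => 0) fun _ => 0)
      fun _ => (g.D : ℤ)) fun _ => 0
  -- The overall factor q makes every nonzero value of this coordinate exceed the NO radius.
  | .inr _ => Sum.elim (fun c => q * cv c) fun _ => q * q

variable [Fintype X] [Fintype Y] [DecidableEq X] [DecidableEq Y]
  (g : Gadget p ε) (A : Y → X → ZMod 2) (b : Y → ZMod 2) (q : ℤ) (cv : CoefIndex X Y g.N → ℤ)
  {K : Type*} [CommRing K] (v : CoefIndex X Y g.N ⊕ Fin 1 → K)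

/-- The ring is left arbitrary because rows are evaluated over ℚ for independence and over ℝ for
norms. -/
theorem sum_basisEntry_x (i : X) :
    ∑ c, (basisEntry g A b q cv (.inl (.inl (.inl (.inl i)))) c : K) * v c =
      g.D * v (.inl (.inl (.inl (.inl i)))) := by
  simp [basisEntry, Fintype.sum_sum_type]

theorem sum_basisEntry_y (y : Y) :
    ∑ c, (basisEntry g A b q cv (.inl (.inl (.inl (.inr y)))) c : K) * v c =
      g.D * g.β * (∑ i, ((A y i).val : K) * v (.inl (.inl (.inl (.inl i)))) +
        (b y).val * v (.inl (.inr 0)) + 2 * v (.inl (.inl (.inl (.inr y))))) := by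
  simp [basisEntry, Fintype.sum_sum_type, mul_add, Finset.mul_sum, mul_assoc]
  ring

theorem sum_basisEntry_z (r : Y × Fin g.N) :
    ∑ c, (basisEntry g A b q cv (.inl (.inl (.inr r))) c : K) * v c =
      g.D * v (.inl (.inl (.inr r))) + g.J * v (.inl (.inr 0)) := by
  simp only [basisEntry, Fintype.sum_sum_type]
  simp

theorem sum_basisEntry_s (i : Fin 1) :
    ∑ c, (basisEntry g A b q cv (.inl (.inr i)) c : K) * v c = g.D * v (.inl (.inr 0)) := by
  simp [basisEntry, Fintype.sum_sum_type]

theorem sum_basisEntry_last (i : Fin 1) :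
    ∑ c, (basisEntry g A b q cv (.inr i) c : K) * v c =
      q * (∑ c, cv c * v (.inl c) + q * v (.inr 0)) := by
  simp [basisEntry, Fintype.sum_sum_type (α₁ := CoefIndex X Y g.N), mul_add, Finset.mul_sum, mul_assoc]

/-- In the order x, s, w, z, modulus, the matrix is triangular with nonzero diagonal. -/
theorem eq_zero_of_sum_basisEntry_eq_zero [IsDomain K] [CharZero K] (hq : q ≠ 0)
    (h : ∀ r, ∑ c, (basisEntry g A b q cv r c : K) * v c = 0) : v = 0 := by
  have hD : (g.D : K) ≠ 0 := Nat.cast_ne_zero.2 g.D_pos.ne'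
  have hβ : (g.β : K) ≠ 0 := Nat.cast_ne_zero.2 g.β_pos.ne'
  have hqK : (q : K) ≠ 0 := Int.cast_ne_zero.2 hq
  have hx : ∀ i, v (.inl (.inl (.inl (.inl i)))) = 0 := fun i => by
    have := h (.inl (.inl (.inl (.inl i))))
    rw [sum_basisEntry_x] at this
    exact (mul_eq_zero.1 this).resolve_left hD
  have hs : v (.inl (.inr 0)) = 0 := by
    have := h (.inl (.inr 0))
    rw [sum_basisEntry_s] at this
    exact (mul_eq_zero.1 this).resolve_left hD
  have hw : ∀ y, v (.inl (.inl (.inl (.inr y)))) = 0 := fun y => by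
    have := h (.inl (.inl (.inl (.inr y))))
    rw [sum_basisEntry_y] at this
    simpa [hx, hs, hD, hβ] using this
  have hz : ∀ r, v (.inl (.inl (.inr r))) = 0 := fun r => by
    have := h (.inl (.inl (.inr r)))
    rw [sum_basisEntry_z] at this
    simpa [hs, hD] using this
  have hc : ∀ c, v (.inl c) = 0 := by
    rintro (((i | i) | i) | i)
    · exact hx i
    · exact hw i
    · exact hz i
    · rw [Subsingleton.elim i 0]; exact hs
  have hu : v (.inr 0) = 0 := by
    have := h (.inr 0)
    rw [sum_basisEntry_last] at this
    simpa [hc, hqK] using this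
  funext c
  rcases c with c | c
  · exact hc c
  · rw [Subsingleton.elim c 0]; exact hu

/-- The `p`-th power of the norm of a lattice vector. -/
theorem sum_rpow_basisEntry (s : ℤ) (x : X → ℤ) (w : Y → ℤ) (z : Y × Fin g.N → ℤ) (u : ℤ) :
    ∑ r, |∑ c, (basisEntry g A b q cv r c : ℝ) * (Sum.elim (coef s x w z) (fun _ => u) c : ℤ)| ^ p =
      costPow g A b s x w z + |((q * (∑ c, cv c * coef s x w z c + q * u) : ℤ) : ℝ)| ^ p := by
  rw [Fintype.sum_sum_type, Fintype.sum_sum_type, Fintype.sum_sum_type, Fintype.sum_sum_type]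
  simp only [sum_basisEntry_x g A b q cv, sum_basisEntry_y g A b q cv, sum_basisEntry_z g A b q cv,
    sum_basisEntry_s g A b q cv, sum_basisEntry_last g A b q cv]
  unfold costPow
  simp [coef, eqnResidual]

end Basis

/-! ### The reduction -/

/-- The `p`-th power of the norm. -/
theorem norm_toLp_le_iff {p : ℝ} (hp : 1 ≤ p) {d : ℕ} (v : Fin d → ℝ) {R : ℝ} (hR : 0 ≤ R) :
    ‖WithLp.toLp (ENNReal.ofReal p) v‖ ≤ R ^ (1 / p) ↔ ∑ i, |v i| ^ p ≤ R := by
  have hp0 : 0 < p := by linarith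
  have ht : (ENNReal.ofReal p).toReal = p := ENNReal.toReal_ofReal hp0.le
  rw [PiLp.norm_eq_sum (by rw [ht]; exact hp0), ht]
  simp only [Real.norm_eq_abs]
  exact Real.rpow_le_rpow_iff (Finset.sum_nonneg fun i _ => by positivity) hR (by positivity)

namespace LinSystem

/-- The number of equations after repeating the system so that it has at least as many equations as
variables. -/
def M (S : LinSystem) : ℕ := (S.n / S.m + 1) * S.m

theorem n_le_M (S : LinSystem) : S.n ≤ S.M := by
  have := Nat.lt_mul_div_succ S.n S.m_pos
  rw [M, mul_comm]
  exact this.le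

theorem M_le (S : LinSystem) : S.M ≤ S.n + S.m := by
  rw [M, add_mul, one_mul]
  exact Nat.add_le_add_right (Nat.div_mul_le_self _ _) _

theorem M_pos (S : LinSystem) : 0 < S.M := Nat.mul_pos (Nat.succ_pos _) S.m_pos

/-- The equation that a row of the repeated system repeats. -/
def eqn (S : LinSystem) (y : Fin S.M) : Fin S.m := ⟨y % S.m, Nat.mod_lt _ S.m_pos⟩

/-- Numbering of the repeated equations. -/
def repEquiv (S : LinSystem) : Fin (S.n / S.m + 1) × Fin S.m ≃ Fin S.M := finProdFinEquiv

/-- Every equation is repeated equally often, so the satisfied fraction, and with it both promises,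
is preserved. -/
theorem card_filter_eqn (S : LinSystem) (P : Fin S.m → Prop) [DecidablePred P] :
    (Finset.univ.filter fun y => P (S.eqn y)).card =
      (S.n / S.m + 1) * (Finset.univ.filter P).card := by
  have h : (Finset.univ.filter fun y => P (S.eqn y)) =
      ((Finset.univ : Finset (Fin (S.n / S.m + 1))) ×ˢ Finset.univ.filter P).map
        S.repEquiv.toEmbedding := by
    ext y
    simp only [Finset.mem_filter, Finset.mem_univ, true_and, Finset.mem_map, Finset.mem_product,
      Equiv.coe_toEmbedding]
    have hmod : ∀ c e, S.eqn (S.repEquiv (c, e)) = e := fun c e => by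
      apply Fin.ext
      change (e + S.m * c : ℕ) % S.m = e
      rw [Nat.add_mul_mod_self_left, Nat.mod_eq_of_lt e.2]
    constructor
    · intro hy
      refine ⟨S.repEquiv.symm y, ?_, S.repEquiv.apply_symm_apply y⟩
      have h2 := hmod (S.repEquiv.symm y).1 (S.repEquiv.symm y).2
      rw [Prod.mk.eta, S.repEquiv.apply_symm_apply] at h2
      rwa [← h2]
    · rintro ⟨⟨c, e⟩, he, rfl⟩
      rwa [hmod]
  rw [h, Finset.card_map, Finset.card_product, Finset.card_univ, Fintype.card_fin]

/-- The matrix of the repeated system. -/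
def repA (S : LinSystem) (y : Fin S.M) (i : Fin S.n) : ZMod 2 := S.A (S.eqn y) i

/-- The right-hand side of the repeated system. -/
def repB (S : LinSystem) (y : Fin S.M) : ZMod 2 := S.b (S.eqn y)

theorem card_rep (S : LinSystem) (x : Fin S.n → ZMod 2) :
    (Finset.univ.filter fun y => ∑ i, S.repA y i * x i = S.repB y).card =
      (S.n / S.m + 1) * S.numSat x :=
  S.card_filter_eqn fun e => ∑ i, S.A e i * x i = S.b e

end LinSystem

/-! ### The lattice instance and its success probabilities -/

section Instance

variable {p ε : ℝ} (g : Gadget p ε) (S : LinSystem)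

/-- The number of coefficients of the lattice, except for that of the modulus. -/
def numCoef : ℕ := S.n + S.M + S.M * g.N + 1

/-- The bit length of the modulus. -/
def modBits : ℕ := g.a * S.M

/-- Numbering of the coefficients. -/
def coefEquiv : CoefIndex (Fin S.n) (Fin S.M) g.N ≃ Fin (numCoef g S) :=
  (Equiv.sumCongr ((Equiv.sumCongr finSumFinEquiv finProdFinEquiv).trans finSumFinEquiv)
    (Equiv.refl _)).trans finSumFinEquiv

/-- Numbering of all rows and columns. -/
def idxEquiv : CoefIndex (Fin S.n) (Fin S.M) g.N ⊕ Fin 1 ≃ Fin (numCoef g S + 1) :=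
  (Equiv.sumCongr (coefEquiv g S) (Equiv.refl _)).trans finSumFinEquiv

/-- The basis matrix. -/
def basisMatrix (cv : Fin (numCoef g S) → ℕ) :
    Matrix (Fin (numCoef g S + 1)) (Fin (numCoef g S + 1)) ℚ :=
  fun i j => (basisEntry g S.repA S.repB (2 ^ modBits g S) (fun c => cv (coefEquiv g S c))
    ((idxEquiv g S).symm i) ((idxEquiv g S).symm j) : ℤ)

/-- The instance of the shortest vector problem for given coefficients of the linear form. -/
def svpInput (cv : Fin (numCoef g S) → ℕ) : SVPInput where
  dim := numCoef g S + 1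
  rank := numCoef g S + 1
  B := basisMatrix g S cv
  rPow := (g.ρ * S.M : ℕ)
  rank_pos := Nat.succ_pos _
  indep := by
    rw [Fintype.linearIndependent_iff]
    intro v hv
    have h := eq_zero_of_sum_basisEntry_eq_zero g S.repA S.repB (2 ^ modBits g S)
      (fun c => cv (coefEquiv g S c)) (fun c => v (idxEquiv g S c)) (by positivity) (fun r => by
        have h1 := congrFun hv (idxEquiv g S r)
        rw [Finset.sum_apply, ← (idxEquiv g S).sum_comp] at h1
        rw [Pi.zero_apply] at h1
        rw [← h1]
        refine Finset.sum_congr rfl fun c _ => ?_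
        simp [Matrix.col, basisMatrix, mul_comm])
    intro i
    have := congrFun h ((idxEquiv g S).symm i)
    simpa using this
  rPow_pos := by
    have h1 := g.ρ_pos
    have h2 := S.M_pos
    exact_mod_cast Nat.mul_pos h1 h2

theorem mem_latticeOf_basisMatrix {cv : Fin (numCoef g S) → ℕ} {v : Fin (numCoef g S + 1) → ℝ} :
    v ∈ latticeOf (basisMatrix g S cv) ↔ ∃ s x w z u, ∀ r, v (idxEquiv g S r) =
      ∑ c, (basisEntry g S.repA S.repB (2 ^ modBits g S) (fun c => (cv (coefEquiv g S c) : ℤ)) r c : ℝ) *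
        (Sum.elim (coef s x w z) (fun _ => u) c : ℤ) := by
  rw [latticeOf, Submodule.mem_span_range_iff_exists_fun]
  have key : ∀ k : Fin (numCoef g S + 1) → ℤ, ∀ r,
      (∑ j, k j • fun i => (basisMatrix g S cv i j : ℝ)) (idxEquiv g S r) =
        ∑ c, (basisEntry g S.repA S.repB (2 ^ modBits g S) (fun c => (cv (coefEquiv g S c) : ℤ)) r c : ℝ) *
          (k (idxEquiv g S c) : ℤ) := by
    intro k r
    rw [Finset.sum_apply, ← (idxEquiv g S).sum_comp]
    refine Finset.sum_congr rfl fun c _ => ?_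
    simp [basisMatrix, mul_comm]
  constructor
  · rintro ⟨k, rfl⟩
    obtain ⟨s, x, w, z, hk⟩ := coef_surjective fun c => k (idxEquiv g S (Sum.inl c))
    refine ⟨s, x, w, z, k (idxEquiv g S (Sum.inr 0)), fun r => ?_⟩
    rw [key]
    refine Finset.sum_congr rfl fun c _ => ?_
    rcases c with c | c
    · have := congrFun hk c
      rw [this, Sum.elim_inl]
    · rw [Subsingleton.elim c 0, Sum.elim_inr]
  · rintro ⟨s, x, w, z, u, h⟩
    refine ⟨fun j => Sum.elim (coef s x w z) (fun _ => u) ((idxEquiv g S).symm j), ?_⟩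
    funext i
    obtain ⟨r, rfl⟩ := (idxEquiv g S).surjective i
    rw [key, h]
    simp

/-- The residue vector that the coefficients of the linear form represent. -/
def residues (cv : Fin (numCoef g S) → ℕ) :
    CoefIndex (Fin S.n) (Fin S.M) g.N → ZMod (2 ^ modBits g S) := fun c => (cv (coefEquiv g S c) : ℕ)

theorem modForm_residues (cv : Fin (numCoef g S) → ℕ)
    (v : CoefIndex (Fin S.n) (Fin S.M) g.N → ℤ) :
    modForm (2 ^ modBits g S) v (residues g S cv) =
      ((∑ c, (cv (coefEquiv g S c) : ℤ) * v c : ℤ) : ZMod (2 ^ modBits g S)) := by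
  rw [modForm_apply]
  push_cast
  rfl

theorem sum_rpow_latticeOf {cv : Fin (numCoef g S) → ℕ} {v : Fin (numCoef g S + 1) → ℝ}
    {s : ℤ} {x w z} {u : ℤ} (h : ∀ r, v (idxEquiv g S r) =
      ∑ c, (basisEntry g S.repA S.repB (2 ^ modBits g S) (fun c => (cv (coefEquiv g S c) : ℤ)) r c : ℝ) *
        (Sum.elim (coef s x w z) (fun _ => u) c : ℤ)) :
    ∑ i, |v i| ^ p = costPow g S.repA S.repB s x w z +
      |((2 ^ modBits g S * (∑ c, (cv (coefEquiv g S c) : ℤ) * coef s x w z c + 2 ^ modBits g S * u) : ℤ) : ℝ)| ^ p := by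
  rw [← sum_rpow_basisEntry, ← (idxEquiv g S).sum_comp]
  simp only [h]

/-- A short vector on which the linear form vanishes makes the instance a YES instance. -/
theorem svpInput_mem_yes (hp : 1 ≤ p) {γ : ℝ} {cv : Fin (numCoef g S) → ℕ}
    (h : ∃ x w z, costPow g S.repA S.repB 1 x w z ≤ g.ρ * S.M ∧
      modForm (2 ^ modBits g S) (coef 1 x w z) (residues g S cv) = 0) :
    svpInput g S cv ∈ (svp p γ).yes := by
  obtain ⟨x, w, z, hcost, hmod⟩ := h
  rw [modForm_residues, ZMod.intCast_zmod_eq_zero_iff_dvd] at hmod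
  -- Taking -u as the coefficient of the modulus annihilates the last coordinate.
  obtain ⟨u, hu⟩ := hmod
  push_cast at hu
  set v : Fin (numCoef g S + 1) → ℝ := fun i =>
    ∑ c, (basisEntry g S.repA S.repB (2 ^ modBits g S) (fun c => (cv (coefEquiv g S c) : ℤ))
      ((idxEquiv g S).symm i) c : ℝ) * (Sum.elim (coef 1 x w z) (fun _ => -u) c : ℤ) with hv
  have hvr : ∀ r, v (idxEquiv g S r) =
      ∑ c, (basisEntry g S.repA S.repB (2 ^ modBits g S) (fun c => (cv (coefEquiv g S c) : ℤ)) r c : ℝ) *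
        (Sum.elim (coef 1 x w z) (fun _ => -u) c : ℤ) := fun r => by
    rw [hv]
    simp only [Equiv.symm_apply_apply]
  have hnorm := sum_rpow_latticeOf g S hvr
  rw [hu, mul_neg, add_neg_cancel, mul_zero, Int.cast_zero, abs_zero,
    Real.zero_rpow (by linarith), add_zero] at hnorm
  have hmem : v ∈ latticeOf (svpInput g S cv).B :=
    (mem_latticeOf_basisMatrix g S).2 ⟨1, x, w, z, -u, hvr⟩
  have hne : v ≠ 0 := by
    intro h0
    have h1 := hvr (.inl (.inr 0))
    rw [h0, sum_basisEntry_s] at h1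
    have hD := g.D_pos'
    simp [coef] at h1
    linarith
  have hle : lambdaOne p (latticeOf (svpInput g S cv).B) ≤ ‖WithLp.toLp (ENNReal.ofReal p) v‖ := by
    refine csInf_le ⟨0, ?_⟩ ⟨v, hmem, hne, rfl⟩
    rintro a ⟨v, -, -, rfl⟩
    have : Fact (1 ≤ ENNReal.ofReal p) := ⟨by simpa using hp⟩
    exact norm_nonneg (WithLp.toLp (ENNReal.ofReal p) v)
  refine hle.trans ?_
  · rw [SVPInput.radius]
    have hr : ((svpInput g S cv).rPow : ℝ) = g.ρ * S.M := by
      change (((g.ρ * S.M : ℕ) : ℚ) : ℝ) = _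
      push_cast
      rfl
    rw [hr, norm_toLp_le_iff hp _ (by positivity), hnorm]
    exact hcost

/-- If the linear form vanishes on no short nonzero vector, then the instance is a NO instance. -/
theorem svpInput_mem_no (hp : 1 ≤ p) {γ : ℝ} (hγ : γ < g.γ) {cv : Fin (numCoef g S) → ℕ}
    (h : ¬ ∃ s x w z, coef s x w z ≠ 0 ∧ costPow g S.repA S.repB s x w z ≤ g.G * S.M ∧
      modForm (2 ^ modBits g S) (coef s x w z) (residues g S cv) = 0) :
    svpInput g S cv ∈ (svp p γ).no := by
  have hr : ((svpInput g S cv).rPow : ℝ) = g.ρ * S.M := by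
    change (((g.ρ * S.M : ℕ) : ℚ) : ℝ) = _
    push_cast
    rfl
  have hρM : (0 : ℝ) < g.ρ * S.M := by
    have h1 := g.ρ_pos
    have h2 := S.M_pos
    positivity
  have hγ1 := g.one_lt_γ
  have hp0 : 0 < p := by linarith
  change γ * SVPInput.radius _ p < lambdaOne p _
  have hrad : 0 < (svpInput g S cv).radius p := by
    rw [SVPInput.radius, hr]; positivity
  -- Strictness comes from γ < g.γ; lattice vectors are only bounded below by g.γ times the radius.
  refine (mul_lt_mul_of_pos_right hγ hrad).trans_le ?_
  have hlong : ∀ v ∈ latticeOf (svpInput g S cv).B, v ≠ 0 →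
      g.γ * (svpInput g S cv).radius p ≤ ‖WithLp.toLp (ENNReal.ofReal p) v‖ := by
    intro v hv hne
    obtain ⟨s, x, w, z, u, hvr⟩ := (mem_latticeOf_basisMatrix g S).1 hv
    have hnorm := sum_rpow_latticeOf g S hvr
    have hγr : g.γ * (svpInput g S cv).radius p = (g.γ ^ p * (g.ρ * S.M)) ^ (1 / p) := by
      rw [SVPInput.radius, hr, Real.mul_rpow (by positivity) hρM.le, ← Real.rpow_mul (by linarith),
        mul_one_div_cancel hp0.ne', Real.rpow_one]
    rw [hγr]
    by_contra! hlt
    have h1 : ∑ i : Fin (numCoef g S + 1), |v i| ^ p ≤ _ :=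
      (norm_toLp_le_iff hp v (by positivity)).1 hlt.le
    have hle : g.γ ^ p * (g.ρ * S.M) ≤ g.G * S.M := by
      rw [← mul_assoc]
      exact mul_le_mul_of_nonneg_right g.γ_rpow_mul_le (Nat.cast_nonneg _)
    replace h1 := h1.trans hle
    rw [hnorm] at h1
    have hcost0 : 0 ≤ costPow g S.repA S.repB s x w z := by
      unfold costPow; positivity
    set t : ℤ := ∑ c, (cv (coefEquiv g S c) : ℤ) * coef s x w z c + 2 ^ modBits g S * u with ht
    -- Otherwise the last coordinate alone, of absolute value at least q, would exceed the bound G ·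
    -- M.
    have ht0 : t = 0 := by
      by_contra ht0
      have hlt' := mul_card_lt_two_pow_rpow g hp (Nat.succ_le_of_lt S.M_pos) (rfl : modBits g S = _)
      have : ((2 : ℝ) ^ modBits g S) ^ p ≤ |((2 ^ modBits g S * t : ℤ) : ℝ)| ^ p := by
        refine Real.rpow_le_rpow (by positivity) ?_ hp0.le
        rw [Int.cast_mul, abs_mul]
        push_cast
        rw [abs_of_pos (by positivity : (0 : ℝ) < 2 ^ modBits g S)]
        refine le_mul_of_one_le_right (by positivity) ?_
        exact_mod_cast Int.one_le_abs ht0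
      linarith
    rw [ht0, mul_zero, Int.cast_zero, abs_zero, Real.zero_rpow hp0.ne', add_zero] at h1
    refine h ⟨s, x, w, z, ?_, h1, ?_⟩
    · intro h0
      refine hne ?_
      rw [h0] at ht
      have hu : u = 0 := by
        simp only [Pi.zero_apply, mul_zero, Finset.sum_const_zero, zero_add] at ht
        rw [ht] at ht0
        exact (mul_eq_zero.1 ht0).resolve_left (by positivity)
      funext i
      obtain ⟨r, rfl⟩ := (idxEquiv g S).surjective i
      rw [hvr, h0, hu]
      refine Finset.sum_eq_zero fun c _ => ?_
      rcases c with c | c <;> simp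
    · rw [modForm_residues, ZMod.intCast_zmod_eq_zero_iff_dvd]
      push_cast
      exact ⟨-u, by linarith⟩
  refine le_csInf ?_ ?_
  -- The infimum of an empty set would be 0, so a nonzero lattice vector is exhibited: the column of
  -- the modulus.
  · set e : CoefIndex (Fin S.n) (Fin S.M) g.N ⊕ Fin 1 → ℤ := Sum.elim (coef 0 0 0 0) fun _ => 1 with he
    set v : Fin (numCoef g S + 1) → ℝ := fun i =>
      ∑ c, (basisEntry g S.repA S.repB (2 ^ modBits g S) (fun c => (cv (coefEquiv g S c) : ℤ))
        ((idxEquiv g S).symm i) c : ℝ) * (e c : ℤ) with hv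
    refine ⟨_, v, (mem_latticeOf_basisMatrix g S).2 ⟨0, 0, 0, 0, 1, fun r => by
      rw [hv]; simp only [Equiv.symm_apply_apply]; rfl⟩, ?_, rfl⟩
    intro h0
    have h1 : v (idxEquiv g S (.inr 0)) = 0 := by rw [h0]; rfl
    rw [hv] at h1
    simp only [Equiv.symm_apply_apply] at h1
    rw [sum_basisEntry_last] at h1
    have hz : (coef 0 0 0 0 : CoefIndex (Fin S.n) (Fin S.M) g.N → ℤ) = 0 := by
      funext i; rcases i with ((i | i) | i) | i <;> rfl
    simp [he, hz] at h1
  · rintro a ⟨v, hv, hne, rfl⟩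
    exact hlong v hv hne

theorem coinProb_mono {k : ℕ} {E F : Set (Fin k → Bool)} (h : E ⊆ F) : coinProb E ≤ coinProb F := by
  unfold coinProb
  have := Set.ncard_le_ncard h (Set.toFinite _)
  gcongr

/-- The coefficients of the linear form that the coins determine. -/
def coinCoef {K : ℕ} (ρ : Fin K → Bool) (i : Fin (numCoef g S)) : ℕ :=
  binVal (fun t => coinBit ρ (i * modBits g S + t)) (modBits g S)

theorem coinProb_residues {K : ℕ} (hK : numCoef g S * modBits g S ≤ K)
    (E : Set (CoefIndex (Fin S.n) (Fin S.M) g.N → ZMod (2 ^ modBits g S))) :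
    coinProb {ρ : Fin K → Bool | residues g S (coinCoef g S ρ) ∈ E} =
      (E.ncard : ℝ) / ((2 : ℝ) ^ modBits g S) ^ Fintype.card (CoefIndex (Fin S.n) (Fin S.M) g.N) := by
  set e := (coefEquiv g S).arrowCongr (Equiv.refl (ZMod (2 ^ modBits g S))) with he
  have h := coinProb_coinResidue hK (e.symm ⁻¹' E)
  rw [Set.ncard_preimage_of_injective_subset_range e.symm.injective (by simp)] at h
  have hcard : Fintype.card (CoefIndex (Fin S.n) (Fin S.M) g.N) = numCoef g S := by
    rw [Fintype.card_congr (coefEquiv g S), Fintype.card_fin]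
  rw [hcard, ← h]
  rfl

theorem two_thirds_le_coinProb_yes (hp : 1 ≤ p) {γ : ℝ} {K : ℕ}
    (hK : numCoef g S * modBits g S ≤ K) (hyes : ∃ x, 5 / 8 * (S.m : ℝ) ≤ S.numSat x) :
    2 / 3 ≤ coinProb {ρ : Fin K → Bool | svpInput g S (coinCoef g S ρ) ∈ (svp p γ).yes} := by
  obtain ⟨x₀, hx₀⟩ := hyes
  have h := two_thirds_le_ncard g hp S.repA S.repB (by simpa using S.n_le_M)
    (by rw [Fintype.card_fin]; exact S.M_pos) x₀ (by
      rw [S.card_rep, Fintype.card_fin, LinSystem.M]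
      push_cast
      have : (0 : ℝ) ≤ (S.n / S.m : ℕ) + 1 := by positivity
      nlinarith) (modBits g S) (by rw [Fintype.card_fin]; rfl)
  rw [Fintype.card_fin] at h
  refine le_trans ?_ (coinProb_mono (E := {ρ | residues g S (coinCoef g S ρ) ∈
    {c | ∃ x w z, costPow g S.repA S.repB 1 x w z ≤ g.ρ * S.M ∧
      modForm (2 ^ modBits g S) (coef 1 x w z) c = 0}}) fun ρ hρ => svpInput_mem_yes (γ := γ) g S hp hρ)
  rw [coinProb_residues g S hK {c | ∃ x w z, costPow g S.repA S.repB 1 x w z ≤ g.ρ * S.M ∧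
    modForm (2 ^ modBits g S) (coef 1 x w z) c = 0}, le_div_iff₀ (by positivity)]
  exact h

theorem two_thirds_le_coinProb_no (hp : 1 ≤ p) {γ : ℝ} (hγ : γ < g.γ) {K : ℕ}
    (hK : numCoef g S * modBits g S ≤ K)
    (hno : ∀ x, (S.numSat x : ℝ) ≤ (5 / 8 - ε) * S.m) :
    2 / 3 ≤ coinProb {ρ : Fin K → Bool | svpInput g S (coinCoef g S ρ) ∈ (svp p γ).no} := by
  have h := three_mul_ncard_le g hp S.repA S.repB (by simpa using S.n_le_M)
    (by rw [Fintype.card_fin]; exact S.M_pos) (fun x => by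
      rw [S.card_rep, Fintype.card_fin, LinSystem.M]
      push_cast
      have h1 : (0 : ℝ) ≤ (S.n / S.m : ℕ) + 1 := by positivity
      have h2 := mul_le_mul_of_nonneg_left (hno x) h1
      linarith) (modBits g S) (by rw [Fintype.card_fin]; rfl)
  rw [Fintype.card_fin] at h
  set E := {c : CoefIndex (Fin S.n) (Fin S.M) g.N → ZMod (2 ^ modBits g S) | ∃ s x w z,
    coef s x w z ≠ 0 ∧ costPow g S.repA S.repB s x w z ≤ g.G * S.M ∧
      modForm (2 ^ modBits g S) (coef s x w z) c = 0} with hE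
  refine le_trans ?_ (coinProb_mono (E := {ρ | residues g S (coinCoef g S ρ) ∈ Eᶜ}) fun ρ hρ =>
    svpInput_mem_no g S hp hγ hρ)
  rw [coinProb_residues g S hK Eᶜ, le_div_iff₀ (by positivity)]
  have hc := Set.ncard_add_ncard_compl E
  rw [Nat.card_eq_fintype_card, Fintype.card_fun, ZMod.card] at hc
  have hcR : (E.ncard : ℝ) + (Eᶜ.ncard : ℝ) =
      ((2 : ℝ) ^ modBits g S) ^ Fintype.card (CoefIndex (Fin S.n) (Fin S.M) g.N) := by
    exact_mod_cast hc
  linarith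

end Instance
/-! ### Reasoning about programs -/

namespace Prog

/-- Sequential composition of a list of programs. -/
def block : List Prog → Prog
  | [] => skip
  | P :: l => seq P (block l)

/-- The final state of a program without loops. -/
def exec : Prog → RAMState → RAMState
  | skip, s => s
  | const i c, s => s.setReg i c
  | add i j k, s => s.setReg i (s.reg j + s.reg k)
  | sub i j k, s => s.setReg i (s.reg j - s.reg k)
  | load i a j, s => s.setReg i (s.mem a (s.reg j))
  | store a i j, s => s.setMem a (s.reg i) (s.reg j)
  | emit i, s => s.write (s.reg i)
  | seq P Q, s => Q.exec (P.exec s)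
  | ite i P Q, s => if 0 < s.reg i then P.exec s else Q.exec s
  -- A default value; `exec` is meaningful only for programs without loops.
  | loop _ _, s => s

/-- A bound for the running time of a program without loops. -/
def cost : Prog → ℕ
  | seq P Q => P.cost + Q.cost
  | ite _ P Q => P.cost + Q.cost + 1
  | _ => 1

/-- The program has no loops. -/
def Straight : Prog → Bool
  | seq P Q => P.Straight && Q.Straight
  | ite _ P Q => P.Straight && Q.Straight
  | loop _ _ => false
  | _ => true

/-- The program changes neither the memory nor the registers below `b`. -/
def Keeps (b : ℕ) : Prog → Bool
  | skip => true
  | const i _ => decide (b ≤ i)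
  | add i _ _ => decide (b ≤ i)
  | sub i _ _ => decide (b ≤ i)
  | load i _ _ => decide (b ≤ i)
  | store _ _ _ => false
  | emit _ => true
  | seq P Q => P.Keeps b && Q.Keeps b
  | ite _ P Q => P.Keeps b && Q.Keeps b
  | loop _ P => P.Keeps b

end Prog

namespace RAMState

theorem reg_setReg (s : RAMState) (i j : ℕ) (v : ℤ) :
    (s.setReg i v).reg j = if j = i then v else s.reg j := by
  simp [setReg, Function.update_apply]

@[simp] theorem mem_setReg (s : RAMState) (i : ℕ) (v : ℤ) : (s.setReg i v).mem = s.mem := rfl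

@[simp] theorem out_setReg (s : RAMState) (i : ℕ) (v : ℤ) : (s.setReg i v).out = s.out := rfl

@[simp] theorem reg_write (s : RAMState) (v : ℤ) : (s.write v).reg = s.reg := rfl

@[simp] theorem mem_write (s : RAMState) (v : ℤ) : (s.write v).mem = s.mem := rfl

@[simp] theorem out_write (s : RAMState) (v : ℤ) : (s.write v).out = s.out ++ [v] := rfl

end RAMState

open Prog

theorem Prog.exists_runs_exec (P : Prog) (hP : P.Straight = true) (s : RAMState) :
    ∃ t ≤ P.cost, Runs P s t (P.exec s) := by
  induction P generalizing s with
  | skip => exact ⟨1, le_rfl, .skip s⟩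
  | const i c => exact ⟨1, le_rfl, .const s i c⟩
  | add i j k => exact ⟨1, le_rfl, .add s i j k⟩
  | sub i j k => exact ⟨1, le_rfl, .sub s i j k⟩
  | load i a j => exact ⟨1, le_rfl, .load s i a j⟩
  | store a i j => exact ⟨1, le_rfl, .store s a i j⟩
  | emit i => exact ⟨1, le_rfl, .emit s i⟩
  | seq P Q hp hq =>
    simp only [Straight, Bool.and_eq_true] at hP
    obtain ⟨t, ht, h⟩ := hp hP.1 s
    obtain ⟨t', ht', h'⟩ := hq hP.2 (P.exec s)
    exact ⟨t + t', Nat.add_le_add ht ht', .seq h h'⟩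
  | ite i P Q hp hq =>
    simp only [Straight, Bool.and_eq_true] at hP
    by_cases hi : 0 < s.reg i
    · obtain ⟨t, ht, h⟩ := hp hP.1 s
      refine ⟨t + 1, by simp only [cost]; omega, ?_⟩
      rw [exec, if_pos hi]
      exact .ite_pos hi h
    · obtain ⟨t, ht, h⟩ := hq hP.2 s
      refine ⟨t + 1, by simp only [cost]; omega, ?_⟩
      rw [exec, if_neg hi]
      exact .ite_neg hi h
  | loop i P _ => simp [Straight] at hP

/-- Registers are layered: global values below 20, then the state of the row, then that of the
entry. This syntactic check supplies the frame conditions between layers. -/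
theorem Runs.keeps {b : ℕ} {P : Prog} {s s' : RAMState} {t : ℕ} (h : Runs P s t s')
    (hP : P.Keeps b = true) : s'.mem = s.mem ∧ ∀ i < b, s'.reg i = s.reg i := by
  have hset : ∀ (s : RAMState) (i : ℕ) (v : ℤ), b ≤ i →
      ∀ j < b, (s.setReg i v).reg j = s.reg j := fun s i v hi j hj => by
    rw [RAMState.reg_setReg, if_neg (by omega)]
  induction h with
  | skip s => exact ⟨rfl, fun _ _ => rfl⟩
  | const s i c => exact ⟨rfl, hset _ _ _ (of_decide_eq_true hP)⟩
  | add s i j k => exact ⟨rfl, hset _ _ _ (of_decide_eq_true hP)⟩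
  | sub s i j k => exact ⟨rfl, hset _ _ _ (of_decide_eq_true hP)⟩
  | load s i a j => exact ⟨rfl, hset _ _ _ (of_decide_eq_true hP)⟩
  | store s a i j => simp [Keeps] at hP
  | emit s i => exact ⟨rfl, fun _ _ => rfl⟩
  | seq _ _ ih ih' =>
    simp only [Keeps, Bool.and_eq_true] at hP
    have h1 := ih hP.1
    have h2 := ih' hP.2
    exact ⟨h2.1.trans h1.1, fun i hi => (h2.2 i hi).trans (h1.2 i hi)⟩
  | ite_pos _ _ ih =>
    simp only [Keeps, Bool.and_eq_true] at hP
    exact ih hP.1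
  | ite_neg _ _ ih =>
    simp only [Keeps, Bool.and_eq_true] at hP
    exact ih hP.2
  | loop_done _ => exact ⟨rfl, fun _ _ => rfl⟩
  | loop_step _ _ _ ih ih' =>
    have h1 := ih hP
    have h2 := ih' hP
    exact ⟨h2.1.trans h1.1, fun i hi => (h2.2 i hi).trans (h1.2 i hi)⟩

/-- Started in `s`, the program `P` halts within `T` steps in a state that satisfies `Q`. -/
def Halts (P : Prog) (s : RAMState) (T : ℕ) (Q : RAMState → Prop) : Prop :=
  ∃ t s', Runs P s t s' ∧ t ≤ T ∧ Q s'

namespace Halts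

variable {P P' : Prog} {s : RAMState} {T T' : ℕ} {Q Q' : RAMState → Prop}

theorem of_exec (hP : P.Straight = true) (h : Q (P.exec s)) : Halts P s P.cost Q := by
  obtain ⟨t, ht, hr⟩ := P.exists_runs_exec hP s
  exact ⟨t, _, hr, ht, h⟩

theorem mono (h : Halts P s T Q) (hT : T ≤ T') (hQ : ∀ s', Q s' → Q' s') : Halts P s T' Q' := by
  obtain ⟨t, s', hr, ht, hq⟩ := h
  exact ⟨t, s', hr, ht.trans hT, hQ s' hq⟩

theorem keeps (h : Halts P s T Q) (b : ℕ) (hP : P.Keeps b = true) :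
    Halts P s T fun s' => Q s' ∧ s'.mem = s.mem ∧ ∀ i < b, s'.reg i = s.reg i := by
  obtain ⟨t, s', hr, ht, hq⟩ := h
  exact ⟨t, s', hr, ht, hq, hr.keeps hP⟩

theorem seq (h : Halts P s T Q) (h' : ∀ s', Q s' → Halts P' s' T' Q') :
    Halts (.seq P P') s (T + T') Q' := by
  obtain ⟨t, s', hr, ht, hq⟩ := h
  obtain ⟨t', s'', hr', ht', hq'⟩ := h' s' hq
  exact ⟨t + t', s'', .seq hr hr', Nat.add_le_add ht ht', hq'⟩

/-- Indexing the invariant by the number of completed passes gives correctness, termination and the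
time bound together; each pass costs one extra step for its test. -/
theorem loop {i : ℕ} {K : ℕ} (I : ℕ → RAMState → Prop)
    (hpos : ∀ k < K, ∀ s, I k s → 0 < s.reg i) (hend : ∀ s, I K s → ¬ 0 < s.reg i)
    (hstep : ∀ k < K, ∀ s, I k s → Halts P s T (I (k + 1))) (h0 : I 0 s) :
    Halts (.loop i P) s (K * (T + 1) + 1) (I K) := by
  have key : ∀ j k, k + j = K → ∀ s, I k s → Halts (.loop i P) s (j * (T + 1) + 1) (I K) := by
    intro j
    induction j with
    | zero =>
      intro k hk s hs
      rw [add_zero] at hk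
      subst hk
      exact ⟨1, s, .loop_done (hend s hs), by omega, hs⟩
    | succ j ih =>
      intro k hk s hs
      obtain ⟨t, s', hr, ht, hs'⟩ := hstep k (by omega) s hs
      obtain ⟨t', s'', hr', ht', hs''⟩ := ih (k + 1) (by omega) s' hs'
      refine ⟨t + t' + 1, s'', .loop_step (hpos k (by omega) s hs) hr hr', ?_, hs''⟩
      rw [add_mul]
      omega
  exact key K 0 (zero_add K) s h0

end Halts

/-! ### Multiplication and powers -/

namespace Prog

/-- Multiply register `x` by register `h`, which becomes `0`. -/
def mul (d x h : ℕ) : Prog := block [const d 0, loop h (block [add d d x, sub h h 2])]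

/-- Double register `d` as often as register `h` says, which becomes `0`. -/
def shift (d h : ℕ) : Prog := loop h (block [add d d d, sub h h 2])

end Prog

/-- Repeated addition takes time linear in the value of register h, so the numbers placed there must
be polynomially bounded. Register 2 holds the constant 1. -/
theorem halts_mul {d x h : ℕ} (hdx : d ≠ x) (hdh : d ≠ h) (hxh : x ≠ h) (hd : d ≠ 2) (hh : h ≠ 2)
    {s : RAMState} (h2 : s.reg 2 = 1) {K : ℕ} (hK : s.reg h = K) :
    Halts (mul d x h) s (K * 4 + 3) fun s' => s'.mem = s.mem ∧ s'.out = s.out ∧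
      s'.reg d = K * s.reg x ∧ ∀ i, i ≠ d → i ≠ h → s'.reg i = s.reg i := by
  have hloop := Halts.loop (P := block [add d d x, sub h h 2]) (i := h) (K := K) (T := 3)
    (s := s.setReg d 0)
    (fun k s' => s'.reg h = K - k ∧ s'.mem = s.mem ∧ s'.out = s.out ∧ s'.reg d = k * s.reg x ∧
      ∀ i, i ≠ d → i ≠ h → s'.reg i = s.reg i)
    (fun k hk s' hs' => by rw [hs'.1]; omega) (fun s' hs' => by rw [hs'.1]; simp)
    (fun k hk s' ⟨e1, e2, e3, e4, e5⟩ => Halts.of_exec (by rfl) (by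
      simp only [block, exec, RAMState.reg_setReg, RAMState.mem_setReg, RAMState.out_setReg]
      refine ⟨?_, e2, e3, ?_, ?_⟩
      · simp only [if_true, hd.symm, hdh.symm, if_false, e1, e5 2 hd.symm hh.symm, h2]
        push_cast
        ring
      · simp only [hdh, if_false, if_true, e4, e5 x hdx.symm hxh]
        push_cast
        ring
      · intro i hi hi'
        simp only [hi, hi', if_false]
        exact e5 i hi hi'))
    (by
      refine ⟨?_, rfl, rfl, ?_, ?_⟩
      · simp [RAMState.reg_setReg, hdh.symm, hK]
      · simp [RAMState.reg_setReg]
      · intro i hi _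
        simp [RAMState.reg_setReg, hi])
  refine Halts.mono (Halts.seq (Halts.of_exec (P := const d 0) (by rfl) (Q := (· = s.setReg d 0)) rfl)
    (T' := (K * 4 + 1) + 1) ?_) (by simp only [cost]; omega) (fun s' hs' => hs')
  rintro _ rfl
  refine Halts.seq hloop fun s' hs' => Halts.of_exec (P := skip) (by rfl) ?_
  exact hs'.2

theorem halts_shift {d h : ℕ} (hdh : d ≠ h) (hd : d ≠ 2) (hh : h ≠ 2)
    {s : RAMState} (h2 : s.reg 2 = 1) {K : ℕ} (hK : s.reg h = K) :
    Halts (shift d h) s (K * 4 + 1) fun s' => s'.mem = s.mem ∧ s'.out = s.out ∧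
      s'.reg d = s.reg d * 2 ^ K ∧ ∀ i, i ≠ d → i ≠ h → s'.reg i = s.reg i := by
  refine (Halts.loop (P := block [add d d d, sub h h 2]) (i := h) (K := K) (T := 3) (s := s)
    (fun k s' => s'.reg h = K - k ∧ s'.mem = s.mem ∧ s'.out = s.out ∧ s'.reg d = s.reg d * 2 ^ k ∧
      ∀ i, i ≠ d → i ≠ h → s'.reg i = s.reg i)
    (fun k hk s' hs' => by rw [hs'.1]; omega) (fun s' hs' => by rw [hs'.1]; simp)
    (fun k hk s' ⟨e1, e2, e3, e4, e5⟩ => Halts.of_exec (by rfl) (by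
      simp only [block, exec, RAMState.reg_setReg, RAMState.mem_setReg, RAMState.out_setReg]
      refine ⟨?_, e2, e3, ?_, ?_⟩
      · simp only [if_true, hd.symm, hdh.symm, if_false, e1, e5 2 hd.symm hh.symm, h2]
        push_cast
        ring
      · simp only [hdh, if_false, if_true, e4]
        ring
      · intro i hi hi'
        simp only [hi, hi', if_false]
        exact e5 i hi hi'))
    (by simp [hK])).mono le_rfl fun s' hs' => hs'.2
/-! ### The preparation phase of the program -/

namespace Prog

/-- Read the numbers of variables and equations, and compute the number of repeated equations. -/
def setupSize : Prog :=
  seq (block [const 2 1, const 19 0, load 3 0 19, load 4 0 2, add 5 4 19, sub 21 3 4, add 21 21 2])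
    (loop 21 (block [add 5 5 4, sub 21 21 4]))

/-- Compute all numbers that the program uses throughout. -/
def setup (a N ρ : ℕ) : Prog :=
  seq setupSize <| seq (add 21 4 19) <| seq (mul 12 3 21) <| seq (const 21 a) <| seq (mul 6 5 21) <|
  seq (const 21 N) <| seq (mul 8 5 21) <| seq (const 21 ρ) <| seq (mul 17 5 21) <|
  seq (block [const 10 1, add 21 6 19]) <| seq (shift 10 21) <|
  seq (block [add 18 10 19, add 21 6 19]) <| seq (shift 18 21) <|
  block [add 12 12 2, add 12 12 2, add 11 3 5, add 8 8 11, add 7 8 2, add 16 7 2]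

end Prog

/-- The numbers that the program uses throughout, and the registers that hold them. -/
structure Globals {p ε : ℝ} (g : Gadget p ε) (S : LinSystem) (μ : ℕ → ℤ → ℤ) (s : RAMState) :
    Prop where
  one : s.reg 2 = 1
  n : s.reg 3 = S.n
  m : s.reg 4 = S.m
  bits : s.reg 6 = modBits g S
  num : s.reg 7 = numCoef g S
  sCol : s.reg 8 = (S.n + S.M + S.M * g.N : ℕ)
  q : s.reg 10 = 2 ^ modBits g S
  zStart : s.reg 11 = (S.n + S.M : ℕ)
  bStart : s.reg 12 = (2 + S.m * S.n : ℕ)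
  rank : s.reg 16 = (numCoef g S + 1 : ℕ)
  rPow : s.reg 17 = (g.ρ * S.M : ℕ)
  qq : s.reg 18 = 2 ^ modBits g S * 2 ^ modBits g S
  zero : s.reg 19 = 0
  mem : s.mem = μ

theorem Globals.of_eq {p ε : ℝ} {g : Gadget p ε} {S : LinSystem} {μ : ℕ → ℤ → ℤ} {s s' : RAMState}
    (h : Globals g S μ s) (hm : s'.mem = s.mem) (hr : ∀ i < 20, s'.reg i = s.reg i) :
    Globals g S μ s' := by
  obtain ⟨h1, h2, h3, h4, h5, h6, h7, h8, h9, h10, h11, h12, h13, h14⟩ := h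
  constructor <;> first | rwa [hm] | (rw [hr _ (by norm_num)]; assumption)

theorem halts_setupSize (S : LinSystem) {μ : ℕ → ℤ → ℤ} {s : RAMState} (hs : s.mem = μ)
    (h0 : μ 0 0 = S.n) (h1 : μ 0 1 = S.m) :
    Halts setupSize s (S.n * 4 + 12) fun s' => s'.mem = μ ∧ s'.out = s.out ∧ s'.reg 2 = 1 ∧
      s'.reg 19 = 0 ∧ s'.reg 3 = S.n ∧ s'.reg 4 = S.m ∧ s'.reg 5 = S.M := by
  have hA := Halts.of_exec (P := block [const 2 1, const 19 0, load 3 0 19, load 4 0 2, add 5 4 19,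
    sub 21 3 4, add 21 21 2]) (s := s) (by rfl) (Q := fun s' => s'.mem = μ ∧ s'.out = s.out ∧
      s'.reg 2 = 1 ∧ s'.reg 19 = 0 ∧ s'.reg 3 = S.n ∧ s'.reg 4 = S.m ∧ s'.reg 5 = S.m ∧
      s'.reg 21 = S.n - S.m + 1) (by
    simp [block, exec, RAMState.reg_setReg, hs, h0, h1])
  refine Halts.mono (T := 8 + ((S.n / S.m + 0) * 4 + 1) + 3) (Halts.mono (Halts.seq hA
    (T' := (S.n / S.m + 0) * (3 + 1) + 1) (Q' := fun s' => s'.mem = μ ∧ s'.out = s.out ∧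
      s'.reg 2 = 1 ∧ s'.reg 19 = 0 ∧ s'.reg 3 = S.n ∧ s'.reg 4 = S.m ∧ s'.reg 5 = S.M) ?_)
    (by simp only [block, cost]; omega) fun s' h => h) ?_ fun s' h => h
  · rintro s₁ ⟨e1, e2, e3, e4, e5, e6, e7, e8⟩
    have hm := S.m_pos
    -- Register 21 holds n + 1 - (k + 1)m, positive exactly while (k + 1)m ≤ n, so there are ⌊n/m⌋
    -- passes and no division.
    refine (Halts.loop (i := 21) (K := S.n / S.m) (T := 3) (s := s₁)
      (P := block [add 5 5 4, sub 21 21 4])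
      (fun k s' => s'.mem = μ ∧ s'.out = s.out ∧ s'.reg 2 = 1 ∧ s'.reg 19 = 0 ∧ s'.reg 3 = S.n ∧
        s'.reg 4 = S.m ∧ s'.reg 5 = ((k + 1) * S.m : ℕ) ∧
        s'.reg 21 = S.n + 1 - ((k + 1) * S.m : ℕ)) ?_ ?_ ?_ ?_).mono (by omega) ?_
    · rintro k hk s' ⟨-, -, -, -, -, -, -, h⟩
      have : (k + 1) * S.m ≤ S.n := (Nat.le_div_iff_mul_le hm).1 (Nat.succ_le_of_lt hk)
      rw [h]
      omega
    · rintro s' ⟨-, -, -, -, -, -, -, h⟩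
      have : S.n < (S.n / S.m + 1) * S.m := by
        rw [mul_comm]
        exact Nat.lt_mul_div_succ S.n hm
      rw [h]
      omega
    · rintro k hk s' ⟨f1, f2, f3, f4, f5, f6, f7, f8⟩
      refine Halts.of_exec (by rfl) ?_
      simp [block, exec, RAMState.reg_setReg, f1, f2, f3, f4, f5, f6, f7, f8]
      constructor <;> ring
    · refine ⟨e1, e2, e3, e4, e5, e6, by simpa using e7, ?_⟩
      rw [e8]; push_cast; ring
    · rintro s' ⟨f1, f2, f3, f4, f5, f6, f7, f8⟩
      exact ⟨f1, f2, f3, f4, f5, f6, f7⟩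
  · have := Nat.div_le_self S.n S.m
    omega

theorem halts_setup {p ε : ℝ} (g : Gadget p ε) (S : LinSystem) {μ : ℕ → ℤ → ℤ} {s : RAMState}
    (hs : s.mem = μ) (h0 : μ 0 0 = S.n) (h1 : μ 0 1 = S.m) :
    Halts (setup g.a g.N g.ρ) s (4 * S.n + 4 * S.m + 4 * g.a + 4 * g.N + 4 * g.ρ +
      8 * modBits g S + 50) fun s' => Globals g S μ s' ∧ s'.out = s.out := by
  refine Halts.mono (T := (S.n * 4 + 12) + (1 + ((S.m * 4 + 3) + (1 + ((g.a * 4 + 3) + (1 +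
    ((g.N * 4 + 3) + (1 + ((g.ρ * 4 + 3) + (3 + ((modBits g S * 4 + 1) + (3 +
    ((modBits g S * 4 + 1) + 7)))))))))))))
    ?_ (by omega) fun s' h => h
  refine Halts.seq (halts_setupSize S hs h0 h1) ?_
  rintro s₁ ⟨hm, ho, r2, r19, r3, r4, r5⟩
  refine Halts.seq (Halts.of_exec (by rfl) rfl) ?_
  rintro s₂ rfl
  refine Halts.seq (halts_mul (by decide) (by decide) (by decide) (by decide) (by decide)
    (by simpa [exec, RAMState.reg_setReg] using r2) (K := S.m)
    (by simp [exec, RAMState.reg_setReg, r4, r19])) ?_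
  rintro s₃ ⟨hm3, ho3, hd3, hr3⟩
  refine Halts.seq (Halts.of_exec (by rfl) rfl) ?_
  rintro s₄ rfl
  simp only [exec, RAMState.mem_setReg, RAMState.out_setReg, RAMState.reg_setReg] at hm3 ho3 hd3 hr3
  refine Halts.seq (halts_mul (by decide) (by decide) (by decide) (by decide) (by decide)
    (by simpa [exec, RAMState.reg_setReg, hr3] using r2) (K := g.a)
    (by simp [exec, RAMState.reg_setReg])) ?_
  rintro s₅ ⟨hm5, ho5, hd5, hr5⟩
  refine Halts.seq (Halts.of_exec (by rfl) rfl) ?_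
  rintro s₆ rfl
  simp only [exec, RAMState.mem_setReg, RAMState.out_setReg, RAMState.reg_setReg] at hm5 ho5 hd5 hr5
  refine Halts.seq (halts_mul (by decide) (by decide) (by decide) (by decide) (by decide)
    (by simpa [exec, RAMState.reg_setReg, hr3, hr5] using r2) (K := g.N)
    (by simp [exec, RAMState.reg_setReg])) ?_
  rintro s₇ ⟨hm7, ho7, hd7, hr7⟩
  refine Halts.seq (Halts.of_exec (by rfl) rfl) ?_
  rintro s₈ rfl
  simp only [exec, RAMState.mem_setReg, RAMState.out_setReg, RAMState.reg_setReg] at hm7 ho7 hd7 hr7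
  refine Halts.seq (halts_mul (by decide) (by decide) (by decide) (by decide) (by decide)
    (by simpa [exec, RAMState.reg_setReg, hr3, hr5, hr7] using r2) (K := g.ρ)
    (by simp [exec, RAMState.reg_setReg])) ?_
  rintro s₉ ⟨hm9, ho9, hd9, hr9⟩
  simp only [exec, RAMState.mem_setReg, RAMState.out_setReg, RAMState.reg_setReg] at hm9 ho9 hd9 hr9
  have hbits : s₉.reg 6 = modBits g S := by
    simp [hr3, hr7, hr9, hd5, r5, modBits]
  refine Halts.seq (Halts.of_exec (by rfl) rfl) ?_
  rintro s₁₀ rfl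
  refine Halts.seq (halts_shift (by decide) (by decide) (by decide)
    (by simpa [block, exec, RAMState.reg_setReg, hr3, hr5, hr7, hr9] using r2) (K := modBits g S)
    (by simp [block, exec, RAMState.reg_setReg, hbits, hr3, hr5, hr7, hr9, r19])) ?_
  rintro s₁₁ ⟨hm11, ho11, hd11, hr11⟩
  simp only [block, exec, RAMState.mem_setReg, RAMState.out_setReg, RAMState.reg_setReg]
    at hm11 ho11 hd11 hr11
  refine Halts.seq (Halts.of_exec (by rfl) rfl) ?_
  rintro s₁₂ rfl
  refine Halts.seq (halts_shift (by decide) (by decide) (by decide)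
    (by simpa [block, exec, RAMState.reg_setReg, hr3, hr5, hr7, hr9, hr11] using r2)
    (K := modBits g S)
    (by simp [block, exec, RAMState.reg_setReg, hbits, hr3, hr5, hr7, hr9, hr11, r19])) ?_
  rintro s₁₃ ⟨hm13, ho13, hd13, hr13⟩
  simp only [block, exec, RAMState.mem_setReg, RAMState.out_setReg, RAMState.reg_setReg]
    at hm13 ho13 hd13 hr13
  refine Halts.of_exec (by rfl) ⟨?_, ?_⟩
  · constructor <;>
      simp [block, exec, RAMState.reg_setReg, hr3, hr5, hr7, hr9, hr11, hr13, r2, r3, r4, r5, r19,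
        hd3, hd5, hd7, hd9, hd11, hd13, hm3, hm5, hm7, hm9, hm11, hm13, hm, modBits, numCoef] <;> ring
  · simp [block, exec, ho3, ho5, ho7, ho9, ho11, ho13, ho]
/-! ### The output phase of the program -/

section Output

variable {p ε : ℝ} (g : Gadget p ε) (S : LinSystem) (μ : ℕ → ℤ → ℤ)

/-- The diagonal entry of a row of the basis matrix. -/
def rowDiag (r : ℕ) : ℤ :=
  if r < S.n then g.D else if r < S.n + S.M then 2 * (g.D * g.β) else g.D

/-- The entry of a row of the basis matrix in the column of the scaling coefficient. -/
def rowConst (r : ℕ) : ℤ :=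
  if r < S.n then 0
  else if r < S.n + S.M then
    if 0 < μ 0 ((2 + S.m * S.n + (r - S.n) % S.m : ℕ) : ℤ) then g.D * g.β else 0
  else if r < S.n + S.M + S.M * g.N then g.J else 0

/-- Whether a row of the basis matrix belongs to an equation. -/
def rowFlag (r : ℕ) : ℤ := if r < S.n then 0 else if r < S.n + S.M then 1 else 0

/-- The entries of all rows but the last of the basis matrix, in terms of the memory. -/
def entryVal (r c : ℕ) : ℤ :=
  (if c = r then rowDiag g S r else 0) +
  (if c = S.n + S.M + S.M * g.N then rowConst g S μ r else 0) +
  (if 0 < rowFlag S r ∧ c < S.n ∧ 0 < μ 0 ((2 + (r - S.n) % S.m * S.n + c : ℕ) : ℤ) then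
    (g.D * g.β : ℤ) else 0)

/-- The coefficients of the linear form, in terms of the memory. -/
def coefVal (c : ℕ) : ℕ :=
  binVal (fun t => if 0 < μ 1 ((c * modBits g S + t : ℕ) : ℤ) then 1 else 0) (modBits g S)

/-- The output for a row of the basis matrix. -/
def rowOut (r : ℕ) : List ℤ :=
  (List.range (numCoef g S + 1)).flatMap fun c => [entryVal g S μ r c, 1]

namespace Prog

/-- Determine the parameters of the current row. -/
def rowSetup (D β J : ℕ) : Prog :=
  seq (sub 27 3 20) <| ite 27 (block [const 24 D, const 25 0, const 26 0]) <|
  seq (sub 27 11 20) <| ite 27 (block [const 24 (2 * (D * β)), const 26 1, add 27 12 22,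
    load 25 0 27, ite 25 (const 25 (D * β)) (const 25 0)]) <|
  seq (sub 27 8 20) <| ite 27 (block [const 24 D, const 25 J, const 26 0])
    (block [const 24 D, const 25 0, const 26 0])

/-- Add register `v` to the current entry if register `j` holds the number of the current column. -/
def addIfEq (j v : ℕ) : Prog :=
  seq (sub 33 30 j) <| ite 33 skip <| seq (sub 33 j 30) <| ite 33 skip (add 32 32 v)

/-- Add the contribution of the coefficient of an equation to the current entry. -/
def addCoef (D β : ℕ) : Prog :=
  ite 26 (seq (sub 33 3 30) <| ite 33 (seq (add 33 23 30) <| seq (load 33 0 33) <|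
    ite 33 (seq (const 33 (D * β)) (add 32 32 33)) skip) skip) skip

/-- Output the entry of the current row and column. -/
def column (D β : ℕ) : Prog :=
  seq (const 32 0) <| seq (addIfEq 20 24) <| seq (addIfEq 8 25) <| seq (addCoef D β) <|
  block [emit 32, emit 2, add 30 30 2, sub 31 31 2]

/-- Output the current row. -/
def columns (D β : ℕ) : Prog :=
  seq (block [const 30 0, add 31 16 19]) (loop 31 (column D β))

/-- Move to the next row. -/
def nextRow : Prog :=
  seq (block [sub 27 20 3, add 27 27 2, add 20 20 2, sub 21 21 2]) <|
  ite 27 (seq (block [add 22 22 2, add 23 23 3, sub 27 4 22])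
    (ite 27 skip (block [const 22 0, const 23 2]))) skip

/-- Output all rows but the last one. -/
def rows (D β J : ℕ) : Prog :=
  seq (block [const 20 0, const 22 0, const 23 2, add 21 7 19])
    (loop 21 (seq (rowSetup D β J) (seq (columns D β) nextRow)))

/-- Compute an entry of the last row from the random bits. -/
def readCoef : Prog :=
  seq (block [const 30 0, add 31 10 19, add 32 6 19]) <|
  loop 32 (seq (load 33 1 20) <| seq (ite 33 (add 30 30 31) skip) <|
    block [add 31 31 31, add 20 20 2, sub 32 32 2])

/-- Output the last row, except for its last entry. -/
def lastRow : Prog :=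
  seq (block [const 20 0, add 21 7 19])
    (loop 21 (seq readCoef (block [emit 30, emit 2, sub 21 21 2])))

/-- The program of the reduction. -/
def reduction (a N ρ D β J : ℕ) : Prog :=
  seq (setup a N ρ) <| seq (block [emit 16, emit 16]) <| seq (rows D β J) <| seq lastRow <|
  block [emit 18, emit 2, emit 17, emit 2]

end Prog

variable {g S μ}

theorem halts_rowSetup {s : RAMState} (h : Globals g S μ s) {r : ℕ} (h20 : s.reg 20 = r)
    (h22 : s.reg 22 = ((r - S.n) % S.m : ℕ)) :
    Halts (rowSetup g.D g.β g.J) s 30 fun s' => s'.out = s.out ∧ s'.reg 24 = rowDiag g S r ∧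
      s'.reg 25 = rowConst g S μ r ∧ s'.reg 26 = rowFlag S r := by
  refine (Halts.of_exec (by rfl) ?_).mono (by simp only [rowSetup, block, cost]; omega)
    fun s' h => h
  by_cases h1 : r < S.n
  · have h1' : (r : ℤ) < S.n := by exact_mod_cast h1
    simp [rowSetup, block, exec, RAMState.reg_setReg, h.n, h20, rowDiag, rowConst, rowFlag, h1]
  by_cases h2 : r < S.n + S.M
  · have h2' : (r : ℤ) < S.n + S.M := by exact_mod_cast h2
    by_cases h3 : 0 < μ 0 ((2 + S.m * S.n + (r - S.n) % S.m : ℕ) : ℤ)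
    all_goals
      have h3' := h3
      push_cast at h3
      simp [rowSetup, block, exec, RAMState.reg_setReg, h.n, h.zStart, h.bStart, h.mem, h20, h22,
        rowDiag, rowConst, rowFlag, h1, h2, h2', h3]
  by_cases h3 : r < S.n + S.M + S.M * g.N
  all_goals
    have h2' : ¬ (r : ℤ) < S.n + S.M := by exact_mod_cast h2
    have h3' := h3
    zify at h3'
    simp [rowSetup, block, exec, RAMState.reg_setReg, h.n, h.zStart, h.sCol, h20, rowDiag, rowConst,
      rowFlag, h1, h2, h2', h3, h3']

/-- Equality is decided by two positivity tests, one on each difference; the bounds on j and v keep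
them away from the scratch registers. -/
theorem halts_addIfEq {s : RAMState} {j v : ℕ} (hj : j < 30) (hv : v < 30) :
    Halts (addIfEq j v) s 7 fun s' => s'.out = s.out ∧
      s'.reg 32 = s.reg 32 + (if s.reg 30 = s.reg j then s.reg v else 0) ∧
      s'.reg 30 = s.reg 30 ∧ s'.reg 31 = s.reg 31 := by
  refine (Halts.of_exec (by rfl) ?_).mono (by simp only [addIfEq, cost]; omega) fun s' h => h
  have hj' : j ≠ 33 := by omega
  have hv' : v ≠ 33 := by omega
  rcases lt_trichotomy (s.reg 30) (s.reg j) with h | h | h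
  · simp [addIfEq, exec, RAMState.reg_setReg, h, h.not_gt, h.ne, hj']
  · simp [addIfEq, exec, RAMState.reg_setReg, h, hj', hv']
  · simp [addIfEq, exec, RAMState.reg_setReg, h, h.ne']

theorem halts_addCoef {s : RAMState} (h : Globals g S μ s) {r c : ℕ} (h26 : s.reg 26 = rowFlag S r)
    (h23 : s.reg 23 = (2 + (r - S.n) % S.m * S.n : ℕ)) (h30 : s.reg 30 = c) :
    Halts (addCoef g.D g.β) s 14 fun s' => s'.out = s.out ∧
      s'.reg 32 = s.reg 32 + (if 0 < rowFlag S r ∧ c < S.n ∧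
        0 < μ 0 ((2 + (r - S.n) % S.m * S.n + c : ℕ) : ℤ) then (g.D * g.β : ℤ) else 0) ∧
      s'.reg 30 = s.reg 30 ∧ s'.reg 31 = s.reg 31 := by
  refine (Halts.of_exec (by rfl) ?_).mono (by simp only [addCoef, cost]; omega) fun s' h => h
  have hc : s.reg 30 < S.n ↔ c < S.n := by rw [h30, Nat.cast_lt]
  have ha : μ 0 (s.reg 23 + s.reg 30) = μ 0 ((2 + (r - S.n) % S.m * S.n + c : ℕ) : ℤ) := by
    rw [h23, h30]; push_cast; rfl
  generalize μ 0 ((2 + (r - S.n) % S.m * S.n + c : ℕ) : ℤ) = b at ha ⊢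
  by_cases h1 : 0 < rowFlag S r
  · by_cases h2 : c < S.n
    · by_cases h3 : 0 < b <;>
        simp [addCoef, exec, h26, h1, h.n, h.mem, hc, h2, ha, h3, RAMState.reg_setReg]
    · simp [addCoef, exec, RAMState.reg_setReg, h26, h1, h.n, hc, h2]
  · simp [addCoef, exec, h26, h1]

theorem halts_columns {s : RAMState} (h : Globals g S μ s) {r : ℕ} (h20 : s.reg 20 = r)
    (h23 : s.reg 23 = (2 + (r - S.n) % S.m * S.n : ℕ)) (h24 : s.reg 24 = rowDiag g S r)
    (h25 : s.reg 25 = rowConst g S μ r) (h26 : s.reg 26 = rowFlag S r) :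
    Halts (columns g.D g.β) s ((numCoef g S + 1) * 35 + 4) fun s' =>
      s'.out = s.out ++ rowOut g S μ r ∧ s'.mem = s.mem ∧ ∀ i < 30, s'.reg i = s.reg i := by
  refine Halts.mono (T := 3 + ((numCoef g S + 1) * (34 + 1) + 1)) (Halts.seq
    ((Halts.of_exec (by rfl) (Q := fun s' => s'.out = s.out ∧ s'.reg 30 = 0 ∧
      s'.reg 31 = (numCoef g S + 1 : ℕ)) (by
        simp [block, exec, RAMState.reg_setReg, h.rank, h.zero])).keeps 30 (by decide)) ?_)
    (by omega) fun s' h => h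
  rintro s₁ ⟨⟨ho, hr30, hr31⟩, hm, hr⟩
  refine Halts.mono (Halts.loop (i := 31) (K := numCoef g S + 1) (T := 34) (fun c s' =>
    (s'.out = s.out ++ (List.range c).flatMap (fun c => [entryVal g S μ r c, 1]) ∧
      s'.mem = s.mem ∧ ∀ i < 30, s'.reg i = s.reg i) ∧ s'.reg 30 = c ∧
      s'.reg 31 = (numCoef g S + 1 : ℕ) - c) ?_ ?_ ?_ ?_) le_rfl fun s' hs' => hs'.1
  · rintro c hc s' ⟨-, -, h⟩
    rw [h]; omega
  · rintro s' ⟨-, -, h⟩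
    rw [h]; omega
  · rintro c hc s₂ ⟨⟨fo, fm, fr⟩, f30, f31⟩
    have G₂ : Globals g S μ s₂ := h.of_eq fm fun i hi => fr i (by omega)
    refine Halts.mono (T := 1 + (7 + (7 + (14 + 5)))) (Halts.seq
      ((Halts.of_exec (by rfl) (Q := fun s' => s'.out = s₂.out ∧ s'.reg 32 = 0 ∧
        s'.reg 30 = s₂.reg 30 ∧ s'.reg 31 = s₂.reg 31) (by
          simp [exec, RAMState.reg_setReg])).keeps 30 (by decide)) ?_)
      (by omega) fun s' h => h
    rintro s₃ ⟨⟨ao, a32, a30, a31⟩, am, ar⟩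
    refine Halts.seq ((halts_addIfEq (by norm_num) (by norm_num)).keeps 30 (by decide)) ?_
    rintro s₄ ⟨⟨bo, b32, b30, b31⟩, bm, br⟩
    refine Halts.seq ((halts_addIfEq (by norm_num) (by norm_num)).keeps 30 (by decide)) ?_
    rintro s₅ ⟨⟨co, c32, c30, c31⟩, cm, cr⟩
    have R₅ : ∀ i < 30, s₅.reg i = s₂.reg i := fun i hi => by rw [cr i hi, br i hi, ar i hi]
    have G₅ : Globals g S μ s₅ :=
      G₂.of_eq (by rw [cm, bm, am]) fun i hi => R₅ i (by omega)
    refine Halts.seq ((halts_addCoef G₅ (r := r) (c := c) (by rw [R₅ _ (by norm_num), fr _ (by norm_num), h26])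
      (by rw [R₅ _ (by norm_num), fr _ (by norm_num), h23]) (by rw [c30, b30, a30, f30])).keeps 30
        (by rfl)) ?_
    rintro s₆ ⟨⟨eo, e32, e30, e31⟩, em, er⟩
    have R₆ : ∀ i < 30, s₆.reg i = s.reg i := fun i hi => by rw [er i hi, R₅ i hi, fr i hi]
    have hval : s₆.reg 32 = entryVal g S μ r c := by
      rw [e32, c32, b32, a32, b30, a30, f30, br 8 (by norm_num), br 25 (by norm_num),
        ar 8 (by norm_num), ar 20 (by norm_num), ar 24 (by norm_num), ar 25 (by norm_num),
        fr 8 (by norm_num), fr 20 (by norm_num), fr 24 (by norm_num), fr 25 (by norm_num), h20, h24,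
        h25, h.sCol, zero_add, entryVal]
      simp only [Nat.cast_inj]
    have hone : s₆.reg 2 = 1 := by rw [R₆ _ (by norm_num), h.one]
    refine Halts.of_exec (by rfl) ⟨⟨?_, ?_, ?_⟩, ?_, ?_⟩
    · simp [block, exec, hval, hone, eo, co, bo, ao, fo, List.range_succ, RAMState.reg_setReg]
    · simp [block, exec, em, cm, bm, am, fm]
    · intro i hi
      have h1 : i ≠ 30 := by omega
      have h2 : i ≠ 31 := by omega
      simp [block, exec, RAMState.reg_setReg, h1, h2, R₆ i hi]
    · simp [block, exec, RAMState.reg_setReg, e30, c30, b30, a30, f30, hone]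
    · simp [block, exec, RAMState.reg_setReg, e31, c31, b31, a31, f31, hone]
      ring
  · refine ⟨⟨by simpa using ho, hm, hr⟩, by simpa using hr30, by simpa using hr31⟩

/-- A counter wrapping at m replaces the remainder, and the address of the equation follows it; both
stay at their start until row n is reached. -/
theorem halts_nextRow {s : RAMState} (h : Globals g S μ s) {r : ℕ} (h20 : s.reg 20 = r)
    (h22 : s.reg 22 = ((r - S.n) % S.m : ℕ)) (h23 : s.reg 23 = (2 + (r - S.n) % S.m * S.n : ℕ)) :
    Halts nextRow s 20 fun s' => s'.out = s.out ∧ s'.reg 20 = (r + 1 : ℕ) ∧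
      s'.reg 21 = s.reg 21 - 1 ∧ s'.reg 22 = ((r + 1 - S.n) % S.m : ℕ) ∧
      s'.reg 23 = (2 + (r + 1 - S.n) % S.m * S.n : ℕ) := by
  refine (Halts.of_exec (by rfl) ?_).mono (by simp only [nextRow, block, cost]; omega)
    fun s' h => h
  have hm := S.m_pos
  by_cases h1 : S.n ≤ r
  · have h1' : (0 : ℤ) < r - S.n + 1 := by omega
    set e := r - S.n with he
    have he' : r + 1 - S.n = e + 1 := by omega
    have hlt := Nat.mod_lt e hm
    have hmod : (e + 1) % S.m = if e % S.m + 1 < S.m then e % S.m + 1 else 0 := by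
      split_ifs with hlt'
      · rw [Nat.add_mod, Nat.mod_eq_of_lt (show 1 < S.m by omega), Nat.mod_eq_of_lt hlt']
      · rw [Nat.add_mod, show e % S.m = S.m - 1 by omega]
        rcases Nat.lt_or_ge 1 S.m with h2 | h2
        · rw [Nat.mod_eq_of_lt h2, Nat.sub_add_cancel hm, Nat.mod_self]
        · rw [show S.m = 1 by omega]
    rw [he', hmod]
    generalize e % S.m = f at *
    have hf : (f : ℤ) + 1 < S.m ↔ f + 1 < S.m := by norm_cast
    by_cases h2 : f + 1 < S.m
    · simp [nextRow, block, exec, RAMState.reg_setReg, h.n, h.m, h.one, h20, h22, h23, h1', hf, h2]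
      ring
    · simp [nextRow, block, exec, RAMState.reg_setReg, h.n, h.m, h.one, h20, h22, h23, h1', hf, h2]
  · have h1' : ¬ (0 : ℤ) < r - S.n + 1 := by omega
    have e1 : r - S.n = 0 := by omega
    have e2 : r + 1 - S.n = 0 := by omega
    rw [e1] at h22 h23
    simp [nextRow, block, exec, RAMState.reg_setReg, h.n, h.one, h20, h22, h23, h1', e2]

theorem halts_rows {s : RAMState} (h : Globals g S μ s) :
    Halts (rows g.D g.β g.J) s (numCoef g S * ((numCoef g S + 1) * 35 + 55) + 6) fun s' =>
      Globals g S μ s' ∧ s'.out = s.out ++ (List.range (numCoef g S)).flatMap (rowOut g S μ) := by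
  refine Halts.mono (T := 5 + (numCoef g S * ((30 + (((numCoef g S + 1) * 35 + 4) + 20)) + 1) + 1))
    (Halts.seq ((Halts.of_exec (by rfl) (Q := fun s' => s'.out = s.out ∧ s'.reg 20 = 0 ∧
      s'.reg 22 = 0 ∧ s'.reg 23 = 2 ∧ s'.reg 21 = numCoef g S) (by
        simp [block, exec, RAMState.reg_setReg, h.num, h.zero])).keeps 20 (by decide)) ?_)
    (by ring_nf; omega) fun s' h => h
  rintro s₁ ⟨⟨ho, h20, h22, h23, h21⟩, hm, hr⟩
  refine Halts.mono (Halts.loop (i := 21) (K := numCoef g S)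
    (T := 30 + (((numCoef g S + 1) * 35 + 4) + 20)) (fun r s' =>
    (Globals g S μ s' ∧ s'.out = s.out ++ (List.range r).flatMap (rowOut g S μ)) ∧
      s'.reg 20 = r ∧ s'.reg 21 = numCoef g S - r ∧ s'.reg 22 = ((r - S.n) % S.m : ℕ) ∧
      s'.reg 23 = (2 + (r - S.n) % S.m * S.n : ℕ)) ?_ ?_ ?_ ?_) le_rfl fun s' hs' => hs'.1
  · rintro c hc s' ⟨-, -, h, -⟩
    rw [h]; omega
  · rintro s' ⟨-, -, h, -⟩
    rw [h]; omega
  · rintro r hr s₂ ⟨⟨G₂, fo⟩, f20, f21, f22, f23⟩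
    refine Halts.seq ((halts_rowSetup G₂ f20 f22).keeps 24 (by rfl)) ?_
    rintro s₃ ⟨⟨ao, a24, a25, a26⟩, am, ar⟩
    have G₃ : Globals g S μ s₃ := G₂.of_eq am fun i hi => ar i (by omega)
    refine Halts.seq (halts_columns G₃ (r := r) (by rw [ar _ (by norm_num), f20])
      (by rw [ar _ (by norm_num), f23]) a24 a25 a26) ?_
    rintro s₄ ⟨bo, bm, br⟩
    have G₄ : Globals g S μ s₄ := G₃.of_eq bm fun i hi => br i (by omega)
    have R₄ : ∀ i < 24, s₄.reg i = s₂.reg i := fun i hi => by rw [br i (by omega), ar i hi]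
    refine Halts.mono ((halts_nextRow G₄ (r := r) (by rw [R₄ _ (by norm_num), f20])
      (by rw [R₄ _ (by norm_num), f22]) (by rw [R₄ _ (by norm_num), f23])).keeps 20 (by decide))
      le_rfl ?_
    rintro s₅ ⟨⟨co, c20, c21, c22, c23⟩, cm, cr⟩
    refine ⟨⟨G₄.of_eq cm cr, ?_⟩, c20, ?_, c22, c23⟩
    · simp [co, bo, ao, fo, List.range_succ]
    · rw [c21, R₄ _ (by norm_num), f21]; push_cast; ring
  · refine ⟨⟨h.of_eq hm hr, by simpa using ho⟩, by simpa using h20, by simpa using h21, ?_, ?_⟩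
    · simpa using h22
    · simpa using h23

/-- The running power of 2 starts at q instead of 1, so the scaled entry is assembled without
multiplication. -/
theorem halts_readCoef {s : RAMState} (h : Globals g S μ s) {c : ℕ}
    (h20 : s.reg 20 = (c * modBits g S : ℕ)) :
    Halts readCoef s (modBits g S * 10 + 5) fun s' => s'.out = s.out ∧
      s'.reg 30 = 2 ^ modBits g S * coefVal g S μ c ∧ s'.reg 21 = s.reg 21 ∧
      s'.reg 20 = ((c + 1) * modBits g S : ℕ) := by
  refine Halts.mono (T := 4 + (modBits g S * (9 + 1) + 1)) (Halts.seq
    ((Halts.of_exec (by rfl) (Q := fun s' => s'.out = s.out ∧ s'.reg 20 = s.reg 20 ∧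
      s'.reg 21 = s.reg 21 ∧ s'.reg 30 = 0 ∧ s'.reg 31 = 2 ^ modBits g S ∧
      s'.reg 32 = modBits g S) (by
        simp [block, exec, RAMState.reg_setReg, h.bits, h.q, h.zero])).keeps 20 (by decide)) ?_)
    (by omega) fun s' h => h
  rintro s₁ ⟨⟨ho, k20, k21, k30, k31, k32⟩, hm, hr⟩
  refine Halts.mono (Halts.loop (i := 32) (K := modBits g S) (T := 9) (fun t s' =>
    (s'.out = s.out ∧ s'.reg 30 = 2 ^ modBits g S *
        binVal (fun t => if 0 < μ 1 ((c * modBits g S + t : ℕ) : ℤ) then 1 else 0) t ∧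
      s'.reg 21 = s.reg 21 ∧ s'.reg 20 = (c * modBits g S + t : ℕ)) ∧
      s'.reg 31 = 2 ^ modBits g S * 2 ^ t ∧ s'.reg 32 = modBits g S - t ∧ s'.reg 2 = 1 ∧
      s'.mem = μ) ?_ ?_ ?_ ?_) le_rfl ?_
  · rintro t ht s' ⟨-, -, h, -⟩
    rw [h]; omega
  · rintro s' ⟨-, -, h, -⟩
    rw [h]; omega
  · rintro t ht s₂ ⟨⟨fo, f30, f21, f20⟩, f31, f32, f2, fm⟩
    refine (Halts.of_exec (by rfl) ?_).mono (by simp only [block, cost]; omega) fun s' h => h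
    have hμ : μ 1 (s₂.reg 20) = μ 1 ((c * modBits g S + t : ℕ) : ℤ) := by rw [f20]
    rw [binVal, Finset.sum_range_succ, ← binVal]
    generalize binVal (fun t => if 0 < μ 1 ((c * modBits g S + t : ℕ) : ℤ) then 1 else 0) t = B at *
    generalize μ 1 ((c * modBits g S + t : ℕ) : ℤ) = b at *
    have h20' : s₂.reg 20 + 1 = (c * modBits g S + (t + 1) : ℕ) := by rw [f20]; push_cast; ring
    have h32' : s₂.reg 32 - 1 = modBits g S - (t + 1 : ℕ) := by rw [f32]; push_cast; ring
    by_cases hb : 0 < b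
    all_goals
      simp only [block, exec, RAMState.reg_setReg, RAMState.mem_setReg, fm, hμ, hb, if_true, if_false]
      simp [-Nat.cast_add, fo, f21, f2, h20', h32', f30, f31, mul_add]
      ring
  · refine ⟨⟨ho, by simpa [binVal] using k30, k21, by simpa [h20] using k20⟩, by simpa using k31,
      by simpa using k32, ?_, by rw [hm, h.mem]⟩
    rw [hr _ (by norm_num), h.one]
  · rintro s' ⟨⟨fo, f30, f21, f20⟩, -⟩
    exact ⟨fo, f30, f21, by rw [f20]; push_cast; ring⟩

theorem halts_lastRow {s : RAMState} (h : Globals g S μ s) :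
    Halts lastRow s (numCoef g S * (modBits g S * 10 + 10) + 4) fun s' => Globals g S μ s' ∧
      s'.out = s.out ++ (List.range (numCoef g S)).flatMap fun c =>
        [2 ^ modBits g S * (coefVal g S μ c : ℤ), 1] := by
  refine Halts.mono (T := 3 + (numCoef g S * (((modBits g S * 10 + 5) + 4) + 1) + 1)) (Halts.seq
    ((Halts.of_exec (by rfl) (Q := fun s' => s'.out = s.out ∧ s'.reg 20 = 0 ∧
      s'.reg 21 = numCoef g S) (by
        simp [block, exec, RAMState.reg_setReg, h.num, h.zero])).keeps 20 (by decide)) ?_)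
    (by ring_nf; omega) fun s' h => h
  rintro s₁ ⟨⟨ho, k20, k21⟩, hm, hr⟩
  refine Halts.mono (Halts.loop (i := 21) (K := numCoef g S) (T := (modBits g S * 10 + 5) + 4)
    (fun c s' => (Globals g S μ s' ∧ s'.out = s.out ++ (List.range c).flatMap fun c =>
        [2 ^ modBits g S * (coefVal g S μ c : ℤ), 1]) ∧
      s'.reg 20 = (c * modBits g S : ℕ) ∧ s'.reg 21 = numCoef g S - c) ?_ ?_ ?_ ?_) le_rfl
    fun s' hs' => hs'.1
  · rintro t ht s' ⟨-, -, h⟩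
    rw [h]; omega
  · rintro s' ⟨-, -, h⟩
    rw [h]; omega
  · rintro c hc s₂ ⟨⟨G₂, fo⟩, f20, f21⟩
    refine Halts.seq ((halts_readCoef G₂ f20).keeps 20 (by decide)) ?_
    rintro s₃ ⟨⟨ao, a30, a21, a20⟩, am, ar⟩
    have G₃ : Globals g S μ s₃ := G₂.of_eq am ar
    refine Halts.mono ((Halts.of_exec (by rfl) (Q := fun s' => s'.out = s₃.out ++ [s₃.reg 30, 1] ∧
      s'.reg 20 = s₃.reg 20 ∧ s'.reg 21 = s₃.reg 21 - 1) (by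
        simp [block, exec, RAMState.reg_setReg, G₃.one])).keeps 20 (by decide)) le_rfl ?_
    rintro s₄ ⟨⟨bo, b20, b21⟩, bm, br⟩
    refine ⟨⟨G₃.of_eq bm br, ?_⟩, ?_, ?_⟩
    · simp [bo, a30, ao, fo, List.range_succ]
    · rw [b20, a20]
    · rw [b21, a21, f21]; push_cast; ring
  · exact ⟨⟨h.of_eq hm hr, by simpa using ho⟩, by simpa using k20, by simpa using k21⟩

/-- The program writes the encoded basis matrix. -/
theorem halts_reduction {s : RAMState} (hs : s.mem = μ) (h0 : μ 0 0 = S.n) (h1 : μ 0 1 = S.m) :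
    Halts (reduction g.a g.N g.ρ g.D g.β g.J) s ((4 * S.n + 4 * S.m + 4 * g.a + 4 * g.N + 4 * g.ρ +
      8 * modBits g S + 50) + (3 + ((numCoef g S * ((numCoef g S + 1) * 35 + 55) + 6) +
      ((numCoef g S * (modBits g S * 10 + 10) + 4) + 5)))) fun s' =>
      s'.out = s.out ++ ([((numCoef g S + 1 : ℕ) : ℤ), (numCoef g S + 1 : ℕ)] ++
        ((List.range (numCoef g S)).flatMap (rowOut g S μ) ++
        ((List.range (numCoef g S)).flatMap (fun c => [2 ^ modBits g S * (coefVal g S μ c : ℤ), 1]) ++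
          [2 ^ modBits g S * 2 ^ modBits g S, 1])) ++ [((g.ρ * S.M : ℕ) : ℤ), 1]) := by
  refine Halts.seq (halts_setup g S hs h0 h1) ?_
  rintro s₁ ⟨G₁, ao⟩
  refine Halts.seq ((Halts.of_exec (by rfl) (Q := fun s' => s'.out = s₁.out ++
    [((numCoef g S + 1 : ℕ) : ℤ), (numCoef g S + 1 : ℕ)]) (by
      simp [block, exec, G₁.rank])).keeps 20 (by decide)) ?_
  rintro s₂ ⟨bo, bm, br⟩
  refine Halts.seq (halts_rows (G₁.of_eq bm br)) ?_
  rintro s₃ ⟨G₃, co⟩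
  refine Halts.seq (halts_lastRow G₃) ?_
  rintro s₄ ⟨G₄, eo⟩
  refine Halts.of_exec (by rfl) ?_
  simp [block, exec, G₄.qq, G₄.one, G₄.rPow, eo, co, bo, ao]

end Output
/-! ### The input and the output of the program -/

theorem List.ofFn_val_eq_map {α : Type*} (n : ℕ) (f : ℕ → α) :
    (List.ofFn fun i : Fin n => f i) = (List.range n).map f := by
  apply List.ext_getElem <;> simp

theorem List.getD_flatten_ofFn {α : Type*} {m n : ℕ} (f : Fin m → Fin n → α) (i : Fin m)
    (j : Fin n) (l : List α) (d : α) :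
    ((List.ofFn fun i => List.ofFn fun j => f i j).flatten ++ l).getD (i * n + j) d = f i j := by
  have h : (List.ofFn fun i => List.ofFn fun j => f i j).flatten =
      List.ofFn fun c : Fin (m * n) => f c.divNat c.modNat := by
    rw [List.ofFn_mul]
    congr 2
    funext i
    congr 1
    funext j
    congr 1
    · ext; simp [Fin.divNat, Nat.add_mul_div_right, j.pos, Nat.add_comm]
    · ext; simp [Fin.modNat, Nat.mod_eq_of_lt]
  have hlt : (i * n + j : ℕ) < m * n := by
    calc (i * n + j : ℕ) < i * n + n := by omega
      _ = (i + 1) * n := by ring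
      _ ≤ m * n := Nat.mul_le_mul_right _ i.2
  rw [h, List.getD_append _ _ _ _ (by simpa using hlt),
    List.getD_eq_getElem _ _ (by simpa using hlt), List.getElem_ofFn]
  congr 1
  · ext; simp [Fin.divNat, Nat.add_mul_div_right, j.pos, Nat.add_comm]
  · ext; simp [Fin.modNat, Nat.mod_eq_of_lt]

section Link

variable {p ε : ℝ} (g : Gadget p ε) (S : LinSystem)

theorem length_encode : S.encode.length = 2 + S.m * S.n + S.m := by
  simp [LinSystem.encode, List.length_flatten, List.map_ofFn, Function.comp_def]
  ring

theorem mem_init_coef {k : ℕ} (ρ : Fin k → Bool) (i : Fin S.m) (j : Fin S.n) :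
    (RAMState.init S.encode ρ).mem 0 ((2 + i * S.n + j : ℕ) : ℤ) = (S.A i j).val := by
  have := List.getD_flatten_ofFn (fun i j => ((S.A i j).val : ℤ)) i j
    (List.ofFn fun i => ((S.b i).val : ℤ)) 0
  simp only [RAMState.init, true_and, Int.toNat_natCast, if_pos (Int.natCast_nonneg _)]
  rw [← this, LinSystem.encode, List.append_assoc, show 2 + i * S.n + j = (i * S.n + j) + 1 + 1 by ring]
  rfl

theorem mem_init_rhs {k : ℕ} (ρ : Fin k → Bool) (i : Fin S.m) :
    (RAMState.init S.encode ρ).mem 0 ((2 + S.m * S.n + i : ℕ) : ℤ) = (S.b i).val := by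
  simp only [RAMState.init, true_and, Int.toNat_natCast, if_pos (Int.natCast_nonneg _)]
  have h : ([(S.n : ℤ), (S.m : ℤ)] ++ (List.ofFn fun i => List.ofFn fun j =>
      ((S.A i j).val : ℤ)).flatten).length = 2 + S.m * S.n := by
    simp [List.length_flatten, List.map_ofFn, Function.comp_def]
    ring
  rw [LinSystem.encode, List.getD_append_right _ _ _ _ (by rw [h]; omega), h,
    Nat.add_sub_cancel_left, List.getD_eq_getElem _ _ (by simp), List.getElem_ofFn]

theorem mem_init_coin {k : ℕ} (ρ : Fin k → Bool) (x : List ℤ) (j : ℕ) :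
    (if 0 < (RAMState.init x ρ).mem 1 (j : ℤ) then 1 else 0) = coinBit ρ j := by
  simp only [RAMState.init, one_ne_zero, false_and, if_false, true_and, Int.toNat_natCast,
    if_pos (Int.natCast_nonneg _), coinBit]
  by_cases h : j < k
  · cases hρ : ρ ⟨j, h⟩ <;> simp [h, hρ]
  · simp [h]

theorem coefVal_init {k : ℕ} (ρ : Fin k → Bool) (x : List ℤ) (i : Fin (numCoef g S)) :
    coefVal g S (RAMState.init x ρ).mem i = coinCoef g S ρ i := by
  simp only [coefVal, coinCoef, mem_init_coin]

/-- The number of a row or column of the basis matrix. -/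
def idxVal : CoefIndex (Fin S.n) (Fin S.M) g.N ⊕ Fin 1 → ℕ
  | .inl (.inl (.inl (.inl i))) => i
  | .inl (.inl (.inl (.inr y))) => S.n + y
  | .inl (.inl (.inr r)) => S.n + S.M + (r.2 + g.N * r.1)
  | .inl (.inr _) => S.n + S.M + S.M * g.N
  | .inr _ => numCoef g S

theorem idxEquiv_val (r : CoefIndex (Fin S.n) (Fin S.M) g.N ⊕ Fin 1) :
    (idxEquiv g S r : ℕ) = idxVal g S r := by
  rcases r with (((i | i) | i) | i) | i
  · rfl
  · rfl
  · rfl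
  · rw [Subsingleton.elim i 0]; rfl
  · simp [idxEquiv, idxVal]

theorem idxVal_z_lt (r : Fin S.M × Fin g.N) : (r.2 + g.N * r.1 : ℕ) < S.M * g.N :=
  (finProdFinEquiv r).2

theorem idxVal_injective : Function.Injective (idxVal g S) := fun r c h =>
  (idxEquiv g S).injective (Fin.ext (by rw [idxEquiv_val, idxEquiv_val, h]))

theorem mul_zmod_two_val (D : ℤ) (a : ZMod 2) :
    D * a.val = if 0 < (a.val : ℤ) then D else 0 := by
  have := a.val_lt
  split_ifs with h
  · rw [show a.val = 1 by omega]; simp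
  · rw [show a.val = 0 by omega]; simp

-- The program adds three contributions to an entry: diagonal, column of s, and coefficient of an
-- equation. At each position at most one is nonzero, so the sum is the case distinction of
-- `basisEntry`.
variable {g S} in
theorem basisEntry_eq_entryVal {k : ℕ} (ρ : Fin k → Bool) (q : ℤ)
    (cv : CoefIndex (Fin S.n) (Fin S.M) g.N → ℤ) (r : CoefIndex (Fin S.n) (Fin S.M) g.N)
    (c : CoefIndex (Fin S.n) (Fin S.M) g.N ⊕ Fin 1) :
    basisEntry g S.repA S.repB q cv (.inl r) c =
      entryVal g S (RAMState.init S.encode ρ).mem (idxVal g S (.inl r)) (idxVal g S c) := by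
  have hdiag : (idxVal g S c = idxVal g S (.inl r)) = (c = .inl r) :=
    propext (idxVal_injective g S).eq_iff
  have hs : (idxVal g S c = S.n + S.M + S.M * g.N) = (c = .inl (.inr 0)) :=
    propext ((idxVal_injective g S).eq_iff (b := .inl (.inr 0)))
  rw [entryVal]
  simp only [hdiag, hs]
  have hz := idxVal_z_lt g S
  rcases r with ((i | y) | t) | e
  · have h1 : idxVal g S (.inl (.inl (.inl (.inl i)))) < S.n := i.2
    simp only [rowDiag, rowConst, rowFlag, h1, if_true, ite_self, lt_irrefl, false_and, if_false,
      add_zero]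
    rcases c with (((j | y) | t) | e) | e <;> simp [basisEntry, eq_comm]
  · have h1 : ¬ idxVal g S (.inl (.inl (.inl (.inr y)))) < S.n := by simp [idxVal]
    have h2 : idxVal g S (.inl (.inl (.inl (.inr y)))) < S.n + S.M := by simp [idxVal]
    have h3 : (idxVal g S (.inl (.inl (.inl (.inr y)))) - S.n) % S.m = S.eqn y := by
      simp [idxVal, LinSystem.eqn]
    simp only [rowDiag, rowConst, rowFlag, h1, h2, h3, if_true, if_false, one_pos, true_and]
    rw [mem_init_rhs]
    rcases c with (((j | y') | t) | e) | e
    · have h4 : idxVal g S (.inl (.inl (.inl (.inl j)))) = j := rfl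
      rw [h4, mem_init_coef]
      simp [-ZMod.natCast_val, basisEntry, mul_zmod_two_val, LinSystem.repA]
    · simp [basisEntry, idxVal, eq_comm]
    · simp [basisEntry, idxVal]
      omega
    · rw [Subsingleton.elim e 0]
      have h4 : ¬ idxVal g S (.inl (.inr 0)) < S.n := by simp [idxVal]; omega
      simp only [h4, false_and, if_false]
      simp [-ZMod.natCast_val, basisEntry, mul_zmod_two_val, LinSystem.repB]
    · have h4 : ¬ idxVal g S (.inr e) < S.n := by simp [idxVal, numCoef]; omega
      simp [basisEntry, h4]
  · have h1 : ¬ idxVal g S (.inl (.inl (.inr t))) < S.n := by simp [idxVal]; omega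
    have h2 : ¬ idxVal g S (.inl (.inl (.inr t))) < S.n + S.M := by simp [idxVal]
    have h3 : idxVal g S (.inl (.inl (.inr t))) < S.n + S.M + S.M * g.N := by
      have := hz t
      simpa [idxVal]
    simp only [rowDiag, rowConst, rowFlag, h1, h2, h3, if_true, if_false, lt_irrefl, false_and,
      add_zero]
    rcases c with (((j | y) | t) | e) | e
    · simp [basisEntry]
    · simp [basisEntry]
    · simp [basisEntry, eq_comm]
    · rw [Subsingleton.elim e 0]; simp [basisEntry]
    · simp [basisEntry]
  · have h1 : ¬ idxVal g S (.inl (.inr e)) < S.n := by simp [idxVal]; omega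
    have h2 : ¬ idxVal g S (.inl (.inr e)) < S.n + S.M := by simp [idxVal]
    have h3 : ¬ idxVal g S (.inl (.inr e)) < S.n + S.M + S.M * g.N := by simp [idxVal]
    simp only [rowDiag, rowConst, rowFlag, h1, h2, h3, if_false, lt_irrefl, false_and,
      add_zero]
    rw [Subsingleton.elim e 0]
    rcases c with (((j | y) | t) | e) | e
    · simp [basisEntry]
    · simp [basisEntry]
    · simp [basisEntry]
    · rw [Subsingleton.elim e 0]; simp [basisEntry]
    · simp [basisEntry]

/-- The last row of the basis matrix. -/
def lastEntry (cv : ℕ → ℕ) (c : ℕ) : ℤ :=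
  if c < numCoef g S then 2 ^ modBits g S * cv c else 2 ^ modBits g S * 2 ^ modBits g S

theorem basisMatrix_init {k : ℕ} (ρ : Fin k → Bool) (i j : Fin (numCoef g S + 1)) :
    basisMatrix g S (coinCoef g S ρ) i j =
      ((if (i : ℕ) < numCoef g S then entryVal g S (RAMState.init S.encode ρ).mem i j
        else lastEntry g S (coefVal g S (RAMState.init S.encode ρ).mem) j : ℤ) : ℚ) := by
  obtain ⟨r, rfl⟩ := (idxEquiv g S).surjective i
  obtain ⟨c, rfl⟩ := (idxEquiv g S).surjective j
  rw [basisMatrix, Equiv.symm_apply_apply, Equiv.symm_apply_apply]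
  congr 1
  have hl : ∀ r : CoefIndex (Fin S.n) (Fin S.M) g.N,
      (idxEquiv g S (.inl r) : ℕ) = coefEquiv g S r := fun r => rfl
  have hr : ∀ e : Fin 1, (idxEquiv g S (.inr e) : ℕ) = numCoef g S := fun e => by
    rw [idxEquiv_val]; rfl
  rcases r with r | r
  · rw [if_pos (by rw [hl]; exact (coefEquiv g S r).2), basisEntry_eq_entryVal ρ, idxEquiv_val,
      idxEquiv_val]
  · rw [if_neg (by rw [hr]; exact lt_irrefl _), lastEntry]
    rcases c with c | c
    · rw [if_pos (by rw [hl]; exact (coefEquiv g S c).2), hl, coefVal_init]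
      rfl
    · rw [if_neg (by rw [hr]; exact lt_irrefl _)]
      rfl

theorem encode_svpInput {k : ℕ} (ρ : Fin k → Bool) :
    (svpInput g S (coinCoef g S ρ)).encode =
      [((numCoef g S + 1 : ℕ) : ℤ), (numCoef g S + 1 : ℕ)] ++
        ((List.range (numCoef g S)).flatMap (rowOut g S (RAMState.init S.encode ρ).mem) ++
        ((List.range (numCoef g S)).flatMap (fun c =>
          [2 ^ modBits g S * (coefVal g S (RAMState.init S.encode ρ).mem c : ℤ), 1]) ++
          [2 ^ modBits g S * 2 ^ modBits g S, 1])) ++ [((g.ρ * S.M : ℕ) : ℤ), 1] := by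
  set μ := (RAMState.init S.encode ρ).mem with hμ
  have hrow : ∀ i : Fin (numCoef g S + 1), (List.ofFn fun j : Fin (numCoef g S + 1) =>
      [(basisMatrix g S (coinCoef g S ρ) i j).num,
        ((basisMatrix g S (coinCoef g S ρ) i j).den : ℤ)]).flatten =
      (List.range (numCoef g S + 1)).flatMap fun c => [if (i : ℕ) < numCoef g S then
        entryVal g S μ i c else lastEntry g S (coefVal g S μ) c, 1] := fun i => by
    rw [List.flatMap_def, ← List.ofFn_val_eq_map]
    congr 2
    funext j
    rw [basisMatrix_init, Rat.num_intCast, Rat.den_intCast]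
    rfl
  have hmat : (List.ofFn fun i : Fin (numCoef g S + 1) => (List.ofFn fun j : Fin (numCoef g S + 1) =>
      [(basisMatrix g S (coinCoef g S ρ) i j).num,
        ((basisMatrix g S (coinCoef g S ρ) i j).den : ℤ)]).flatten).flatten =
      (List.range (numCoef g S)).flatMap (rowOut g S μ) ++
        ((List.range (numCoef g S)).flatMap (fun c => [2 ^ modBits g S * (coefVal g S μ c : ℤ), 1]) ++
          [2 ^ modBits g S * 2 ^ modBits g S, 1]) := by
    simp only [hrow]
    rw [List.ofFn_val_eq_map (numCoef g S + 1) fun i => (List.range (numCoef g S + 1)).flatMap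
      fun c => [if i < numCoef g S then entryVal g S μ i c else lastEntry g S (coefVal g S μ) c, 1],
      ← List.flatMap_def, List.range_succ, List.flatMap_append]
    congr 1
    · refine List.flatMap_congr fun i hi => ?_
      rw [rowOut, ← List.range_succ]
      refine List.flatMap_congr fun c _ => ?_
      rw [if_pos (List.mem_range.1 hi)]
    · simp only [List.flatMap_singleton, lt_irrefl, if_false, List.flatMap_append, lastEntry]
      congr 1
      refine List.flatMap_congr fun c hc => ?_
      rw [if_pos (List.mem_range.1 hc)]
  rw [SVPInput.encode, ← hmat]
  congr 1

/-! ### Polynomial bounds and the main theorem -/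

theorem length_le_bitSize (x : List ℤ) : x.length ≤ bitSize x := by
  induction x with
  | nil => simp
  | cons a x ih =>
    simp only [bitSize, List.map_cons, List.sum_cons, List.length_cons] at ih ⊢
    omega

/-- The input lists all mn ≥ n entries of A and m entries of b, each contributing at least 1, so
loops running n or m times are polynomial. -/
theorem n_add_m_le_bitSize : S.n + S.m ≤ bitSize S.encode := by
  have h := length_le_bitSize S.encode
  have h1 : S.n ≤ S.m * S.n := Nat.le_mul_of_pos_left _ S.m_pos
  rw [length_encode] at h
  omega

/-- A bound for the rank of the lattice. -/
noncomputable def rankPoly : Polynomial ℕ :=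
  .X + .X + .X * .C g.N + 1

/-- A bound for the bit length of the modulus. -/
noncomputable def bitsPoly : Polynomial ℕ := .C g.a * .X

/-- A bound for the running time. -/
noncomputable def timePoly : Polynomial ℕ :=
  (.C 4 * .X + .C 4 * .X + .C (4 * g.a + 4 * g.N + 4 * g.ρ) + .C 8 * bitsPoly g + .C 50) +
    (.C 3 + ((rankPoly g * ((rankPoly g + 1) * .C 35 + .C 55) + .C 6) +
      ((rankPoly g * (bitsPoly g * .C 10 + .C 10) + .C 4) + .C 5)))

theorem M_le_bitSize : S.M ≤ bitSize S.encode := S.M_le.trans (n_add_m_le_bitSize S)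

theorem numCoef_le_eval : numCoef g S ≤ (rankPoly g).eval (bitSize S.encode) := by
  have h1 := M_le_bitSize S
  have h2 := n_add_m_le_bitSize S
  have h3 := Nat.mul_le_mul_right g.N h1
  simp only [rankPoly, numCoef, Polynomial.eval_add, Polynomial.eval_X, Polynomial.eval_mul,
    Polynomial.eval_C, Polynomial.eval_one]
  omega

theorem modBits_le_eval : modBits g S ≤ (bitsPoly g).eval (bitSize S.encode) := by
  simp only [bitsPoly, modBits, Polynomial.eval_X, Polynomial.eval_mul, Polynomial.eval_C]
  exact Nat.mul_le_mul_left _ (M_le_bitSize S)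

theorem numCoef_mul_modBits_le_eval :
    numCoef g S * modBits g S ≤ (rankPoly g * bitsPoly g).eval (bitSize S.encode) := by
  rw [Polynomial.eval_mul]
  exact Nat.mul_le_mul (numCoef_le_eval g S) (modBits_le_eval g S)

theorem exists_runs_reduction {k : ℕ} (ρ : Fin k → Bool) :
    ∃ t s, Runs (reduction g.a g.N g.ρ g.D g.β g.J) (RAMState.init S.encode ρ) t s ∧
      t ≤ (timePoly g).eval (bitSize S.encode) ∧
      s.out = (svpInput g S (coinCoef g S ρ)).encode := by
  obtain ⟨t, s, hr, ht, ho⟩ := halts_reduction (g := g) (S := S)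
    (s := RAMState.init S.encode ρ) rfl rfl rfl
  refine ⟨t, s, hr, ht.trans ?_, ?_⟩
  · have h1 := numCoef_le_eval g S
    have h2 := modBits_le_eval g S
    have h3 := n_add_m_le_bitSize S
    have h4 : S.n ≤ bitSize S.encode := by omega
    have h5 : S.m ≤ bitSize S.encode := by omega
    simp only [timePoly, Polynomial.eval_add, Polynomial.eval_X, Polynomial.eval_mul,
      Polynomial.eval_C, Polynomial.eval_one]
    rw [add_assoc (4 * S.n + 4 * S.m), add_assoc (4 * S.n + 4 * S.m), mul_comm _ 35, mul_comm _ 35]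
    gcongr
  · rw [ho, encode_svpInput]
    rfl

/-- The reduction that belongs to a gadget. -/
noncomputable def gadgetReduction (hp : 1 ≤ p) {γ : ℝ} (hγ : γ < g.γ) (C : ℕ) :
    RandomizedKarpReduction (maxLin ε C) (svp p γ) where
  prog := reduction g.a g.N g.ρ g.D g.β g.J
  coins := rankPoly g * bitsPoly g
  time := timePoly g
  map x ρ := svpInput g x.1 (coinCoef g x.1 ρ)
  computes x ρ := exists_runs_reduction g x.1 ρ
  map_yes x hx := two_thirds_le_coinProb_yes g x.1 hp (numCoef_mul_modBits_le_eval g x.1) hx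
  map_no x hx := two_thirds_le_coinProb_no g x.1 hp hγ (numCoef_mul_modBits_le_eval g x.1) hx

end Link

theorem mainTheorem6 (p : ℝ) (hp : 2 < p) (ε : ℝ) (hε₀ : 0 < ε) (hε₁ : ε < 1) :
    ∃ γ : ℝ, 1 < γ ∧ ∀ C : ℕ, ∃ C' : ℕ,
      ∃ F : RandomizedKarpReduction (maxLin ε C) (svp p γ),
        ∀ (S : (maxLin ε C).Inst) (ρ : Fin (F.coins.eval (bitSize ((maxLin ε C).encode S))) → Bool),
          (F.map S ρ).rank ≤ C' * S.1.n := by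
  obtain ⟨g⟩ := exists_gadget hp hε₀ hε₁
  have hg := g.one_lt_γ
  -- Any constant strictly between 1 and g.γ would do. In the rank bound, n ≥ 1 absorbs the two
  -- extra columns, those of s and of the modulus.
  refine ⟨(1 + g.γ) / 2, by linarith, fun C => ⟨1 + (1 + C) + (1 + C) * g.N + 2,
    gadgetReduction g (by linarith) (by linarith) C, fun S ρ => ?_⟩⟩
  change numCoef g S.1 + 1 ≤ _
  have h1 : S.1.m ≤ C * S.1.n := S.2
  have h2 := S.1.M_le
  have h3 := S.1.n_pos
  have h4 : S.1.M ≤ (1 + C) * S.1.n := by rw [add_mul, one_mul]; omega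
  have h5 : S.1.M * g.N ≤ (1 + C) * g.N * S.1.n := by
    rw [mul_right_comm]; exact Nat.mul_le_mul_right _ h4
  simp only [numCoef, add_mul (_ + _) _ S.1.n, add_mul 1 _ S.1.n, one_mul] at h4 h5 ⊢
  omega
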